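/- For each $N\ge 1$ let $X_1=X_1^{(N)}$ and $X_2=X_2^{(N)}$ be independent random $N\times N$ complex matrices, each with density proportional to $\exp[-\operatorname{Tr}(X^*X)]$ with respect to Lebesgue measure on the real and imaginary parts of the entries. All these matrices are defined on one probability space; no assumption is made on the joint law for different $N$. Let $\lambda_1,\dots,\lambda_N$ be the squared singular values of $X_1X_2$, counted with multiplicity. Then, almost surely, the scaled empirical measure $$\mu_N:=\frac1N\sum_{i=1}^N\delta_{\lambda_i/N^2}$$ converges, as $N\to\infty$, weakly and in moments (that is, $\int f\,d\mu_N\to\int f\,d\mu$ for every bounded continuous $f:\mathbb R\to\mathbb R$ and for every $f(x)=x^l$, $l=0,1,2,\dots$) to the probability measure $\mu$ on the positive real axis with density $$\frac{d\mu}{dx}(x)=\begin{cases}\frac{4}{27}\,h\!\left(\frac{4x}{27}\right), & x\in\left(0,\frac{27}{4}\right),\\ 0, & \text{elsewhere,}\end{cases}\qquad h(y)=\frac{3\sqrt3}{4\pi}\,\frac{(1+\sqrt{1-y})^{1/3}-(1-\sqrt{1-y})^{1/3}}{y^{2/3}},\quad 0<y<1.$$ Moreover, let $w(x,y)=y^{-1}e^{-x/y-y}$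 for $x,y>0$. There exist monic polynomials $p_j$, $q_k$ of degrees $j$, $k$ ($j,k=0,1,2,\dots$) that satisfy $$\int_0^\infty\!\!\int_0^\infty w(x,y)\,p_j(x)\,q_k(y)\,dx\,dy=\delta_{j,k}\,(j!)^3,$$ and for any such polynomials the correlation kernel $$K_N^{(2)}(x,y)=\sum_{j=0}^{N-1}\frac{1}{(j!)^3}\left(\int_0^\infty w(x,s)\,q_j(s)\,ds\right)p_j(y)$$ satisfies $$\lim_{N\to\infty}N\,K_N^{(2)}(N^2x,N^2x)=\frac{d\mu}{dx}(x)\qquad\text{for every }x>0.$$ -/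

import Mathlib

open MeasureTheory ProbabilityTheory Filter Topology Polynomial

/-- The weight `exp (-Tr (A* A))` on complex `N × N` matrices, as a measure: it has this density
with respect to Lebesgue measure on the real and imaginary parts of the `N²` entries. -/
noncomputable def gaussianWeight (N : ℕ) : Measure (Fin N → Fin N → ℂ) :=
  (volume : Measure (Fin N → Fin N → ℂ)).withDensity fun A =>
    ENNReal.ofReal (Real.exp (-(Matrix.trace ((Matrix.of A).conjTranspose * Matrix.of A)).re))

/-- The Gaussian law on complex `N × N` matrices with density proportional to
`exp (-Tr (A* A))`: the weight above divided by its total mass. -/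
noncomputable def gaussianLaw (N : ℕ) : Measure (Fin N → Fin N → ℂ) :=
  (gaussianWeight N Set.univ)⁻¹ • gaussianWeight N

/-- The squared singular values `λ_i`, `i < N`, of an `N × N` complex matrix,
repeated according to multiplicity. -/
noncomputable def squaredSingularValue {N : ℕ} (A : Matrix (Fin N) (Fin N) ℂ) (i : Fin N) : ℝ :=
  (Matrix.toEuclideanLin A).singularValues i ^ 2

/-- The scaled empirical measure `(1/N) ∑ δ_{λ_i / N²}` of the squared singular values of `A`. -/
noncomputable def scaledEmpiricalMeasure {N : ℕ} (A : Matrix (Fin N) (Fin N) ℂ) : Measure ℝ :=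
  (N : ENNReal)⁻¹ • ∑ i : Fin N, Measure.dirac (squaredSingularValue A i / (N : ℝ) ^ 2)

/-- The function `h`, used for `0 < y < 1` only. -/
noncomputable def hFun (y : ℝ) : ℝ :=
  3 * Real.sqrt 3 / (4 * Real.pi) *
    (((1 + Real.sqrt (1 - y)) ^ (1 / 3 : ℝ) - (1 - Real.sqrt (1 - y)) ^ (1 / 3 : ℝ)) /
      y ^ (2 / 3 : ℝ))

open Classical in
/-- The limiting density: `(4/27) h (4x/27)` on `(0, 27/4)` and `0` elsewhere. -/
noncomputable def limitDensity (x : ℝ) : ℝ :=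
  if x ∈ Set.Ioo (0 : ℝ) (27 / 4) then 4 / 27 * hFun (4 * x / 27) else 0

/-- The measure on the real line with density `limitDensity`. -/
noncomputable def limitMeasure : Measure ℝ :=
  (volume : Measure ℝ).withDensity fun x => ENNReal.ofReal (limitDensity x)

/-- The weight `w(x, y) = y⁻¹ exp (-x / y - y)`, for `x, y > 0`. -/
noncomputable def biorthWeight (x y : ℝ) : ℝ :=
  y⁻¹ * Real.exp (-(x / y) - y)

/-- `p_j` and `q_k` are monic polynomials of degrees `j` and `k` that are biorthogonal with respect
to the weight `w` on `(0, ∞)²`, with squared norms `h_j = (j!)³`. -/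
structure IsBiorthogonalSystem (p q : ℕ → ℝ[X]) : Prop where
  monic_left : ∀ j, (p j).Monic
  natDegree_left : ∀ j, (p j).natDegree = j
  monic_right : ∀ k, (q k).Monic
  natDegree_right : ∀ k, (q k).natDegree = k
  biorthogonal : ∀ j k,
    (∫ y in Set.Ioi (0 : ℝ), ∫ x in Set.Ioi (0 : ℝ),
        biorthWeight x y * (p j).eval x * (q k).eval y) =
      if j = k then (j.factorial : ℝ) ^ 3 else 0

/-- The correlation kernel
`K_N(x, y) = ∑_{j < N} h_j⁻¹ (∫_0^∞ w(x, s) q_j(s) ds) p_j(y)`. -/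
noncomputable def correlationKernel (p q : ℕ → ℝ[X]) (N : ℕ) (x y : ℝ) : ℝ :=
  ∑ j ∈ Finset.range N, 1 / (j.factorial : ℝ) ^ 3 *
    (∫ s in Set.Ioi (0 : ℝ), biorthWeight x s * (q j).eval s) * (p j).eval y

/-! The limit measure. The substitution x = 27u(1-u) turns the density into a combination of beta
densities, so its moments are the Gamma quotients `limitMoment`. They are the Fuss–Catalan numbers:
any sequence whose generating function satisfies M = 1 + zM³ obeys, by the linear equation of
`ternary_ode`, the same two-term recursion.

The random matrices. The l-th moment of the empirical measure is a normalized trace of an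
alternating word in X₁*X₁ and X₂X₂*. Gaussian integration by parts yields the Schwinger–Dyson
equation (`schwinger_dyson`) for expectations of products of such traces: splitting a trace keeps
the power of N, merging two traces costs N⁻². By induction on the number of letters, expectations
factor up to O(N⁻²) (`schwinger_dyson_asymptotics`), and the limits for alternating words satisfy M
= 1 + zM³. Applied to a word and to its double, this bounds the mean square deviation of each moment
by C/N². That is summable, so convergence is almost sure whatever the joint law for different N.
Since the limit has bounded support, weak convergence follows.

The kernel. Integrating out x reduces biorthogonality to Laguerre orthogonality, so p and q are
unique and explicit. At scaled argument y, the polynomial factor of the j-th summand is the average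
of I₀(2Nz)(1-y/z²)^j over a circle |z| = ρ. The other factor is -1/π times the imaginary part of the
integral of 2K₀(2Nζ)·2ζ·ζ^{2j}/(ζ²-y)^{j+1} along a path in the first quadrant that passes over √y:
half of a Cauchy integral. The sum over j is geometric. Its upper end leaves a remainder controlled
by the N-th power of the ratio of `growthRate` at z to `growthRate` at ζ; its lower end gives, by
Cauchy's formula, -I₀(2Nζ)/y inside the disk and 0 outside.

The circle and the path are taken through a saddle a + bi of 2ζ + log(1-y/ζ²), a root of ζ³ - yζ + y
= 0, where the growth rate is maximal along the circle and minimal along the path. The remainder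
then disappears. As N·2K₀(2Nζ)·I₀(2Nζ)·2ζ tends to 1 (`tendsto_macdonald_mul_besselSeries`), what is
left is -1/y times the displacement from the real axis to the saddle, and the limit is b/(πy).
Cardano's formula identifies this with the density (`exists_isBulkPoint`). For y ≥ 27/4 the path
starts on the circle at 3/2 and stays outside the disk, so the limit is 0. -/

/-! ### Beta integrals and the moments of the limit measure. -/

theorem intervalIntegrable_beta {α β : ℝ} (hα : 0 < α) (hβ : 0 < β) :
    IntervalIntegrable (fun u : ℝ => u ^ (α - 1) * (1 - u) ^ (β - 1)) volume 0 1 := by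
  have h := Complex.betaIntegral_convergent (u := (α : ℂ)) (v := (β : ℂ)) (by simpa) (by simpa)
  have h2 := h.1.re
  rw [intervalIntegrable_iff_integrableOn_Ioc_of_le zero_le_one]
  refine IntegrableOn.congr_fun h2 ?_ measurableSet_Ioc
  intro x hx
  have e1 : ((x : ℂ) ^ ((α : ℂ) - 1)) = ((x ^ (α - 1) : ℝ) : ℂ) := by
    rw [Complex.ofReal_cpow hx.1.le]; push_cast; rfl
  have e2 : ((1 - (x : ℂ)) ^ ((β : ℂ) - 1)) = (((1 - x) ^ (β - 1) : ℝ) : ℂ) := by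
    rw [Complex.ofReal_cpow (by linarith [hx.2])]; push_cast; rfl
  simp only [e1, e2, ← Complex.ofReal_mul]
  simp

theorem integral_beta {α β : ℝ} (hα : 0 < α) (hβ : 0 < β) :
    ∫ u in (0 : ℝ)..1, u ^ (α - 1) * (1 - u) ^ (β - 1) =
      Real.Gamma α * Real.Gamma β / Real.Gamma (α + β) := by
  have h := beta_eq_betaIntegralReal α β hα hβ
  have h2 : Complex.betaIntegral α β =
      ((∫ u in (0 : ℝ)..1, u ^ (α - 1) * (1 - u) ^ (β - 1) : ℝ) : ℂ) := by
    rw [Complex.betaIntegral, ← intervalIntegral.integral_ofReal]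
    refine intervalIntegral.integral_congr fun x hx => ?_
    rw [Set.uIcc_of_le zero_le_one] at hx
    have e1 : ((x : ℂ) ^ ((α : ℂ) - 1)) = ((x ^ (α - 1) : ℝ) : ℂ) := by
      rw [Complex.ofReal_cpow hx.1]; push_cast; rfl
    have e2 : ((1 - (x : ℂ)) ^ ((β : ℂ) - 1)) = (((1 - x) ^ (β - 1) : ℝ) : ℂ) := by
      rw [Complex.ofReal_cpow (by linarith [hx.2])]; push_cast; rfl
    simp only [e1, e2, Complex.ofReal_mul]
  rw [h2, Complex.ofReal_re] at h
  exact h.symm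

/-- The density of the limit measure after the substitution `x = 27 u (1 - u)`. -/
noncomputable def limitProfile (u : ℝ) : ℝ :=
  3 * Real.sqrt 3 / (2 * Real.pi) * ((2 * u - 1) *
    (u ^ (1 / 3 : ℝ) - (1 - u) ^ (1 / 3 : ℝ)) * (u ^ (-2 / 3 : ℝ) * (1 - u) ^ (-2 / 3 : ℝ)))

/-- At x = 27u(1-u) with u > 1/2 the root √(1-4x/27) equals 2u-1, so the two cube roots in `hFun`
become multiples of u^{1/3} and (1-u)^{1/3}. The absolute value is the Jacobian. -/
theorem limitDensity_subst {u : ℝ} (h0 : 1 / 2 < u) (h1 : u < 1) :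
    |27 * (1 - 2 * u)| * limitDensity (27 * (u * (1 - u))) = limitProfile u := by
  have hu : 0 < u := by linarith
  have hv : 0 < 1 - u := by linarith
  have hmem : 27 * (u * (1 - u)) ∈ Set.Ioo (0 : ℝ) (27 / 4) := by
    constructor
    · positivity
    · nlinarith [sq_pos_of_pos (by linarith : (0 : ℝ) < 2 * u - 1)]
  have hs : Real.sqrt (1 - 4 * (27 * (u * (1 - u))) / 27) = 2 * u - 1 := by
    rw [show 1 - 4 * (27 * (u * (1 - u))) / 27 = (2 * u - 1) ^ 2 by ring]
    exact Real.sqrt_sq (by linarith)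
  rw [limitDensity, if_pos hmem, hFun, hs, limitProfile, abs_of_neg (by linarith)]
  have e1 : (1 + (2 * u - 1)) ^ (1 / 3 : ℝ) = 2 ^ (1 / 3 : ℝ) * u ^ (1 / 3 : ℝ) := by
    rw [← Real.mul_rpow (by norm_num) hu.le]; ring_nf
  have e2 : (1 - (2 * u - 1)) ^ (1 / 3 : ℝ) = 2 ^ (1 / 3 : ℝ) * (1 - u) ^ (1 / 3 : ℝ) := by
    rw [← Real.mul_rpow (by norm_num) hv.le]; ring_nf
  have e3 : (4 * (27 * (u * (1 - u))) / 27) ^ (2 / 3 : ℝ) =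
      2 ^ (4 / 3 : ℝ) * (u ^ (2 / 3 : ℝ) * (1 - u) ^ (2 / 3 : ℝ)) := by
    rw [show 4 * (27 * (u * (1 - u))) / 27 = (2 ^ (2 : ℝ) : ℝ) * (u * (1 - u)) by norm_num; ring,
      Real.mul_rpow (by positivity) (by positivity), ← Real.rpow_mul (by norm_num),
      Real.mul_rpow hu.le hv.le]
    norm_num
  have e4 : (2 : ℝ) ^ (4 / 3 : ℝ) = 2 * 2 ^ (1 / 3 : ℝ) := by
    rw [show (4 / 3 : ℝ) = 1 + 1 / 3 by norm_num, Real.rpow_add (by norm_num), Real.rpow_one]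
  have e5 : u ^ (-2 / 3 : ℝ) = (u ^ (2 / 3 : ℝ))⁻¹ := by
    rw [← Real.rpow_neg hu.le]; norm_num
  have e6 : (1 - u) ^ (-2 / 3 : ℝ) = ((1 - u) ^ (2 / 3 : ℝ))⁻¹ := by
    rw [← Real.rpow_neg hv.le]; norm_num
  rw [e1, e2, e3, e4, e5, e6]
  have p1 : (0 : ℝ) < 2 ^ (1 / 3 : ℝ) := by positivity
  have p2 : (0 : ℝ) < u ^ (2 / 3 : ℝ) := by positivity
  have p3 : (0 : ℝ) < (1 - u) ^ (2 / 3 : ℝ) := by positivity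
  have p4 := Real.pi_pos
  field_simp
  ring

theorem limitProfile_symm (u : ℝ) : limitProfile (1 - u) = limitProfile u := by
  simp only [limitProfile, sub_sub_cancel]; ring

/-- Expanding the product of the two differences leaves four beta densities. In each the two
parameters add up to 2l+2, so the four integrals share the denominator Γ(2l+2). -/
theorem limitProfile_mul_pow {u : ℝ} (h0 : 0 < u) (h1 : u < 1) (l : ℕ) :
    (27 * (u * (1 - u))) ^ l * limitProfile u = 3 * Real.sqrt 3 / (2 * Real.pi) * 27 ^ l *
      (u ^ ((l + 5 / 3 : ℝ) - 1) * (1 - u) ^ ((l + 1 / 3 : ℝ) - 1)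
        - u ^ ((l + 4 / 3 : ℝ) - 1) * (1 - u) ^ ((l + 2 / 3 : ℝ) - 1)
        - u ^ ((l + 2 / 3 : ℝ) - 1) * (1 - u) ^ ((l + 4 / 3 : ℝ) - 1)
        + u ^ ((l + 1 / 3 : ℝ) - 1) * (1 - u) ^ ((l + 5 / 3 : ℝ) - 1)) := by
  have hv : 0 < 1 - u := by linarith
  have key : ∀ (z : ℝ), 0 < z → ∀ a b : ℝ, a = l + b → z ^ a = z ^ l * z ^ b := by
    intro z hz a b h; rw [h, Real.rpow_add hz, Real.rpow_natCast]
  have k53 : ∀ z : ℝ, 0 < z → z ^ ((l + 5 / 3 : ℝ) - 1) = z ^ l * (z * z ^ (1 / 3 : ℝ) * z ^ (-2 / 3 : ℝ)) := by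
    intro z hz
    rw [key z hz _ (2 / 3) (by ring), show (2 / 3 : ℝ) = 1 + 1 / 3 + -2 / 3 by norm_num,
      Real.rpow_add hz, Real.rpow_add hz, Real.rpow_one]
  have k43 : ∀ z : ℝ, 0 < z → z ^ ((l + 4 / 3 : ℝ) - 1) = z ^ l * (z * z ^ (-2 / 3 : ℝ)) := by
    intro z hz
    rw [key z hz _ (1 / 3) (by ring), show (1 / 3 : ℝ) = 1 + -2 / 3 by norm_num,
      Real.rpow_add hz, Real.rpow_one]
  have k23 : ∀ z : ℝ, 0 < z → z ^ ((l + 2 / 3 : ℝ) - 1) = z ^ l * (z ^ (1 / 3 : ℝ) * z ^ (-2 / 3 : ℝ)) := by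
    intro z hz
    rw [key z hz _ (-1 / 3) (by ring), show (-1 / 3 : ℝ) = 1 / 3 + -2 / 3 by norm_num,
      Real.rpow_add hz]
  have k13 : ∀ z : ℝ, 0 < z → z ^ ((l + 1 / 3 : ℝ) - 1) = z ^ l * z ^ (-2 / 3 : ℝ) := by
    intro z hz
    rw [key z hz _ (-2 / 3) (by ring)]
  rw [k53 u h0, k53 _ hv, k43 u h0, k43 _ hv, k23 u h0, k23 _ hv, k13 u h0, k13 _ hv, limitProfile,
    mul_pow, mul_pow]
  ring

/-- The Fuss–Catalan moments of the limit measure in terms of the Gamma function. -/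
noncomputable def limitMoment (l : ℕ) : ℝ :=
  Real.sqrt 3 / (2 * Real.pi) * 27 ^ l *
    (Real.Gamma (l + 1 / 3) * Real.Gamma (l + 2 / 3) / Real.Gamma (2 * l + 2))

/-- The profile and u(1-u) are invariant under u ↦ 1-u, so the integral over (1/2, 1) is half of the
beta integral over (0, 1). -/
theorem limitProfile_integral (l : ℕ) :
    IntegrableOn (fun u => (27 * (u * (1 - u))) ^ l * limitProfile u) (Set.Ioo (1 / 2) 1) ∧
    ∫ u in Set.Ioo (1 / 2 : ℝ) 1, (27 * (u * (1 - u))) ^ l * limitProfile u = limitMoment l := by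
  set F : ℝ → ℝ := fun u => (27 * (u * (1 - u))) ^ l * limitProfile u with hF
  have hl : (0 : ℝ) ≤ l := Nat.cast_nonneg l
  have i1 := intervalIntegrable_beta (α := l + 5 / 3) (β := l + 1 / 3) (by positivity) (by positivity)
  have i2 := intervalIntegrable_beta (α := l + 4 / 3) (β := l + 2 / 3) (by positivity) (by positivity)
  have i3 := intervalIntegrable_beta (α := l + 2 / 3) (β := l + 4 / 3) (by positivity) (by positivity)
  have i4 := intervalIntegrable_beta (α := l + 1 / 3) (β := l + 5 / 3) (by positivity) (by positivity)
  have hsum := (((i1.sub i2).sub i3).add i4).const_mul (3 * Real.sqrt 3 / (2 * Real.pi) * 27 ^ l)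
  have hFI : IntegrableOn F (Set.Ioo 0 1) := by
    rw [intervalIntegrable_iff_integrableOn_Ioo_of_le zero_le_one] at hsum
    refine hsum.congr_fun (fun u hu => ?_) measurableSet_Ioo
    simp only [hF]
    rw [limitProfile_mul_pow hu.1 hu.2 l]
  have hFII : IntervalIntegrable F volume 0 1 := by
    rwa [intervalIntegrable_iff_integrableOn_Ioo_of_le zero_le_one]
  have hint : ∫ u in (0 : ℝ)..1, F u = 2 * limitMoment l := by
    have e : ∫ u in (0 : ℝ)..1, F u = ∫ u in (0 : ℝ)..1, (3 * Real.sqrt 3 / (2 * Real.pi) * 27 ^ l *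
      (u ^ ((l + 5 / 3 : ℝ) - 1) * (1 - u) ^ ((l + 1 / 3 : ℝ) - 1)
        - u ^ ((l + 4 / 3 : ℝ) - 1) * (1 - u) ^ ((l + 2 / 3 : ℝ) - 1)
        - u ^ ((l + 2 / 3 : ℝ) - 1) * (1 - u) ^ ((l + 4 / 3 : ℝ) - 1)
        + u ^ ((l + 1 / 3 : ℝ) - 1) * (1 - u) ^ ((l + 5 / 3 : ℝ) - 1))) := by
      rw [intervalIntegral.integral_of_le zero_le_one, intervalIntegral.integral_of_le zero_le_one,
        integral_Ioc_eq_integral_Ioo, integral_Ioc_eq_integral_Ioo]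
      exact setIntegral_congr_fun measurableSet_Ioo fun u hu => limitProfile_mul_pow hu.1 hu.2 l
    rw [e, intervalIntegral.integral_const_mul,
      intervalIntegral.integral_add ((i1.sub i2).sub i3) i4,
      intervalIntegral.integral_sub (i1.sub i2) i3, intervalIntegral.integral_sub i1 i2,
      integral_beta (by positivity) (by positivity), integral_beta (by positivity) (by positivity),
      integral_beta (by positivity) (by positivity), integral_beta (by positivity) (by positivity)]
    have g1 : Real.Gamma (l + 5 / 3) = (l + 2 / 3) * Real.Gamma (l + 2 / 3) := by
      rw [show (l + 5 / 3 : ℝ) = (l + 2 / 3) + 1 by ring, Real.Gamma_add_one (by positivity)]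
    have g2 : Real.Gamma (l + 4 / 3) = (l + 1 / 3) * Real.Gamma (l + 1 / 3) := by
      rw [show (l + 4 / 3 : ℝ) = (l + 1 / 3) + 1 by ring, Real.Gamma_add_one (by positivity)]
    rw [g1, g2, show (l + 5 / 3 + (l + 1 / 3) : ℝ) = 2 * l + 2 by ring,
      show (l + 4 / 3 + (l + 2 / 3) : ℝ) = 2 * l + 2 by ring,
      show (l + 1 / 3 + (l + 5 / 3) : ℝ) = 2 * l + 2 by ring,
      show (l + 2 / 3 + (l + 4 / 3) : ℝ) = 2 * l + 2 by ring, limitMoment]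
    have p4 := Real.pi_pos
    have p5 : 0 < Real.Gamma (2 * (l : ℝ) + 2) := Real.Gamma_pos_of_pos (by positivity)
    field_simp
    ring_nf
  have hsymm : ∀ u, F (1 - u) = F u := by
    intro u; simp only [hF, limitProfile_symm, sub_sub_cancel]; ring
  have hhalf : ∫ u in (0 : ℝ)..(1 / 2), F u = ∫ u in (1 / 2 : ℝ)..1, F u := by
    have := intervalIntegral.integral_comp_sub_left (a := (1 / 2 : ℝ)) (b := 1) F 1
    rw [show (1 : ℝ) - 1 = 0 by norm_num, show (1 : ℝ) - 1 / 2 = 1 / 2 by norm_num] at this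
    rw [← this]
    simp only [hsymm]
  refine ⟨hFI.mono_set (Set.Ioo_subset_Ioo_left (by norm_num)), ?_⟩
  have hadd := intervalIntegral.integral_add_adjacent_intervals (μ := volume) (f := F)
    (a := 0) (b := 1 / 2) (c := 1)
    (hFII.mono_set (by rw [Set.uIcc_of_le, Set.uIcc_of_le] <;> first | exact Set.Icc_subset_Icc le_rfl (by norm_num) | norm_num))
    (hFII.mono_set (by rw [Set.uIcc_of_le, Set.uIcc_of_le] <;> first | exact Set.Icc_subset_Icc (by norm_num) le_rfl | norm_num))
  rw [hhalf, hint] at hadd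
  rw [← integral_Ioc_eq_integral_Ioo, ← intervalIntegral.integral_of_le (by norm_num)]
  linarith

theorem image_quadratic_Ioo :
    (fun u : ℝ => 27 * (u * (1 - u))) '' Set.Ioo (1 / 2) 1 = Set.Ioo 0 (27 / 4) := by
  ext x
  constructor
  · rintro ⟨u, ⟨h0, h1⟩, rfl⟩
    have hv : 0 < 1 - u := by linarith
    constructor
    · have : 0 < u := by linarith
      positivity
    · nlinarith [sq_pos_of_pos (by linarith : (0 : ℝ) < 2 * u - 1)]
  · rintro ⟨h0, h1⟩
    have hp : 0 < 1 - 4 * x / 27 := by linarith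
    have hs := Real.sq_sqrt hp.le
    have hs0 := Real.sqrt_pos.mpr hp
    have hs1 : Real.sqrt (1 - 4 * x / 27) < 1 := by
      rw [Real.sqrt_lt' one_pos]; linarith
    refine ⟨(1 + Real.sqrt (1 - 4 * x / 27)) / 2, ⟨by linarith, by linarith⟩, ?_⟩
    simp only
    nlinarith

theorem limitDensity_nonneg (x : ℝ) : 0 ≤ limitDensity x := by
  rw [limitDensity]
  split_ifs with h
  · have h4 : 0 ≤ Real.sqrt (1 - 4 * x / 27) := Real.sqrt_nonneg _
    have h5 : Real.sqrt (1 - 4 * x / 27) ≤ 1 := by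
      rw [Real.sqrt_le_left (by norm_num)]; linarith [h.1]
    have h6 : (1 - Real.sqrt (1 - 4 * x / 27)) ^ (1 / 3 : ℝ) ≤
        (1 + Real.sqrt (1 - 4 * x / 27)) ^ (1 / 3 : ℝ) :=
      Real.rpow_le_rpow (by linarith) (by linarith) (by norm_num)
    have h7 : 0 ≤ (4 * x / 27) ^ (2 / 3 : ℝ) := Real.rpow_nonneg (by linarith [h.1]) _
    have := Real.pi_pos
    rw [hFun]
    refine mul_nonneg (by norm_num) (mul_nonneg (by positivity) (div_nonneg (by linarith) h7))
  · exact le_rfl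

theorem measurable_limitDensity : Measurable limitDensity := by
  unfold limitDensity hFun
  refine Measurable.ite measurableSet_Ioo ?_ measurable_const
  fun_prop

theorem limitDensity_integral (l : ℕ) :
    Integrable (fun x => x ^ l * limitDensity x) ∧ ∫ x, x ^ l * limitDensity x = limitMoment l := by
  have hinj : Set.InjOn (fun u : ℝ => 27 * (u * (1 - u))) (Set.Ioo (1 / 2) 1) := by
    intro a ha b hb hab
    simp only at hab
    have : (a - b) * (1 - (a + b)) = 0 := by linarith
    rcases mul_eq_zero.mp this with h | h
    · linarith
    · linarith [ha.1, hb.1]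
  have hder : ∀ u ∈ Set.Ioo (1 / 2 : ℝ) 1, HasDerivWithinAt (fun u : ℝ => 27 * (u * (1 - u)))
      (27 * (1 - 2 * u)) (Set.Ioo (1 / 2) 1) u := by
    intro u _
    have := (((hasDerivAt_id u).mul ((hasDerivAt_id u).const_sub 1)).const_mul 27)
    refine (this.congr_deriv ?_).hasDerivWithinAt
    simp; ring
  have hsupp : ∀ x, x ∉ Set.Ioo (0 : ℝ) (27 / 4) → x ^ l * limitDensity x = 0 := by
    intro x hx; rw [limitDensity, if_neg hx, mul_zero]
  have hcongr : ∀ u ∈ Set.Ioo (1 / 2 : ℝ) 1, (27 * (u * (1 - u))) ^ l * limitProfile u =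
      |27 * (1 - 2 * u)| • ((27 * (u * (1 - u))) ^ l * limitDensity (27 * (u * (1 - u)))) := by
    intro u hu
    rw [← limitDensity_subst hu.1 hu.2, smul_eq_mul]; ring
  obtain ⟨hi, hv⟩ := limitProfile_integral l
  constructor
  · rw [← integrableOn_iff_integrable_of_support_subset (s := Set.Ioo (0 : ℝ) (27 / 4)),
      ← image_quadratic_Ioo,
      integrableOn_image_iff_integrableOn_abs_deriv_smul measurableSet_Ioo hder hinj]
    · exact hi.congr_fun hcongr measurableSet_Ioo
    · intro x hx
      by_contra h
      exact hx (hsupp x h)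
  · rw [← setIntegral_eq_integral_of_forall_compl_eq_zero hsupp, ← image_quadratic_Ioo,
      integral_image_eq_integral_abs_deriv_smul measurableSet_Ioo hder hinj, ← hv]
    exact setIntegral_congr_fun measurableSet_Ioo fun u hu => (hcongr u hu).symm

/-- Euler's reflection formula at 1/3. -/
theorem limitMoment_zero : limitMoment 0 = 1 := by
  have h := Real.Gamma_mul_Gamma_one_sub (1 / 3)
  rw [show (1 : ℝ) - 1 / 3 = 2 / 3 by norm_num, show Real.pi * (1 / 3) = Real.pi / 3 by ring,
    Real.sin_pi_div_three] at h
  have h3 : (0 : ℝ) < Real.sqrt 3 := by positivity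
  have := Real.pi_pos
  simp only [limitMoment, Nat.cast_zero, zero_add, pow_zero, mul_one, mul_zero, h]
  rw [Real.Gamma_two]
  field_simp

/-- This two-term recursion is what identifies the moments with the Fuss–Catalan numbers. -/
theorem limitMoment_succ (l : ℕ) :
    (2 * l + 2) * (2 * l + 3) * limitMoment (l + 1) =
      3 * (3 * l + 1) * (3 * l + 2) * limitMoment l := by
  have hl : (0 : ℝ) ≤ l := Nat.cast_nonneg l
  have g1 : Real.Gamma (((l + 1 : ℕ) : ℝ) + 2 / 3) = (l + 2 / 3) * Real.Gamma (l + 2 / 3) := by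
    rw [← Real.Gamma_add_one (by positivity)]; push_cast; ring_nf
  have g2 : Real.Gamma (((l + 1 : ℕ) : ℝ) + 1 / 3) = (l + 1 / 3) * Real.Gamma (l + 1 / 3) := by
    rw [← Real.Gamma_add_one (by positivity)]; push_cast; ring_nf
  have g3 : Real.Gamma (2 * ((l + 1 : ℕ) : ℝ) + 2) =
      (2 * l + 3) * ((2 * l + 2) * Real.Gamma (2 * l + 2)) := by
    rw [← Real.Gamma_add_one (by positivity), show (2 * l + 3 : ℝ) = (2 * l + 2 + 1) by ring,
      ← Real.Gamma_add_one (by positivity)]; push_cast; ring_nf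
  have p5 : 0 < Real.Gamma (2 * (l : ℝ) + 2) := Real.Gamma_pos_of_pos (by positivity)
  have := Real.pi_pos
  rw [limitMoment, limitMoment, g1, g2, g3]
  field_simp
  ring

theorem isProbabilityMeasure_limitMeasure : IsProbabilityMeasure limitMeasure := by
  obtain ⟨hi, hv⟩ := limitDensity_integral 0
  simp only [pow_zero, one_mul] at hi hv
  constructor
  rw [limitMeasure, withDensity_apply _ MeasurableSet.univ, Measure.restrict_univ,
    ← ofReal_integral_eq_lintegral_ofReal hi (Eventually.of_forall limitDensity_nonneg), hv,
    limitMoment_zero, ENNReal.ofReal_one]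

theorem integral_limitMeasure (f : ℝ → ℝ) :
    ∫ x, f x ∂limitMeasure = ∫ x, f x * limitDensity x := by
  rw [limitMeasure, integral_withDensity_eq_integral_toReal_smul
    measurable_limitDensity.ennreal_ofReal (by simp)]
  refine integral_congr_ae (Eventually.of_forall fun x => ?_)
  simp only [ENNReal.toReal_ofReal (limitDensity_nonneg x), smul_eq_mul]; ring

theorem integral_pow_limitMeasure (l : ℕ) : ∫ x, x ^ l ∂limitMeasure = limitMoment l := by
  rw [integral_limitMeasure]; exact (limitDensity_integral l).2

theorem ae_limitMeasure_mem : ∀ᵐ x ∂limitMeasure, x ∈ Set.Ioo (0 : ℝ) (27 / 4) := by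
  rw [limitMeasure, ae_withDensity_iff measurable_limitDensity.ennreal_ofReal]
  refine Eventually.of_forall fun x hx => ?_
  by_contra h
  exact hx (by rw [limitDensity, if_neg h, ENNReal.ofReal_zero])

/-! ### The generating function M = 1 + zM³. -/

/-- The algebraic equation is differentiated twice. Multiplication by (1-3zM²)³, which is nonzero
because its constant coefficient is 1, eliminates both derivatives, and the rest is a multiple of
the algebraic equation. The gain is linearity: coefficients can be compared one by one. -/
theorem ternary_ode {M : PowerSeries ℝ} (hM : M = 1 + PowerSeries.X * M ^ 3) :
    (4 * PowerSeries.X - 27 * PowerSeries.X ^ 2) *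
        PowerSeries.derivative ℝ (PowerSeries.derivative ℝ M) +
      (6 - 54 * PowerSeries.X) * PowerSeries.derivative ℝ M - 6 * M = 0 := by
  set z : PowerSeries ℝ := PowerSeries.X with hz
  set D := PowerSeries.derivative ℝ M with hD
  set D2 := PowerSeries.derivative ℝ D with hD2
  have hdz : PowerSeries.derivative ℝ z = 1 := PowerSeries.derivative_X
  have h1 : D = M ^ 3 + z * (3 * M ^ 2 * D) := by
    have := congrArg (PowerSeries.derivative ℝ) hM
    rw [map_add, Derivation.leibniz, Derivation.leibniz_pow, hdz, Derivation.map_one_eq_zero] at this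
    simp only [smul_eq_mul, nsmul_eq_mul] at this
    rw [← hD] at this
    push_cast at this
    linear_combination this
  have h2 : D2 = 6 * M ^ 2 * D + z * (6 * M * D ^ 2 + 3 * M ^ 2 * D2) := by
    have := congrArg (PowerSeries.derivative ℝ) h1
    have h3 : PowerSeries.derivative ℝ (3 : PowerSeries ℝ) = 0 := by
      exact_mod_cast (PowerSeries.derivative ℝ).map_natCast 3
    simp only [map_add, Derivation.leibniz, Derivation.leibniz_pow, hdz, smul_eq_mul,
      nsmul_eq_mul, h3, ← hD, ← hD2] at this
    push_cast at this
    linear_combination this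
  have hE0 : (1 - 3 * z * M ^ 2) ≠ 0 := by
    intro h
    have := congrArg PowerSeries.constantCoeff h
    simp [hz] at this
  have hED : (1 - 3 * z * M ^ 2) * D = M ^ 3 := by linear_combination h1
  have hED2 : (1 - 3 * z * M ^ 2) * D2 = 6 * M ^ 2 * D + 6 * z * M * D ^ 2 := by
    linear_combination h2
  have hE3 : (1 - 3 * z * M ^ 2) ^ 3 * D2 =
      6 * M ^ 5 * (1 - 3 * z * M ^ 2) + 6 * z * M ^ 7 := by
    set E := 1 - 3 * z * M ^ 2
    calc E ^ 3 * D2 = E ^ 2 * (E * D2) := by ring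
      _ = 6 * M ^ 2 * E * (E * D) + 6 * z * M * (E * D) ^ 2 := by rw [hED2]; ring
      _ = _ := by rw [hED]; ring
  refine (mul_eq_zero.mp (?_ : (1 - 3 * z * M ^ 2) ^ 3 * _ = 0)).resolve_left (pow_ne_zero 3 hE0)
  have e2 : (1 - 3 * z * M ^ 2) ^ 3 * D = (1 - 3 * z * M ^ 2) ^ 2 * M ^ 3 := by
    rw [← hED]; ring
  linear_combination (4 * z - 27 * z ^ 2) * hE3 + (6 - 54 * z) * e2 +
    6 * M * (M * (1 - z * M ^ 2) + 1) * hM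

theorem eq_limitMoment_of_ternary {m : ℕ → ℝ} (h0 : m 0 = 1)
    (hM : PowerSeries.mk m = 1 + PowerSeries.X * PowerSeries.mk m ^ 3) :
    ∀ l, m l = limitMoment l := by
  have hode := ternary_ode hM
  have hrec : ∀ l : ℕ, (2 * l + 2) * (2 * l + 3) * m (l + 1) =
      3 * (3 * l + 1) * (3 * l + 2) * m l := by
    intro l
    have hc := congrArg (PowerSeries.coeff l) hode
    set D := PowerSeries.derivative ℝ (PowerSeries.mk m) with hD
    set D2 := PowerSeries.derivative ℝ D with hD2
    have e : (4 * PowerSeries.X - 27 * PowerSeries.X ^ 2) * D2 +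
        (6 - 54 * PowerSeries.X) * D - 6 * PowerSeries.mk m =
        (4 : ℝ) • (PowerSeries.X * D2) - (27 : ℝ) • (PowerSeries.X * (PowerSeries.X * D2)) +
        (6 : ℝ) • D - (54 : ℝ) • (PowerSeries.X * D) - (6 : ℝ) • PowerSeries.mk m := by
      simp only [PowerSeries.smul_eq_C_mul, map_ofNat]; ring
    have d1 : ∀ k, PowerSeries.coeff k D = m (k + 1) * (k + 1) := by
      intro k; rw [hD, PowerSeries.coeff_derivative, PowerSeries.coeff_mk]
    have d2 : ∀ k, PowerSeries.coeff k D2 = m (k + 2) * (k + 2) * (k + 1) := by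
      intro k
      rw [hD2, PowerSeries.coeff_derivative, d1]; push_cast; ring
    rw [e] at hc
    simp only [map_sub, map_add, map_smul, smul_eq_mul, PowerSeries.coeff_mk, map_zero] at hc
    -- The factors `X` and `X ^ 2` shift the coefficients, so l = 0 and l = 1 are treated apart.
    rcases l with _ | _ | l
    · simp only [PowerSeries.coeff_zero_X_mul, d1] at hc
      push_cast at hc ⊢
      linarith
    · simp only [PowerSeries.coeff_succ_X_mul, PowerSeries.coeff_zero_X_mul, d1, d2] at hc
      push_cast at hc ⊢
      linarith
    · simp only [PowerSeries.coeff_succ_X_mul, d1, d2] at hc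
      push_cast at hc ⊢
      linarith
  intro l
  induction l with
  | zero => rw [h0, limitMoment_zero]
  | succ l ih =>
    have a := hrec l
    have b := limitMoment_succ l
    rw [ih, ← b] at a
    exact mul_left_cancel₀ (by positivity) a

/-! ### Empirical moments as traces. -/

/-- The squared singular values are the eigenvalues of the symmetric operator A*A, so the trace is
computed in an orthonormal eigenbasis. -/
theorem sum_squaredSingularValue_pow {N : ℕ} (A : Matrix (Fin N) (Fin N) ℂ) (l : ℕ) :
    ((∑ i, squaredSingularValue A i ^ l : ℝ) : ℂ) =
      Matrix.trace ((A.conjTranspose * A) ^ l) := by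
  have hn : Module.finrank ℂ (EuclideanSpace ℂ (Fin N)) = N := by simp
  set T := Matrix.toEuclideanLin A with hT
  have hS := T.isSymmetric_adjoint_comp_self
  have e : (T.adjoint ∘ₗ T) = Matrix.toEuclideanLin (A.conjTranspose * A) := by
    rw [Matrix.toLpLin_mul_same, Matrix.toEuclideanLin_conjTranspose_eq_adjoint]
  have e2 : LinearMap.trace ℂ _ ((T.adjoint ∘ₗ T) ^ l) =
      Matrix.trace ((A.conjTranspose * A) ^ l) := by
    rw [e, ← Matrix.toLpLin_pow,
      LinearMap.trace_eq_matrix_trace ℂ (EuclideanSpace.basisFun (Fin N) ℂ).toBasis]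
    exact congrArg Matrix.trace (LinearMap.toMatrix_toLin _ _ _)
  rw [← e2, LinearMap.trace_eq_sum_inner _ (hS.eigenvectorBasis hn)]
  push_cast
  refine Finset.sum_congr rfl fun i _ => ?_
  have hp : ∀ k : ℕ, ((T.adjoint ∘ₗ T) ^ k) (hS.eigenvectorBasis hn i) =
      ((hS.eigenvalues hn i : ℂ) ^ k) • hS.eigenvectorBasis hn i := by
    intro k
    induction k with
    | zero => simp
    | succ k ih =>
      rw [pow_succ', Module.End.mul_apply, ih, map_smul, hS.apply_eigenvectorBasis, smul_smul,
        pow_succ]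
      rfl
  rw [hp, inner_smul_right, inner_self_eq_norm_sq_to_K,
    (hS.eigenvectorBasis hn).orthonormal.1 i, squaredSingularValue, ← hT,
    T.sq_singularValues_fin hn i]
  simp

theorem squaredSingularValue_nonneg {N : ℕ} (A : Matrix (Fin N) (Fin N) ℂ) (i : Fin N) :
    0 ≤ squaredSingularValue A i := sq_nonneg _

theorem integrable_scaledEmpiricalMeasure {N : ℕ} (hN : N ≠ 0) (A : Matrix (Fin N) (Fin N) ℂ)
    (f : ℝ → ℝ) : Integrable f (scaledEmpiricalMeasure A) := by
  refine Integrable.smul_measure ?_ (by simp [hN])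
  rw [integrable_finsetSum_measure]
  exact fun i _ => integrable_dirac (by simp)

theorem integral_scaledEmpiricalMeasure {N : ℕ} (A : Matrix (Fin N) (Fin N) ℂ)
    (f : ℝ → ℝ) : ∫ x, f x ∂(scaledEmpiricalMeasure A) =
      (N : ℝ)⁻¹ * ∑ i, f (squaredSingularValue A i / (N : ℝ) ^ 2) := by
  rw [scaledEmpiricalMeasure, integral_smul_measure,
    integral_finsetSum_measure fun i _ => integrable_dirac (by simp)]
  simp

theorem ae_nonneg_scaledEmpiricalMeasure {N : ℕ} (A : Matrix (Fin N) (Fin N) ℂ) :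
    ∀ᵐ x ∂(scaledEmpiricalMeasure A), 0 ≤ x := by
  refine Measure.ae_smul_measure ?_ _
  rw [ae_iff, Measure.finsetSum_apply]
  refine Finset.sum_eq_zero fun i _ => ?_
  have h : 0 ≤ squaredSingularValue A i / (N : ℝ) ^ 2 :=
    div_nonneg (squaredSingularValue_nonneg A i) (by positivity)
  rw [Measure.dirac_apply]
  simp [h]

theorem integral_pow_scaledEmpiricalMeasure {N : ℕ} (A : Matrix (Fin N) (Fin N) ℂ) (l : ℕ) :
    ((∫ x, x ^ l ∂(scaledEmpiricalMeasure A) : ℝ) : ℂ) =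
      Matrix.trace ((A.conjTranspose * A) ^ l) / (N : ℂ) ^ (1 + 2 * l) := by
  rw [integral_scaledEmpiricalMeasure, ← sum_squaredSingularValue_pow]
  push_cast
  simp only [div_pow, ← pow_mul, ← Finset.sum_div]
  rw [pow_add, pow_one, inv_mul_eq_div, div_div, mul_comm]

/-! ### From moments to weak convergence. -/

/-- The method of moments for limits supported in a bounded interval. -/
theorem tendsto_integral_of_tendsto_moments {μ : Measure ℝ} [IsProbabilityMeasure μ] {R S : ℝ}
    (hR : 0 ≤ R) (hRS : R < S) (hS : 1 ≤ S) (hμ : ∀ᵐ x ∂μ, x ∈ Set.Icc 0 R) {ν : ℕ → Measure ℝ}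
    (hν : ∀ᶠ n in atTop, ∀ f : ℝ → ℝ, Integrable f (ν n)) (hν0 : ∀ n, ∀ᵐ x ∂(ν n), 0 ≤ x)
    (hm : ∀ l : ℕ, Tendsto (fun n => ∫ x, x ^ l ∂(ν n)) atTop (𝓝 (∫ x, x ^ l ∂μ)))
    (f : BoundedContinuousFunction ℝ ℝ) :
    Tendsto (fun n => ∫ x, f x ∂(ν n)) atTop (𝓝 (∫ x, f x ∂μ)) := by
  have hμi : ∀ g : ℝ → ℝ, Continuous g → Integrable g μ := by
    intro g hg
    obtain ⟨C, hC⟩ := isCompact_Icc.exists_bound_of_continuousOn (s := Set.Icc 0 R) hg.continuousOn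
    exact Integrable.of_bound hg.aestronglyMeasurable C (hμ.mono fun x hx => hC x hx)
  have hS0 : 0 < S := by linarith
  have hpoly : ∀ p : ℝ[X], Tendsto (fun n => ∫ x, p.eval x ∂(ν n)) atTop
      (𝓝 (∫ x, p.eval x ∂μ)) := by
    intro p
    have e : ∀ κ : Measure ℝ, (∀ l : ℕ, Integrable (fun x : ℝ => x ^ l) κ) →
        ∫ x, p.eval x ∂κ = ∑ i ∈ Finset.range (p.natDegree + 1), p.coeff i * ∫ x, x ^ i ∂κ := by
      intro κ hκ
      simp_rw [Polynomial.eval_eq_sum_range]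
      rw [integral_finsetSum _ fun i _ => (hκ i).const_mul _]
      simp_rw [integral_const_mul]
    rw [e μ fun l => hμi _ (by fun_prop)]
    refine (tendsto_finsetSum _ fun i _ => (hm i).const_mul _).congr' ?_
    filter_upwards [hν] with n hn
    rw [e _ fun l => hn _]
  rw [Metric.tendsto_atTop']
  intro ε hε
  -- Weierstrass approximation gives control on [0, S] only; beyond S a high moment takes over.
  obtain ⟨p, hp⟩ := exists_polynomial_near_of_continuousOn 0 S f f.continuous.continuousOn
    (ε / 8) (by positivity)
  set K : ℝ := ‖f‖ + ∑ i ∈ Finset.range (p.natDegree + 1), |p.coeff i| with hK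
  have hK0 : 0 ≤ K := by positivity
  set d := p.natDegree
  -- Beyond S ≥ 1 both f and p are at most a constant times x^d, and x^d ≤ S^d (x/S)^k for every k ≥
  -- d. The exponent k stays free.
  have hbound : ∀ k, d ≤ k → ∀ x, 0 ≤ x →
      |f x - p.eval x| ≤ ε / 8 + K * S ^ d * (x ^ k / S ^ k) := by
    intro k hk x hx
    rcases le_or_gt x S with h | h
    · have h1 := hp x ⟨hx, h⟩
      rw [abs_sub_comm] at h1
      have : 0 ≤ K * S ^ d * (x ^ k / S ^ k) := by positivity
      linarith
    · have hx1 : 1 ≤ x := by linarith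
      have h1 : |p.eval x| ≤ (∑ i ∈ Finset.range (d + 1), |p.coeff i|) * x ^ d := by
        rw [Polynomial.eval_eq_sum_range, Finset.sum_mul]
        refine (Finset.abs_sum_le_sum_abs _ _).trans (Finset.sum_le_sum fun i hi => ?_)
        rw [abs_mul, abs_of_nonneg (pow_nonneg hx i)]
        exact mul_le_mul_of_nonneg_left (pow_le_pow_right₀ hx1
          (Nat.lt_succ_iff.mp (Finset.mem_range.mp hi))) (abs_nonneg _)
      have h2 : |f x| ≤ ‖f‖ * x ^ d :=
        (f.norm_coe_le_norm x).trans (le_mul_of_one_le_right (norm_nonneg _) (one_le_pow₀ hx1))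
      have h3 : |f x - p.eval x| ≤ K * x ^ d := by
        rw [hK, add_mul]
        exact (abs_sub _ _).trans (add_le_add h2 h1)
      have h4 : x ^ d ≤ S ^ d * (x ^ k / S ^ k) := by
        have : (x / S) ^ d ≤ (x / S) ^ k := pow_le_pow_right₀ ((one_le_div hS0).mpr h.le) hk
        rw [div_pow, div_pow, div_le_iff₀ (by positivity)] at this
        linarith
      have h5 := mul_le_mul_of_nonneg_left h4 hK0
      have : 0 < ε / 8 := by positivity
      linarith
  -- Since R < S, the k-th moment of the limit divided by S^k is small for large k. This k is fixed
  -- before n tends to infinity.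
  have hlim : Tendsto (fun k : ℕ => K * S ^ d * (R / S) ^ k) atTop (𝓝 0) := by
    rw [← mul_zero (K * S ^ d)]
    exact (tendsto_pow_atTop_nhds_zero_of_lt_one (by positivity)
      ((div_lt_one hS0).mpr hRS)).const_mul _
  obtain ⟨k, hk, hkd⟩ := ((hlim.eventually (gt_mem_nhds (by positivity : 0 < ε / 8))).and
    (eventually_ge_atTop d)).exists
  have hdiff : ∀ κ : Measure ℝ, (∀ᵐ x ∂κ, 0 ≤ x) → (∀ g : ℝ → ℝ, Continuous g → Integrable g κ) →
      |∫ x, f x ∂κ - ∫ x, p.eval x ∂κ| ≤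
        ε / 8 * (∫ x, x ^ 0 ∂κ) + K * S ^ d * ((∫ x, x ^ k ∂κ) / S ^ k) := by
    intro κ h0 hi
    rw [← integral_sub (hi _ f.continuous) (hi _ p.continuous)]
    calc |∫ x, (f x - p.eval x) ∂κ| ≤ ∫ x, |f x - p.eval x| ∂κ := abs_integral_le_integral_abs
      _ ≤ ∫ x, (ε / 8 * x ^ 0 + K * S ^ d * (x ^ k / S ^ k)) ∂κ := by
        refine integral_mono_ae (hi _ ((f.continuous.sub p.continuous).abs))
          (hi _ (by fun_prop)) (h0.mono fun x hx => ?_)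
        simpa using hbound k hkd x hx
      _ = _ := by
        rw [integral_add (hi _ (by fun_prop)) (hi _ (by fun_prop)), integral_const_mul,
          integral_const_mul, integral_div]
  have hμ0 : ∀ᵐ x ∂μ, 0 ≤ x := hμ.mono fun x hx => hx.1
  have hm0 : ∫ x : ℝ, x ^ 0 ∂μ = 1 := by simp
  have hmk : (∫ x : ℝ, x ^ k ∂μ) ≤ R ^ k := by
    calc ∫ x : ℝ, x ^ k ∂μ ≤ ∫ x : ℝ, R ^ k ∂μ :=
          integral_mono_ae (hμi _ (by fun_prop)) (hμi _ (by fun_prop))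
            (hμ.mono fun x hx => pow_le_pow_left₀ hx.1 hx.2 k)
      _ = R ^ k := by simp
  have hsmall : K * S ^ d * ((∫ x : ℝ, x ^ k ∂μ) / S ^ k) < ε / 8 := by
    refine lt_of_le_of_lt ?_ hk
    rw [div_pow]
    gcongr
  have hd1 := hdiff μ hμ0 hμi
  rw [hm0] at hd1
  have hE : Tendsto (fun n => ε / 8 * (∫ x, x ^ 0 ∂(ν n)) +
      K * S ^ d * ((∫ x, x ^ k ∂(ν n)) / S ^ k)) atTop
      (𝓝 (ε / 8 * (∫ x, x ^ 0 ∂μ) + K * S ^ d * ((∫ x, x ^ k ∂μ) / S ^ k))) :=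
    ((hm 0).const_mul _).add (((hm k).div_const _).const_mul _)
  rw [hm0] at hE
  have hE' := hE.eventually (gt_mem_nhds (by linarith : _ < 3 * ε / 8))
  have hP := (Metric.tendsto_atTop'.mp (hpoly p)) (ε / 8) (by positivity)
  obtain ⟨n0, hn0⟩ := hP
  obtain ⟨n1, hn1⟩ := eventually_atTop.mp (hE'.and hν)
  refine ⟨max n0 n1, fun n hn => ?_⟩
  have q1 := hn0 n (lt_of_le_of_lt (le_max_left _ _) hn)
  obtain ⟨q2, q3⟩ := hn1 n ((le_max_right n0 n1).trans hn.le)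
  have q4 := hdiff (ν n) (hν0 n) fun g _ => q3 g
  rw [Real.dist_eq] at q1 ⊢
  rw [abs_le] at q4 hd1
  rw [abs_lt] at q1 ⊢
  constructor <;> linarith [q4.1, q4.2, hd1.1, hd1.2, q1.1, q1.2]

/-! ### Words in two letters: splitting and merging. -/

/-- All ways to write a word as `u b v`, as the list of the pairs `(u, v)`. -/
def splits (b : Bool) : List Bool → List (List Bool × List Bool)
  | [] => []
  | c :: w => (if c = b then [([], w)] else []) ++ (splits b w).map fun s => (c :: s.1, s.2)

/-- All results of opening one of the words of a list at a letter `b` and joining it, cyclically,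
to the word `b U`. -/
def merges (b : Bool) (U : List Bool) : List (List Bool) → List (List (List Bool))
  | [] => []
  | w :: ws => ((splits b w).map fun s => (b :: (U ++ (s.2 ++ s.1))) :: ws) ++
      (merges b U ws).map fun l => w :: l

theorem length_of_mem_splits {b : Bool} {w : List Bool} {s : List Bool × List Bool}
    (hs : s ∈ splits b w) : s.1.length + s.2.length + 1 = w.length := by
  induction w generalizing s with
  | nil => simp [splits] at hs
  | cons c w ih =>
    simp only [splits, List.mem_append, List.mem_map] at hs
    rcases hs with hs | ⟨t, ht, rfl⟩
    · split_ifs at hs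
      · simp only [List.mem_singleton] at hs; subst hs; simp
      · simp at hs
    · have := ih ht
      simp only [List.length_cons]; omega

/-- The number of letters in a list of words. -/
def letterCount (ws : List (List Bool)) : ℕ := (ws.map List.length).sum

/-- Compared with `(b :: U) :: ws`, a merged list has one letter and one word fewer. This double
loss is the source of the factor N⁻². -/
theorem of_mem_merges {b : Bool} {U : List Bool} {ws ms : List (List Bool)}
    (h : ms ∈ merges b U ws) :
    letterCount ms = U.length + letterCount ws ∧ ms.length = ws.length := by
  induction ws generalizing ms with
  | nil => simp [merges] at h
  | cons w ws ih =>
    simp only [merges, List.mem_append, List.mem_map] at h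
    rcases h with ⟨s, hs, rfl⟩ | ⟨t, ht, rfl⟩
    · have := length_of_mem_splits hs
      refine ⟨?_, by simp⟩
      simp only [letterCount, List.map_cons, List.sum_cons, List.length_cons, List.length_append]
      omega
    · have := ih ht
      simp only [letterCount, List.map_cons, List.sum_cons, List.length_cons] at this ⊢
      omega

/-! ### Derivations acting on traces of words. -/

section WordMatrix

variable {R : Type*} [CommRing R] {N : ℕ} (X Y : Bool → Matrix (Fin N) (Fin N) R)

/-- The product of the matrices `Y b * X b` along a word. -/
def wordMatrix (w : List Bool) : Matrix (Fin N) (Fin N) R := (w.map fun b => Y b * X b).prod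

theorem wordMatrix_cons (b : Bool) (w : List Bool) :
    wordMatrix X Y (b :: w) = Y b * (X b * wordMatrix X Y w) := by
  simp [wordMatrix, mul_assoc]

theorem wordMatrix_append (v w : List Bool) :
    wordMatrix X Y (v ++ w) = wordMatrix X Y v * wordMatrix X Y w := by
  simp [wordMatrix]

/-- The trace of the product of the matrices `Y b * X b` along a word. -/
def wordTrace (w : List Bool) : R := Matrix.trace (wordMatrix X Y w)

/-- The product of the traces of several words. -/
def wordTraces (ws : List (List Bool)) : R := (ws.map (wordTrace X Y)).prod

theorem wordTraces_cons (w : List Bool) (ws : List (List Bool)) :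
    wordTraces X Y (w :: ws) = wordTrace X Y w * wordTraces X Y ws := by
  simp [wordTraces]

variable {X Y} {K : Type*} [CommRing K] [Algebra K R] (D : Derivation K R R)
  {b : Bool} {i j : Fin N}
  (hX : ∀ c k l, D (X c k l) = if c = b ∧ k = j ∧ l = i then 1 else 0)
  (hY : ∀ c k l, D (Y c k l) = 0)

theorem sum_list_map_mul_left {ι : Type*} (L : List ι) (f : ι → R) (c : R) :
    c * (L.map f).sum = (L.map fun s => c * f s).sum := by
  induction L with
  | nil => simp
  | cons a L ih => simp [mul_add, ih]

theorem sum_list_map_sum {ι κ : Type*} (L : List ι) (S : Finset κ) (f : κ → ι → R) :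
    ∑ k ∈ S, (L.map (f k)).sum = (L.map fun s => ∑ k ∈ S, f k s).sum := by
  induction L with
  | nil => simp
  | cons a L ih => simp [Finset.sum_add_distrib, ih]

include hX hY in
-- By the Leibniz rule, D hits one occurrence of `X b` at a time and replaces it by the matrix unit
-- at (j, i), which cuts the product into the two halves of a split.
theorem derivation_wordMatrix (w : List Bool) (p q : Fin N) :
    D (wordMatrix X Y w p q) =
      ((splits b w).map fun s => (wordMatrix X Y s.1 * Y b) p j * wordMatrix X Y s.2 i q).sum := by
  induction w generalizing p q with
  | nil =>
    simp only [wordMatrix, List.map_nil, List.prod_nil, splits, List.sum_nil, Matrix.one_apply]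
    split_ifs <;> simp
  | cons c w ih =>
    have hD : D (wordMatrix X Y (c :: w) p q) =
        (if c = b then Y b p j * wordMatrix X Y w i q else 0) +
          ∑ k, (Y c * X c) p k * D (wordMatrix X Y w k q) := by
      rw [wordMatrix_cons, ← Matrix.mul_assoc, Matrix.mul_apply, map_sum]
      simp only [Derivation.leibniz, smul_eq_mul, Finset.sum_add_distrib]
      rw [add_comm]
      congr 1
      have h1 : ∀ k, D ((Y c * X c) p k) = if c = b ∧ k = i then Y b p j else 0 := by
        intro k
        rw [Matrix.mul_apply, map_sum]
        simp only [Derivation.leibniz, hX, hY, smul_eq_mul, mul_zero, add_zero]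
        by_cases hc : c = b
        · by_cases hk : k = i
          · simp [hc, hk]
          · simp [hk]
        · simp [hc]
      simp only [h1]
      by_cases hc : c = b
      · simp [hc, mul_comm]
      · simp [hc]
    rw [hD, splits, List.map_append, List.sum_append]
    congr 1
    · split_ifs
      · simp [wordMatrix]
      · simp
    · simp only [ih, sum_list_map_mul_left, sum_list_map_sum, List.map_map]
      congr 1
      refine List.map_congr_left fun s _ => ?_
      simp only [Function.comp]
      rw [wordMatrix_cons, ← Matrix.mul_assoc, Matrix.mul_assoc (Y c * X c), Matrix.mul_apply,
        Finset.sum_mul]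
      exact Finset.sum_congr rfl fun k _ => by ring

include hX hY in
-- Cutting a cyclic word once leaves a single word, read from the cut around to the cut; hence the
-- order `s.2 ++ s.1`.
theorem derivation_wordTrace (w : List Bool) :
    D (wordTrace X Y w) =
      ((splits b w).map fun s => (wordMatrix X Y (s.2 ++ s.1) * Y b) i j).sum := by
  rw [wordTrace, Matrix.trace, map_sum]
  simp only [Matrix.diag_apply, derivation_wordMatrix D hX hY, sum_list_map_sum]
  congr 1
  refine List.map_congr_left fun s _ => ?_
  rw [wordMatrix_append, Matrix.mul_assoc, Matrix.mul_apply]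
  exact Finset.sum_congr rfl fun k _ => by ring

include hX hY in
-- The first term comes from the leading `X b`; it does not depend on j, so summation over i and j
-- turns it into N times the trace of U.
theorem derivation_mul_wordMatrix (U : List Bool) :
    D ((X b * wordMatrix X Y U) j i) = wordMatrix X Y U i i +
      ((splits b U).map fun s =>
        (X b * (wordMatrix X Y s.1 * Y b)) j j * wordMatrix X Y s.2 i i).sum := by
  rw [Matrix.mul_apply, map_sum]
  simp only [Derivation.leibniz, smul_eq_mul, Finset.sum_add_distrib, hX]
  rw [add_comm]
  congr 1
  · simp
  · simp only [derivation_wordMatrix D hX hY, sum_list_map_mul_left, sum_list_map_sum]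
    congr 1
    refine List.map_congr_left fun s _ => ?_
    rw [Matrix.mul_apply (M := X b), Finset.sum_mul]
    exact Finset.sum_congr rfl fun k _ => by ring

end WordMatrix

/-! ### The Schwinger–Dyson equation. -/

section SchwingerDyson

variable {R : Type*} [CommRing R] {N : ℕ} {X Y : Bool → Matrix (Fin N) (Fin N) R}
  {K : Type*} [CommRing K] [Algebra K R] {D : Bool → Fin N → Fin N → Derivation K R R}
  (hX : ∀ b j i c k l, D b j i (X c k l) = if c = b ∧ k = j ∧ l = i then 1 else 0)
  (hY : ∀ b j i c k l, D b j i (Y c k l) = 0)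

include hX hY in
-- Contracting the entry with the derivative of another trace glues the word `b :: U` into that
-- trace at one of its letters `b`.
theorem sum_mul_derivation_wordTraces (b : Bool) (U : List Bool) (ws : List (List Bool)) :
    ∑ i, ∑ j, (X b * wordMatrix X Y U) j i * D b j i (wordTraces X Y ws) =
      ((merges b U ws).map (wordTraces X Y)).sum := by
  induction ws with
  | nil => simp [wordTraces, merges]
  | cons w ws ih =>
    rw [merges, List.map_append, List.sum_append]
    simp only [wordTraces_cons, Derivation.leibniz, smul_eq_mul, mul_add, Finset.sum_add_distrib]
    rw [add_comm]
    congr 1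
    · simp only [derivation_wordTrace (D b _ _) (hX b _ _) (hY b _ _), sum_list_map_mul_left,
        sum_list_map_sum, List.map_map]
      congr 1
      refine List.map_congr_left fun s _ => ?_
      simp only [Function.comp, wordTraces_cons]
      have : wordTrace X Y (b :: (U ++ (s.2 ++ s.1))) =
          ∑ i, ∑ j, (X b * wordMatrix X Y U) j i * (wordMatrix X Y (s.2 ++ s.1) * Y b) i j := by
        rw [wordTrace, wordMatrix_cons, wordMatrix_append, Matrix.trace_mul_comm,
          ← Matrix.mul_assoc (X b), Matrix.mul_assoc, Matrix.trace, Finset.sum_comm]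
        simp only [Matrix.diag_apply]
        exact Finset.sum_congr rfl fun k _ => Matrix.mul_apply
      rw [this, Finset.sum_mul]
      refine Finset.sum_congr rfl fun i _ => ?_
      rw [Finset.sum_mul]
      exact Finset.sum_congr rfl fun j _ => by ring
    · rw [List.map_map]
      have : ∀ l, (wordTraces X Y ∘ fun l => w :: l) l = wordTrace X Y w * wordTraces X Y l :=
        fun l => wordTraces_cons X Y w l
      rw [List.map_congr_left fun l _ => this l, ← sum_list_map_mul_left, ← ih, Finset.mul_sum]
      refine Finset.sum_congr rfl fun i _ => ?_
      rw [Finset.mul_sum]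
      exact Finset.sum_congr rfl fun j _ => by ring

include hX hY in
/-- The Schwinger–Dyson equation for a linear functional that satisfies integration by parts. -/
theorem schwinger_dyson (L : R →ₗ[K] K) (hL : ∀ b i j F, L (Y b i j * F) = L (D b j i F))
    (b : Bool) (U : List Bool) (ws : List (List Bool)) :
    L (wordTraces X Y ((b :: U) :: ws)) = N * L (wordTraces X Y (U :: ws)) +
      ((splits b U).map fun s => L (wordTraces X Y ((b :: s.1) :: s.2 :: ws))).sum +
      ((merges b U ws).map fun ms => L (wordTraces X Y ms)).sum := by
  have hsum : ∀ {ι : Type} (S : List ι) (f : ι → R),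
      (S.map fun s => L (f s)).sum = L (S.map f).sum := by
    intro ι S f
    induction S with
    | nil => simp
    | cons a S ih => simp [ih]
  -- The leading `Y b` of the first word is isolated; `hL` trades it for the derivation.
  have e1 : wordTraces X Y ((b :: U) :: ws) =
      ∑ i, ∑ j, Y b i j * ((X b * wordMatrix X Y U) j i * wordTraces X Y ws) := by
    rw [wordTraces_cons, wordTrace, wordMatrix_cons, Matrix.trace, Finset.sum_mul]
    refine Finset.sum_congr rfl fun i _ => ?_
    rw [Matrix.diag_apply, Matrix.mul_apply, Finset.sum_mul]
    exact Finset.sum_congr rfl fun j _ => by ring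
  -- The derivation acts on the leading `X b` (factor N), on the rest of the first word (splits) and
  -- on the other words (merges).
  have e2 : ∑ i, ∑ j, D b j i ((X b * wordMatrix X Y U) j i * wordTraces X Y ws) =
      (N : R) * wordTraces X Y (U :: ws) +
      ((splits b U).map fun s => wordTraces X Y ((b :: s.1) :: s.2 :: ws)).sum +
      ((merges b U ws).map (wordTraces X Y)).sum := by
    simp only [Derivation.leibniz, smul_eq_mul, Finset.sum_add_distrib]
    rw [add_comm, sum_mul_derivation_wordTraces hX hY]
    congr 1
    simp only [derivation_mul_wordMatrix (D b _ _) (hX b _ _) (hY b _ _), mul_add,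
      Finset.sum_add_distrib]
    congr 1
    · rw [wordTraces_cons, wordTrace, Matrix.trace]
      simp only [Finset.sum_const, Finset.card_univ, Fintype.card_fin, nsmul_eq_mul,
        Matrix.diag_apply]
      rw [← Finset.mul_sum, Finset.sum_mul]
      congr 1
      exact Finset.sum_congr rfl fun j _ => by ring
    · simp only [sum_list_map_mul_left, sum_list_map_sum]
      congr 1
      refine List.map_congr_left fun s _ => ?_
      rw [wordTraces_cons, wordTraces_cons, wordTrace, wordTrace, wordMatrix_cons,
        Matrix.trace_mul_comm, Matrix.mul_assoc]
      simp only [Matrix.trace, Matrix.diag_apply]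
      simp only [Finset.sum_mul, Finset.mul_sum]
      exact Finset.sum_congr rfl fun i _ => Finset.sum_congr rfl fun j _ => by ring
  rw [e1, map_sum]
  simp only [map_sum, hL]
  simp only [← map_sum]
  rw [e2, map_add, map_add, hsum, hsum]
  congr 2
  rw [← nsmul_eq_mul, map_nsmul, nsmul_eq_mul]

end SchwingerDyson

/-! ### Limits for alternating words. -/

/-- The limits of the normalized traces of words. -/
noncomputable def wordLimit : List Bool → ℝ
  | [] => 1
  | b :: U => wordLimit U +
      ((splits b U).attach.map fun s => wordLimit (b :: s.1.1) * wordLimit s.1.2).sum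
termination_by w => w.length
decreasing_by
  all_goals
    first
    | (have := length_of_mem_splits s.2; simp only [List.length_cons]; omega)
    | simp

theorem wordLimit_cons (b : Bool) (U : List Bool) : wordLimit (b :: U) = wordLimit U +
    ((splits b U).map fun s => wordLimit (b :: s.1) * wordLimit s.2).sum := by
  rw [wordLimit]
  congr 2
  exact List.attach_map_val (f := fun s : List Bool × List Bool => wordLimit (b :: s.1) * wordLimit s.2)

/-- The alternating word of length `n` that starts with `b`. -/
def altWord : Bool → ℕ → List Bool
  | _, 0 => []
  | b, n + 1 => b :: altWord (!b) n

/-- In the alternating word that begins with the other letter, b occupies positions 1, 3, 5, ...,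
counted from 0. -/
theorem splits_altWord (b : Bool) (n : ℕ) :
    splits b (altWord (!b) n) = (List.range (n / 2)).map fun i =>
      (altWord (!b) (2 * i + 1), altWord (!b) (n - (2 * i + 2))) := by
  induction n using Nat.twoStepInduction with
  | zero => simp [altWord, splits]
  | one => simp [altWord, splits]
  | more n ih _ =>
    have e : altWord (!b) (n + 2) = (!b) :: b :: altWord (!b) n := by simp [altWord]
    rw [e, splits, splits, ih, show (n + 2) / 2 = n / 2 + 1 by omega, List.range_succ_eq_map]
    simp only [Bool.not_eq_eq_eq_not, List.map_append, List.map_map, List.map_cons]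
    simp only [if_true, List.nil_append, List.map_cons, List.map_nil,
      List.cons_append]
    simp [altWord, Function.comp_def, Nat.mul_add, Nat.add_sub_add_right]

/-- The separate term `wordLimit U` of the recursion becomes the summand i = 0. -/
theorem wordLimit_altWord_succ (b : Bool) (n : ℕ) :
    wordLimit (altWord b (n + 1)) = ∑ i ∈ Finset.range (n / 2 + 1),
      wordLimit (altWord b (2 * i)) * wordLimit (altWord (!b) (n - 2 * i)) := by
  rw [altWord, wordLimit_cons, splits_altWord, Finset.sum_range_succ', List.map_map, add_comm]
  congr 1
  simp [altWord, wordLimit]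

theorem wordLimit_altWord_not (n : ℕ) (b : Bool) :
    wordLimit (altWord (!b) n) = wordLimit (altWord b n) := by
  induction n using Nat.strong_induction_on generalizing b with
  | _ n ih =>
    rcases n with _ | n
    · simp [altWord]
    · rw [wordLimit_altWord_succ, wordLimit_altWord_succ]
      refine Finset.sum_congr rfl fun i hi => ?_
      have := Finset.mem_range.mp hi
      rw [ih (2 * i) (by omega), ih (n - 2 * i) (by omega) (!b)]

/-- With m for even and r for odd lengths, r is the convolution of m with itself and the shifted m
that of m with r. The generating functions satisfy R = M² and M = 1 + zMR, hence M = 1 + zM³. -/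
theorem wordLimit_altWord (b : Bool) (l : ℕ) : wordLimit (altWord b (2 * l)) = limitMoment l := by
  set m : ℕ → ℝ := fun l => wordLimit (altWord b (2 * l)) with hm
  set r : ℕ → ℝ := fun l => wordLimit (altWord b (2 * l + 1)) with hr
  have hrec : ∀ l, r l = ∑ p ∈ Finset.HasAntidiagonal.antidiagonal l, m p.1 * m p.2 := by
    intro l
    rw [Finset.Nat.sum_antidiagonal_eq_sum_range_succ_mk]
    simp only [hr, hm]
    rw [wordLimit_altWord_succ, show 2 * l / 2 + 1 = l.succ by omega]
    refine Finset.sum_congr rfl fun i hi => ?_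
    rw [wordLimit_altWord_not, Nat.mul_sub]
  have hmec : ∀ l, m (l + 1) = ∑ p ∈ Finset.HasAntidiagonal.antidiagonal l, m p.1 * r p.2 := by
    intro l
    rw [Finset.Nat.sum_antidiagonal_eq_sum_range_succ_mk]
    simp only [hr, hm]
    rw [show 2 * (l + 1) = 2 * l + 1 + 1 by ring, wordLimit_altWord_succ,
      show (2 * l + 1) / 2 + 1 = l.succ by omega]
    refine Finset.sum_congr rfl fun i hi => ?_
    have := Finset.mem_range.mp hi
    rw [wordLimit_altWord_not, show 2 * (l - i) + 1 = 2 * l + 1 - 2 * i by omega]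
  have h0 : m 0 = 1 := by simp [hm, altWord, wordLimit]
  refine eq_limitMoment_of_ternary h0 ?_ l
  have hR : PowerSeries.mk r = PowerSeries.mk m ^ 2 := by
    ext n
    rw [pow_two, PowerSeries.coeff_mul]
    simp [hrec]
  have hM : PowerSeries.mk m = 1 + PowerSeries.X * (PowerSeries.mk m * PowerSeries.mk r) := by
    ext n
    rcases n with _ | n
    · simp [h0]
    · rw [map_add, PowerSeries.coeff_succ_X_mul, PowerSeries.coeff_mul]
      simp [hmec, PowerSeries.coeff_one]
  rw [hR] at hM
  linear_combination hM

/-! ### Expectations of products of traces up to order N⁻². -/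

/-- The exponent of the matrix size in the normalization of a product of traces. -/
def traceWeight (ws : List (List Bool)) : ℕ := letterCount ws + ws.length

theorem norm_sum_map_sub_le {ι : Type*} (S : List ι) (f g : ι → ℂ) (C : ι → ℝ) (t : ℝ)
    (h : ∀ s ∈ S, ‖f s - g s‖ ≤ C s * t) :
    ‖(S.map f).sum - (S.map g).sum‖ ≤ (S.map C).sum * t := by
  induction S with
  | nil => simp
  | cons a S ih =>
    simp only [List.map_cons, List.sum_cons]
    rw [add_sub_add_comm, add_mul]
    exact (norm_add_le _ _).trans (add_le_add (h a (by simp)) (ih fun s hs => h s (by simp [hs])))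

/-- Induction on the number of letters. In the equation for `(b :: U) :: ws` the factor N makes up
for the lost letter, splitting preserves `traceWeight`, and merging lowers it by 2. So the first two
kinds of terms reproduce the recursion of `wordLimit`, and merges enter the error only. -/
theorem schwinger_dyson_asymptotics {T : ℕ → List (List Bool) → ℂ} (h0 : ∀ N, T N [] = 1)
    (hnil : ∀ N ws, T N ([] :: ws) = N * T N ws)
    (hcons : ∀ N b U ws, T N ((b :: U) :: ws) = N * T N (U :: ws) +
      ((splits b U).map fun s => T N ((b :: s.1) :: s.2 :: ws)).sum +
      ((merges b U ws).map fun ms => T N ms).sum) (ws : List (List Bool)) :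
    ∃ C : ℝ, 0 ≤ C ∧ ∀ N : ℕ, N ≠ 0 → ‖T N ws / (N : ℂ) ^ traceWeight ws -
      ((ws.map wordLimit).prod : ℝ)‖ ≤ C * ((N : ℝ) ^ 2)⁻¹ := by
  generalize hn : letterCount ws = n
  induction n using Nat.strong_induction_on generalizing ws with
  | _ n ih =>
  -- Empty words carry no letters; an inner induction on the list strips them.
  induction ws with
  | nil => exact ⟨0, le_rfl, fun N hN => by simp [h0, traceWeight, letterCount]⟩
  | cons w ws ihw =>
    rcases w with _ | ⟨b, U⟩
    · obtain ⟨C, hC0, hC⟩ := ihw (by simpa [letterCount] using hn)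
      refine ⟨C, hC0, fun N hN => ?_⟩
      have hN' : (N : ℂ) ≠ 0 := by exact_mod_cast hN
      have e : T N ([] :: ws) / (N : ℂ) ^ traceWeight ([] :: ws) =
          T N ws / (N : ℂ) ^ traceWeight ws := by
        rw [hnil, show traceWeight ([] :: ws) = traceWeight ws + 1 by
          simp [traceWeight, letterCount]; ring, pow_succ]
        field_simp
      rw [e, List.map_cons, List.prod_cons, wordLimit, one_mul]
      exact hC N hN
    · have hlc : letterCount ((b :: U) :: ws) = U.length + 1 + letterCount ws := by
        simp [letterCount]
      rw [hlc] at hn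
      have i1 := ih (letterCount (U :: ws)) (by simp [letterCount] at hn ⊢; omega) (U :: ws) rfl
      -- The constant is defined for every s, with value 0 off the list of splits, so that `choose`
      -- applies.
      have i2 : ∀ s : List Bool × List Bool, ∃ C : ℝ, 0 ≤ C ∧ (s ∈ splits b U → ∀ N : ℕ, N ≠ 0 →
          ‖T N ((b :: s.1) :: s.2 :: ws) / (N : ℂ) ^ traceWeight ((b :: s.1) :: s.2 :: ws) -
          ((((b :: s.1) :: s.2 :: ws).map wordLimit).prod : ℝ)‖ ≤ C * ((N : ℝ) ^ 2)⁻¹) := by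
        intro s
        by_cases hs : s ∈ splits b U
        · have hl := length_of_mem_splits hs
          obtain ⟨C, hC0, hC⟩ := ih _ (by simp [letterCount] at hn ⊢; omega)
            ((b :: s.1) :: s.2 :: ws) rfl
          exact ⟨C, hC0, fun _ => hC⟩
        · exact ⟨0, le_rfl, fun h => absurd h hs⟩
      -- Boundedness of the merged terms is enough, as they come with the factor N⁻².
      have i3 : ∀ ms : List (List Bool), ∃ C : ℝ, 0 ≤ C ∧ (ms ∈ merges b U ws → ∀ N : ℕ, N ≠ 0 →
          ‖T N ms / (N : ℂ) ^ traceWeight ms - 0‖ ≤ C * 1) := by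
        intro ms
        by_cases hs : ms ∈ merges b U ws
        · obtain ⟨hl, _⟩ := of_mem_merges hs
          obtain ⟨C, hC0, hC⟩ := ih _ (by omega) ms rfl
          refine ⟨C + |(ms.map wordLimit).prod|, by positivity, fun _ N hN => ?_⟩
          have h1 := hC N hN
          have hN1 : ((N : ℝ) ^ 2)⁻¹ ≤ 1 :=
            inv_le_one_of_one_le₀ (one_le_pow₀ (by exact_mod_cast Nat.one_le_iff_ne_zero.mpr hN))
          have h2 : C * ((N : ℝ) ^ 2)⁻¹ ≤ C := mul_le_of_le_one_right hC0 hN1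
          have h3 := norm_add_le (T N ms / (N : ℂ) ^ traceWeight ms -
            (((ms.map wordLimit).prod : ℝ) : ℂ)) (((ms.map wordLimit).prod : ℝ) : ℂ)
          rw [sub_add_cancel, Complex.norm_real, Real.norm_eq_abs] at h3
          rw [sub_zero, mul_one]
          linarith
        · exact ⟨0, le_rfl, fun h => absurd h hs⟩
      obtain ⟨C1, hC10, hC1⟩ := i1
      choose C2 hC20 hC2 using i2
      choose C3 hC30 hC3 using i3
      refine ⟨C1 + ((splits b U).map C2).sum + ((merges b U ws).map C3).sum, ?_, fun N hN => ?_⟩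
      · have h2 : 0 ≤ ((splits b U).map C2).sum := List.sum_nonneg (by
          simp only [List.mem_map]; rintro x ⟨s, _, rfl⟩; exact hC20 s)
        have h3 : 0 ≤ ((merges b U ws).map C3).sum := List.sum_nonneg (by
          simp only [List.mem_map]; rintro x ⟨s, _, rfl⟩; exact hC30 s)
        linarith
      have hN' : (N : ℂ) ≠ 0 := by exact_mod_cast hN
      have hw1 : traceWeight ((b :: U) :: ws) = traceWeight (U :: ws) + 1 := by
        simp [traceWeight, letterCount]; ring
      have e : T N ((b :: U) :: ws) / (N : ℂ) ^ traceWeight ((b :: U) :: ws) =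
          T N (U :: ws) / (N : ℂ) ^ traceWeight (U :: ws) +
          ((splits b U).map fun s => T N ((b :: s.1) :: s.2 :: ws) /
            (N : ℂ) ^ traceWeight ((b :: s.1) :: s.2 :: ws)).sum +
          ((N : ℂ) ^ 2)⁻¹ * ((merges b U ws).map fun ms => T N ms / (N : ℂ) ^ traceWeight ms).sum := by
        rw [hcons, add_div, add_div]
        congr 1
        · congr 1
          · rw [hw1, pow_succ]; field_simp
          · rw [div_eq_mul_inv, mul_comm, sum_list_map_mul_left]
            congr 1
            refine List.map_congr_left fun s hs => ?_
            have hl := length_of_mem_splits hs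
            rw [show traceWeight ((b :: s.1) :: s.2 :: ws) = traceWeight ((b :: U) :: ws) by
              simp [traceWeight, letterCount]; omega]
            rw [div_eq_mul_inv, mul_comm]
        · rw [div_eq_mul_inv, mul_comm, sum_list_map_mul_left, sum_list_map_mul_left]
          congr 1
          refine List.map_congr_left fun ms hms => ?_
          obtain ⟨hl, hl2⟩ := of_mem_merges hms
          rw [show traceWeight ((b :: U) :: ws) = traceWeight ms + 2 by
            simp [traceWeight] ; rw [hlc, hl, hl2]; ring, pow_add]
          field_simp
      have e2 : ((((b :: U) :: ws).map wordLimit).prod : ℝ) = ((((U :: ws).map wordLimit).prod : ℝ) : ℂ) +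
          ((splits b U).map fun s => ((((b :: s.1) :: s.2 :: ws).map wordLimit).prod : ℂ)).sum +
          ((N : ℂ) ^ 2)⁻¹ * ((merges b U ws).map fun _ => (0 : ℂ)).sum := by
        have hz : ((merges b U ws).map fun _ => (0 : ℂ)).sum = 0 := by simp
        rw [hz, mul_zero, add_zero]
        simp only [List.map_cons, List.prod_cons]
        rw [wordLimit_cons]
        have hcast : ∀ S : List (List Bool × List Bool), (((S.map fun s =>
            wordLimit (b :: s.1) * wordLimit s.2).sum : ℝ) : ℂ) * ((ws.map wordLimit).prod : ℝ) =
            (S.map fun s => ((wordLimit (b :: s.1) * (wordLimit s.2 * (ws.map wordLimit).prod) : ℝ) : ℂ)).sum := by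
          intro S
          induction S with
          | nil => simp
          | cons a S ih =>
            simp only [List.map_cons, List.sum_cons]
            rw [← ih]; push_cast; ring
        rw [← hcast]
        push_cast; ring
      rw [e, e2, add_sub_add_comm, add_sub_add_comm, ← mul_sub, add_mul, add_mul]
      refine (norm_add₃_le).trans (add_le_add (add_le_add (hC1 N hN) ?_) ?_)
      · exact norm_sum_map_sub_le _ _ _ _ _ fun s hs => hC2 s hs N hN
      · rw [norm_mul, mul_comm (((merges b U ws).map C3).sum)]
        refine mul_le_mul (by simp) ?_ (norm_nonneg _) (by positivity)
        have := norm_sum_map_sub_le _ (fun ms => T N ms / (N : ℂ) ^ traceWeight ms) (fun _ => 0) C3 1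
          fun ms hms => hC3 ms hms N hN
        rwa [mul_one] at this

/-! ### Gaussian moments of the matrix entries. -/

/-- The mixed moments `E[z^a \bar z^b]` of a standard complex Gaussian variable. -/
def gaussianMoment (a b : ℕ) : ℂ := if a = b then (a.factorial : ℂ) else 0

theorem gaussianMoment_symm (a b : ℕ) : gaussianMoment a b = gaussianMoment b a := by
  unfold gaussianMoment; by_cases h : a = b
  · simp [h]
  · simp [h, Ne.symm h]

/-- Gaussian integration by parts in one variable. For a = 0 both sides vanish, so the truncated a -
1 does no harm. -/
theorem gaussianMoment_succ_right (a b : ℕ) :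
    gaussianMoment a (b + 1) = a * gaussianMoment (a - 1) b := by
  unfold gaussianMoment
  rcases a with _ | a
  · simp
  · by_cases h : a = b
    · simp [h, Nat.factorial_succ]
    · simp [h]

theorem integrable_pow_mul_gaussian (a b : ℕ) :
    Integrable (fun z : ℂ => z ^ a * (starRingEnd ℂ z) ^ b * (Real.exp (-‖z‖ ^ 2) : ℂ)) := by
  have h := Complex.integral_rpow_mul_exp_neg_rpow (p := 2) (q := (a + b : ℕ)) (by norm_num)
    (by linarith [(Nat.cast_nonneg (a + b) : (0 : ℝ) ≤ ((a + b : ℕ) : ℝ))])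
  have hi : Integrable (fun z : ℂ => ‖z‖ ^ ((a + b : ℕ) : ℝ) * Real.exp (-‖z‖ ^ (2 : ℝ))) := by
    refine Integrable.of_integral_ne_zero ?_
    rw [h]
    have := Real.Gamma_pos_of_pos (s := (((a + b : ℕ) : ℝ) + 2) / 2) (by positivity)
    have := Real.pi_pos
    positivity
  refine hi.mono' ?_ (Eventually.of_forall fun z => ?_)
  · exact Continuous.aestronglyMeasurable (by fun_prop)
  · rw [norm_mul, norm_mul, norm_pow, norm_pow, Complex.norm_conj, Complex.norm_real,
      Real.norm_of_nonneg (Real.exp_pos _).le, Real.rpow_natCast, pow_add]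
    norm_cast

/-- For a = b this is a radial Gamma integral. For a ≠ b the rotation by the angle π/(a-b) preserves
the measure and reverses the sign of the integrand. -/
theorem integral_pow_mul_gaussian (a b : ℕ) :
    ∫ z : ℂ, z ^ a * (starRingEnd ℂ z) ^ b * (Real.exp (-‖z‖ ^ 2) : ℂ) =
      Real.pi * gaussianMoment a b := by
  unfold gaussianMoment
  split_ifs with hab
  · subst hab
    have h := Complex.integral_rpow_mul_exp_neg_rpow (p := 2) (q := (2 * a : ℕ)) (by norm_num)
      (by linarith [(Nat.cast_nonneg (2 * a) : (0 : ℝ) ≤ ((2 * a : ℕ) : ℝ))])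
    have e : ∀ z : ℂ, z ^ a * (starRingEnd ℂ z) ^ a * (Real.exp (-‖z‖ ^ 2) : ℂ) =
        ((‖z‖ ^ ((2 * a : ℕ) : ℝ) * Real.exp (-‖z‖ ^ (2 : ℝ)) : ℝ) : ℂ) := by
      intro z
      rw [← mul_pow, Complex.mul_conj, Complex.normSq_eq_norm_sq, Real.rpow_natCast, pow_mul]
      norm_cast
    simp_rw [e]
    rw [integral_complex_ofReal, h, show (((2 * a : ℕ) : ℝ) + 2) / 2 = a + 1 by push_cast; ring,
      Real.Gamma_nat_eq_factorial]
    push_cast; ring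
  · rw [mul_zero]
    set F : ℂ → ℂ := fun z => z ^ a * (starRingEnd ℂ z) ^ b * (Real.exp (-‖z‖ ^ 2) : ℂ) with hF
    have hab' : ((a : ℝ) - b) ≠ 0 := sub_ne_zero.mpr (by exact_mod_cast hab)
    set c : Circle := Circle.exp (Real.pi / (a - b)) with hc
    have hc1 : (c : ℂ) ^ a * (starRingEnd ℂ c) ^ b = -1 := by
      rw [← Circle.coe_inv_eq_conj, hc, ← Circle.exp_neg, Circle.coe_exp, Circle.coe_exp,
        ← Complex.exp_nat_mul, ← Complex.exp_nat_mul, ← Complex.exp_add, ← Complex.exp_pi_mul_I]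
      congr 1
      have : ((a : ℂ) - b) ≠ 0 := by exact_mod_cast hab'
      push_cast
      field_simp
      ring
    have hmp := (rotation c).measurePreserving.integral_comp
      (rotation c).toHomeomorph.measurableEmbedding F
    have e : ∀ z, F (rotation c z) = -F z := by
      intro z
      simp only [hF, rotation_apply, mul_pow, map_mul, norm_mul, Circle.norm_coe, one_mul]
      linear_combination (z ^ a * (starRingEnd ℂ z) ^ b * (Real.exp (-‖z‖ ^ 2) : ℂ)) * hc1
    simp_rw [e, integral_neg] at hmp
    exact self_eq_neg.mp hmp.symm

/-- The mixed monomial with the given exponents in the entries of a matrix. -/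
noncomputable def entryMonomial {N : ℕ} (a b : Fin N → Fin N → ℕ) (A : Fin N → Fin N → ℂ) : ℂ :=
  ∏ i, ∏ j, (A i j ^ a i j * (starRingEnd ℂ (A i j)) ^ b i j)

theorem re_trace_conjTranspose_mul {N : ℕ} (A : Fin N → Fin N → ℂ) :
    (Matrix.trace ((Matrix.of A).conjTranspose * Matrix.of A)).re = ∑ i, ∑ j, ‖A i j‖ ^ 2 := by
  rw [Matrix.trace, Complex.re_sum, Finset.sum_comm]
  refine Finset.sum_congr rfl fun j _ => ?_
  rw [Matrix.diag_apply, Matrix.mul_apply, Complex.re_sum]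
  refine Finset.sum_congr rfl fun i _ => ?_
  rw [Matrix.conjTranspose_apply, Matrix.of_apply, ← Complex.normSq_eq_norm_sq]
  have : star (A i j) * A i j = (Complex.normSq (A i j) : ℂ) := Complex.normSq_eq_conj_mul_self.symm
  rw [this, Complex.ofReal_re]

theorem ofReal_exp_trace_mul_entryMonomial {N : ℕ} (a b : Fin N → Fin N → ℕ)
    (A : Fin N → Fin N → ℂ) :
    (Real.exp (-(Matrix.trace ((Matrix.of A).conjTranspose * Matrix.of A)).re) : ℂ) *
      entryMonomial a b A =
      ∏ i, ∏ j, (A i j ^ a i j * (starRingEnd ℂ (A i j)) ^ b i j *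
        (Real.exp (-‖A i j‖ ^ 2) : ℂ)) := by
  simp only [entryMonomial, Finset.prod_mul_distrib]
  rw [mul_comm]
  congr 1
  rw [re_trace_conjTranspose_mul, ← Finset.sum_neg_distrib, Real.exp_sum]
  push_cast
  refine Finset.prod_congr rfl fun i _ => ?_
  rw [← Finset.sum_neg_distrib, Complex.exp_sum]

theorem continuous_trace_weight (N : ℕ) : Continuous fun A : Fin N → Fin N → ℂ =>
    Real.exp (-(Matrix.trace ((Matrix.of A).conjTranspose * Matrix.of A)).re) := by
  simp only [re_trace_conjTranspose_mul]
  fun_prop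

theorem continuous_entryMonomial {N : ℕ} (a b : Fin N → Fin N → ℕ) :
    Continuous (entryMonomial a b) := by
  unfold entryMonomial
  have : Continuous (starRingEnd ℂ) := Complex.continuous_conj
  fun_prop

/-- The weight and the monomial both factor over the entries, so Fubini leaves one complex variable.
-/
theorem gaussianWeight_entryMonomial {N : ℕ} (a b : Fin N → Fin N → ℕ) :
    Integrable (entryMonomial a b) (gaussianWeight N) ∧
      ∫ A, entryMonomial a b A ∂(gaussianWeight N) =
        ∏ i, ∏ j, (Real.pi * gaussianMoment (a i j) (b i j)) := by
  have hm := (continuous_trace_weight N).measurable.ennreal_ofReal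
  have e : ∀ A : Fin N → Fin N → ℂ, (ENNReal.ofReal (Real.exp
      (-(Matrix.trace ((Matrix.of A).conjTranspose * Matrix.of A)).re))).toReal •
      entryMonomial a b A = ∏ i, ∏ j, (A i j ^ a i j * (starRingEnd ℂ (A i j)) ^ b i j *
        (Real.exp (-‖A i j‖ ^ 2) : ℂ)) := by
    intro A
    rw [ENNReal.toReal_ofReal (Real.exp_pos _).le, ← ofReal_exp_trace_mul_entryMonomial]
    rfl
  constructor
  · rw [gaussianWeight, integrable_withDensity_iff_integrable_smul' hm (by simp)]
    simp_rw [e]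
    have h1 : ∀ i, Integrable (fun B : Fin N → ℂ => ∏ j, (B j ^ a i j *
        (starRingEnd ℂ (B j)) ^ b i j * (Real.exp (-‖B j‖ ^ 2) : ℂ))) := by
      intro i
      rw [volume_pi]
      exact Integrable.fintype_prod
        (f := fun j (z : ℂ) => (z ^ a i j * (starRingEnd ℂ z) ^ b i j * (Real.exp (-‖z‖ ^ 2) : ℂ)))
        fun j => integrable_pow_mul_gaussian _ _
    rw [volume_pi]
    exact Integrable.fintype_prod (f := fun i (B : Fin N → ℂ) => ∏ j, (B j ^ a i j *
        (starRingEnd ℂ (B j)) ^ b i j * (Real.exp (-‖B j‖ ^ 2) : ℂ))) h1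
  · rw [gaussianWeight, integral_withDensity_eq_integral_toReal_smul hm (by simp)]
    simp_rw [e]
    rw [integral_fintype_prod_volume_eq_prod
      (f := fun i (B : Fin N → ℂ) => ∏ j, (B j ^ a i j * (starRingEnd ℂ (B j)) ^ b i j *
        (Real.exp (-‖B j‖ ^ 2) : ℂ)))]
    refine Finset.prod_congr rfl fun i _ => ?_
    rw [integral_fintype_prod_volume_eq_prod
      (f := fun j z => (z ^ a i j * (starRingEnd ℂ z) ^ b i j * (Real.exp (-‖z‖ ^ 2) : ℂ)))]
    exact Finset.prod_congr rfl fun j _ => integral_pow_mul_gaussian _ _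

theorem gaussianWeight_univ (N : ℕ) :
    gaussianWeight N Set.univ = ENNReal.ofReal (∏ _i : Fin N, ∏ _j : Fin N, Real.pi) := by
  obtain ⟨hi, hv⟩ := gaussianWeight_entryMonomial (N := N) 0 0
  have e : ∀ A, entryMonomial (N := N) 0 0 A = 1 := by intro A; simp [entryMonomial]
  have hfin : IsFiniteMeasure (gaussianWeight N) := by
    have : Integrable (fun _ : Fin N → Fin N → ℂ => (1 : ℂ)) (gaussianWeight N) := by
      simpa only [funext e] using hi
    exact (integrable_const_iff_isFiniteMeasure one_ne_zero).mp this
  simp_rw [e] at hv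
  have h2 : (gaussianWeight N).real Set.univ = ∏ _i : Fin N, ∏ _j : Fin N, Real.pi := by
    simp only [integral_const, gaussianMoment, Pi.zero_apply] at hv
    simpa [← Complex.ofReal_pow] using hv
  rw [← h2, Measure.real, ENNReal.ofReal_toReal (measure_ne_top _ _)]

theorem gaussianLaw_entryMonomial {N : ℕ} (a b : Fin N → Fin N → ℕ) :
    Integrable (entryMonomial a b) (gaussianLaw N) ∧
      ∫ A, entryMonomial a b A ∂(gaussianLaw N) =
        ∏ i, ∏ j, gaussianMoment (a i j) (b i j) := by
  obtain ⟨hi, hv⟩ := gaussianWeight_entryMonomial (N := N) a b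
  have hp : 0 < ∏ _i : Fin N, ∏ _j : Fin N, Real.pi :=
    Finset.prod_pos fun _ _ => Finset.prod_pos fun _ _ => Real.pi_pos
  constructor
  · refine hi.smul_measure ?_
    rw [gaussianWeight_univ]
    simpa using hp
  · rw [gaussianLaw, integral_smul_measure, hv, gaussianWeight_univ, ENNReal.toReal_inv,
      ENNReal.toReal_ofReal hp.le]
    simp only [Finset.prod_mul_distrib, Complex.real_smul]
    push_cast
    rw [← mul_assoc, inv_mul_cancel₀, one_mul]
    exact_mod_cast hp.ne'

/-! ### Polynomials in the entries of two independent matrices. -/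

/-- Variables for the entries of two matrices `A`, `Bᴴ` and for their complex conjugates. -/
abbrev EntryVar (N : ℕ) := (Bool × Fin N × Fin N) ⊕ (Bool × Fin N × Fin N)

/-- The values of the variables at a pair of matrices. -/
noncomputable def entryEval {N : ℕ} (A B : Fin N → Fin N → ℂ) : EntryVar N → ℂ
  | .inl (false, i, j) => A i j
  | .inl (true, i, j) => starRingEnd ℂ (B j i)
  | .inr (false, i, j) => starRingEnd ℂ (A i j)
  | .inr (true, i, j) => B j i

theorem eval_monomial_entryEval {N : ℕ} (A B : Fin N → Fin N → ℂ) (d : EntryVar N →₀ ℕ) :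
    MvPolynomial.eval (entryEval A B) (MvPolynomial.monomial d 1) =
      entryMonomial (fun i j => d (.inl (false, i, j))) (fun i j => d (.inr (false, i, j))) A *
      entryMonomial (fun i j => d (.inr (true, j, i))) (fun i j => d (.inl (true, j, i))) B := by
  rw [MvPolynomial.eval_monomial, one_mul, Finsupp.prod_fintype _ _ (fun _ => pow_zero _)]
  simp only [Fintype.prod_sum_type, Fintype.prod_prod_type, Fintype.prod_bool, entryEval,
    entryMonomial, Finset.prod_mul_distrib]
  rw [Finset.prod_comm (f := fun i j => starRingEnd ℂ (B j i) ^ d (Sum.inl (true, i, j))),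
    Finset.prod_comm (f := fun i j => B j i ^ d (Sum.inr (true, i, j)))]
  ring

section Expectation

variable {Ω : Type*} [MeasurableSpace Ω] {P : Measure Ω} {N : ℕ}
  {A B : Ω → Fin N → Fin N → ℂ} (hA : HasLaw A (gaussianLaw N) P)
  (hB : HasLaw B (gaussianLaw N) P) (hAB : IndepFun A B P)

theorem HasLaw.integrable_comp_gaussian {X : Ω → Fin N → Fin N → ℂ}
    (hX : HasLaw X (gaussianLaw N) P) (a b : Fin N → Fin N → ℕ) :
    Integrable (fun ω => entryMonomial a b (X ω)) P := by
  have h := (gaussianLaw_entryMonomial a b).1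
  rw [← hX.map_eq] at h
  exact h.comp_aemeasurable hX.aemeasurable

include hA hB hAB in
theorem integrable_eval_entryEval (F : MvPolynomial (EntryVar N) ℂ) :
    Integrable (fun ω => MvPolynomial.eval (entryEval (A ω) (B ω)) F) P := by
  induction F using MvPolynomial.induction_on' with
  | add p q hp hq =>
    simp only [map_add]
    exact hp.add hq
  | monomial d c =>
    have e : MvPolynomial.monomial d c = MvPolynomial.C c * MvPolynomial.monomial d 1 := by
      rw [MvPolynomial.C_mul_monomial, mul_one]
    simp only [e, map_mul, MvPolynomial.eval_C, eval_monomial_entryEval]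
    refine Integrable.const_mul ?_ _
    exact IndepFun.integrable_mul
      (hAB.comp (continuous_entryMonomial _ _).measurable (continuous_entryMonomial _ _).measurable)
      (HasLaw.integrable_comp_gaussian hA _ _) (HasLaw.integrable_comp_gaussian hB _ _)

/-- The expectation of polynomials in the entries of two independent Gaussian matrices. -/
noncomputable def entryExpectation : MvPolynomial (EntryVar N) ℂ →ₗ[ℂ] ℂ where
  toFun F := ∫ ω, MvPolynomial.eval (entryEval (A ω) (B ω)) F ∂P
  map_add' F G := by
    simp only [map_add]
    exact integral_add (integrable_eval_entryEval hA hB hAB F) (integrable_eval_entryEval hA hB hAB G)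
  map_smul' c F := by
    simp only [MvPolynomial.smul_eval, integral_const_mul, RingHom.id_apply, smul_eq_mul]

theorem entryExpectation_monomial (d : EntryVar N →₀ ℕ) :
    entryExpectation hA hB hAB (MvPolynomial.monomial d 1) =
      ∏ s : Bool × Fin N × Fin N, gaussianMoment (d (.inl s)) (d (.inr s)) := by
  change ∫ ω, _ ∂P = _
  simp_rw [eval_monomial_entryEval]
  rw [hAB.integral_fun_comp_mul_comp hA.aemeasurable hB.aemeasurable
    (continuous_entryMonomial _ _).aestronglyMeasurable
    (continuous_entryMonomial _ _).aestronglyMeasurable]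
  have eA := hA.integral_comp (continuous_entryMonomial (fun i j => d (.inl (false, i, j)))
    (fun i j => d (.inr (false, i, j)))).aestronglyMeasurable
  have eB := hB.integral_comp (continuous_entryMonomial (fun i j => d (.inr (true, j, i)))
    (fun i j => d (.inl (true, j, i)))).aestronglyMeasurable
  simp only [Function.comp_def] at eA eB
  rw [eA, eB, (gaussianLaw_entryMonomial _ _).2, (gaussianLaw_entryMonomial _ _).2,
    Fintype.prod_prod_type, Fintype.prod_bool, Fintype.prod_prod_type, Fintype.prod_prod_type,
    mul_comm]
  congr 1
  rw [Finset.prod_comm]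
  exact Finset.prod_congr rfl fun i _ => Finset.prod_congr rfl fun j _ => gaussianMoment_symm _ _

/-- Gaussian integration by parts. -/
theorem entryExpectation_X_mul (s : Bool × Fin N × Fin N) (F : MvPolynomial (EntryVar N) ℂ) :
    entryExpectation hA hB hAB (MvPolynomial.X (.inr s) * F) =
      entryExpectation hA hB hAB (MvPolynomial.pderiv (.inl s) F) := by
  -- By linearity monomials suffice. Their expectation is a product over the entries in which only
  -- the factor at s changes.
  suffices h : ∀ d, entryExpectation hA hB hAB (MvPolynomial.X (.inr s) * MvPolynomial.monomial d 1) =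
      entryExpectation hA hB hAB (MvPolynomial.pderiv (.inl s) (MvPolynomial.monomial d 1)) by
    induction F using MvPolynomial.induction_on' with
    | add p q hp hq => rw [mul_add, map_add, map_add, map_add, hp, hq]
    | monomial d c =>
      have e : MvPolynomial.monomial d c = c • (MvPolynomial.monomial d 1 : MvPolynomial _ ℂ) := by
        rw [MvPolynomial.smul_monomial, smul_eq_mul, mul_one]
      rw [e, mul_smul_comm, map_smul, Derivation.map_smul, map_smul, h]
  intro d
  have e : (MvPolynomial.monomial (d - Finsupp.single (Sum.inl s) 1) ((1 : ℂ) * (d (Sum.inl s) : ℂ)) :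
      MvPolynomial (EntryVar N) ℂ) = (d (Sum.inl s) : ℂ) •
        MvPolynomial.monomial (d - Finsupp.single (Sum.inl s) 1) 1 := by
    rw [MvPolynomial.smul_monomial, smul_eq_mul, one_mul, mul_one]
  rw [MvPolynomial.pderiv_monomial, e, map_smul, MvPolynomial.X, MvPolynomial.monomial_mul,
    mul_one, entryExpectation_monomial, entryExpectation_monomial,
    ← Finset.mul_prod_erase _ _ (Finset.mem_univ s), ← Finset.mul_prod_erase _ _ (Finset.mem_univ s),
    smul_eq_mul, ← mul_assoc]
  congr 1
  · simp only [Finsupp.add_apply, Finsupp.tsub_apply, Finsupp.single_apply]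
    simp only [reduceCtorEq, if_false, if_true, zero_add, tsub_zero]
    rw [add_comm, gaussianMoment_succ_right]
  · refine Finset.prod_congr rfl fun t ht => ?_
    have hne : s ≠ t := (Finset.ne_of_mem_erase ht).symm
    simp [Finsupp.add_apply, Finsupp.tsub_apply, hne]

/-- The matrices `A` and `Bᴴ` of variables. -/
noncomputable def varMatrix (N : ℕ) (b : Bool) :
    Matrix (Fin N) (Fin N) (MvPolynomial (EntryVar N) ℂ) :=
  Matrix.of fun i j => MvPolynomial.X (.inl (b, i, j))

/-- The matrices `Aᴴ` and `B` of variables. -/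
noncomputable def conjVarMatrix (N : ℕ) (b : Bool) :
    Matrix (Fin N) (Fin N) (MvPolynomial (EntryVar N) ℂ) :=
  Matrix.of fun i j => MvPolynomial.X (.inr (b, j, i))

/-- The derivations are the partial derivatives in the unconjugated variables, and
`entryExpectation_X_mul` is the integration by parts. Each N is treated by itself. -/
theorem entryExpectation_asymptotics [IsProbabilityMeasure P]
    {A B : (N : ℕ) → Ω → Fin N → Fin N → ℂ} (hA : ∀ N, HasLaw (A N) (gaussianLaw N) P)
    (hB : ∀ N, HasLaw (B N) (gaussianLaw N) P) (hAB : ∀ N, IndepFun (A N) (B N) P)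
    (ws : List (List Bool)) :
    ∃ C : ℝ, 0 ≤ C ∧ ∀ N : ℕ, N ≠ 0 → ‖entryExpectation (hA N) (hB N) (hAB N)
        (wordTraces (varMatrix N) (conjVarMatrix N) ws) / (N : ℂ) ^ traceWeight ws -
      ((ws.map wordLimit).prod : ℝ)‖ ≤ C * ((N : ℝ) ^ 2)⁻¹ := by
  refine schwinger_dyson_asymptotics (T := fun N ws => entryExpectation (hA N) (hB N) (hAB N)
    (wordTraces (varMatrix N) (conjVarMatrix N) ws)) ?_ ?_ ?_ ws
  · intro N
    change ∫ ω, _ ∂P = 1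
    simp [wordTraces]
  · intro N ws
    have : wordTrace (varMatrix N) (conjVarMatrix N) [] = (N : MvPolynomial (EntryVar N) ℂ) := by
      simp [wordTrace, wordMatrix]
    rw [wordTraces_cons, this, ← nsmul_eq_mul, map_nsmul, nsmul_eq_mul]
  · intro N b U ws
    refine schwinger_dyson (D := fun b j i => MvPolynomial.pderiv (.inl (b, j, i))) ?_ ?_ _ ?_ b U ws
    · intro b j i c k l
      simp only [varMatrix, Matrix.of_apply, MvPolynomial.pderiv_X, Pi.single_apply]
      refine if_congr ?_ rfl rfl
      simp
    · intro b j i c k l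
      simp [conjVarMatrix, MvPolynomial.pderiv_X]
    · intro b i j F
      exact entryExpectation_X_mul _ _ _ _ F

end Expectation

/-! ### Almost sure convergence. -/

/-- The letters `false` and `true` evaluate to AᴴA and BBᴴ; cyclicity of the trace of a power
carries B around to form (AB)ᴴ(AB). -/
theorem eval_wordTrace_altWord {N : ℕ} (A B : Fin N → Fin N → ℂ) (l : ℕ) :
    MvPolynomial.eval (entryEval A B)
      (wordTrace (varMatrix N) (conjVarMatrix N) (altWord false (2 * l))) =
      Matrix.trace (((Matrix.of A * Matrix.of B).conjTranspose * (Matrix.of A * Matrix.of B)) ^ l) := by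
  set φ := MvPolynomial.eval (entryEval A B) with hφ
  have hX0 : (varMatrix N false).map φ = Matrix.of A := by
    ext i j; simp [varMatrix, hφ, entryEval]
  have hX1 : (varMatrix N true).map φ = (Matrix.of B).conjTranspose := by
    ext i j; simp [varMatrix, hφ, entryEval, Matrix.conjTranspose_apply]
  have hY0 : (conjVarMatrix N false).map φ = (Matrix.of A).conjTranspose := by
    ext i j; simp [conjVarMatrix, hφ, entryEval, Matrix.conjTranspose_apply]
  have hY1 : (conjVarMatrix N true).map φ = Matrix.of B := by
    ext i j; simp [conjVarMatrix, hφ, entryEval]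
  have hw : ∀ l, (wordMatrix (varMatrix N) (conjVarMatrix N) (altWord false (2 * l))).map φ =
      ((Matrix.of A).conjTranspose * Matrix.of A * (Matrix.of B * (Matrix.of B).conjTranspose)) ^ l := by
    intro l
    induction l with
    | zero => ext i j; simp [altWord, wordMatrix, Matrix.one_apply, apply_ite φ]
    | succ l ih =>
      rw [show altWord false (2 * (l + 1)) = false :: true :: altWord false (2 * l) by
        rw [show 2 * (l + 1) = 2 * l + 1 + 1 by ring]; rfl, wordMatrix_cons, wordMatrix_cons,
        Matrix.map_mul, Matrix.map_mul, Matrix.map_mul, Matrix.map_mul, ih, hX0, hX1, hY0, hY1,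
        pow_succ']
      simp only [Matrix.mul_assoc]
  have hpow : ∀ (S T : Matrix (Fin N) (Fin N) ℂ) (l : ℕ),
      Matrix.trace ((S * T) ^ l) = Matrix.trace ((T * S) ^ l) := by
    intro S T l
    rcases l with _ | l
    · simp
    · have : (S * T) ^ (l + 1) = S * ((T * S) ^ l * T) := by
        rw [pow_succ, ← mul_assoc, mul_pow_mul, mul_assoc]
      rw [this, Matrix.trace_mul_comm, pow_succ, mul_assoc]
  rw [wordTrace, AddMonoidHom.map_trace φ, hw, hpow, Matrix.mul_assoc (Matrix.of B), hpow,
    Matrix.conjTranspose_mul]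
  simp only [Matrix.mul_assoc]

/-- The series of squares has a finite integral, hence converges almost everywhere, and its terms
tend to 0. No independence is involved. -/
theorem ae_tendsto_zero_of_integral_sq_le {Ω : Type*} [MeasurableSpace Ω] {P : Measure Ω}
    {f : ℕ → Ω → ℝ} (hf : ∀ n, Integrable (fun ω => f n ω ^ 2) P) {C : ℝ}
    (hC : ∀ n, n ≠ 0 → ∫ ω, f n ω ^ 2 ∂P ≤ C * ((n : ℝ) ^ 2)⁻¹) :
    ∀ᵐ ω ∂P, Tendsto (fun n => f n ω) atTop (𝓝 0) := by
  -- The index is shifted because the bound is not available at n = 0.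
  set g : ℕ → Ω → ENNReal := fun n ω => ENNReal.ofReal (f (n + 1) ω ^ 2) with hg
  have hgm : ∀ n, AEMeasurable (g n) P := fun n => (hf (n + 1)).aemeasurable.ennreal_ofReal
  have hsum : ∫⁻ ω, ∑' n, g n ω ∂P ≠ ⊤ := by
    rw [lintegral_tsum hgm]
    have hs : Summable fun n : ℕ => C * (((n + 1 : ℕ) : ℝ) ^ 2)⁻¹ :=
      ((summable_nat_add_iff 1).mpr (Real.summable_nat_pow_inv.mpr one_lt_two)).mul_left C
    have hle : ∀ n, ∫⁻ ω, g n ω ∂P ≤ ENNReal.ofReal (C * (((n + 1 : ℕ) : ℝ) ^ 2)⁻¹) := by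
      intro n
      rw [← ofReal_integral_eq_lintegral_ofReal (hf (n + 1))
        (Eventually.of_forall fun ω => sq_nonneg _)]
      exact ENNReal.ofReal_le_ofReal (hC (n + 1) (by omega))
    refine ne_top_of_le_ne_top ?_ (ENNReal.tsum_le_tsum hle)
    exact hs.tsum_ofReal_ne_top
  filter_upwards [ae_lt_top' (AEMeasurable.tsum hgm) hsum] with ω hω
  have h1 := ENNReal.tendsto_atTop_zero_of_tsum_ne_top hω.ne
  have h2 : Tendsto (fun n => (g n ω).toReal) atTop (𝓝 0) := by
    simpa [Function.comp_def] using (ENNReal.tendsto_toReal ENNReal.zero_ne_top).comp h1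
  have h3 : Tendsto (fun n => f (n + 1) ω ^ 2) atTop (𝓝 0) := by
    refine h2.congr fun n => ?_
    rw [hg, ENNReal.toReal_ofReal (sq_nonneg _)]
  have h4 : Tendsto (fun n => |f (n + 1) ω|) atTop (𝓝 0) := by
    simpa [Real.sqrt_sq_eq_abs, Function.comp_def] using (Real.continuous_sqrt.tendsto 0).comp h3
  exact (tendsto_add_atTop_iff_nat 1).mp ((tendsto_zero_iff_abs_tendsto_zero _).mpr h4)

section AlmostSure

variable {Ω : Type*} [MeasurableSpace Ω] {P : Measure Ω} [IsProbabilityMeasure P]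
  {A B : (N : ℕ) → Ω → Fin N → Fin N → ℂ} (hA : ∀ N, HasLaw (A N) (gaussianLaw N) P)
  (hB : ∀ N, HasLaw (B N) (gaussianLaw N) P) (hAB : ∀ N, IndepFun (A N) (B N) P)

include hA hB hAB in
-- The asymptotics for `[w]` and `[w, w]` give E S = m + O(N⁻²) and E S² = m² + O(N⁻²), so in E S² -
-- 2m E S + m² the leading terms cancel.
theorem ae_tendsto_moment (l : ℕ) : ∀ᵐ ω ∂P, Tendsto (fun N : ℕ =>
    ∫ x, x ^ l ∂(scaledEmpiricalMeasure (Matrix.of (A N ω) * Matrix.of (B N ω)))) atTop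
    (𝓝 (limitMoment l)) := by
  set S : ℕ → Ω → ℝ := fun N ω =>
    ∫ x, x ^ l ∂(scaledEmpiricalMeasure (Matrix.of (A N ω) * Matrix.of (B N ω))) with hS
  set w := altWord false (2 * l) with hw
  set T : (N : ℕ) → MvPolynomial (EntryVar N) ℂ := fun N =>
    wordTrace (varMatrix N) (conjVarMatrix N) w with hT
  have hlen : ∀ (n : ℕ) (b : Bool), (altWord b n).length = n := by
    intro n
    induction n with
    | zero => simp [altWord]
    | succ n ih => intro b; simp [altWord, ih]
  have hST : ∀ N ω, (S N ω : ℂ) =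
      MvPolynomial.eval (entryEval (A N ω) (B N ω)) (T N) / (N : ℂ) ^ (1 + 2 * l) := by
    intro N ω
    rw [hS, hT, hw, eval_wordTrace_altWord, integral_pow_scaledEmpiricalMeasure]
  have hm := wordLimit_altWord false l
  rw [← hw] at hm
  have hi1 : ∀ N, Integrable (S N) P := by
    intro N
    have := ((integrable_eval_entryEval (hA N) (hB N) (hAB N) (T N)).div_const
      ((N : ℂ) ^ (1 + 2 * l))).re
    refine this.congr (Eventually.of_forall fun ω => ?_)
    simp only [← hST]
    simp
  have hi2 : ∀ N, Integrable (fun ω => S N ω ^ 2) P := by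
    intro N
    have := ((integrable_eval_entryEval (hA N) (hB N) (hAB N) (T N ^ 2)).div_const
      (((N : ℂ) ^ (1 + 2 * l)) ^ 2)).re
    refine this.congr (Eventually.of_forall fun ω => ?_)
    simp only [map_pow, ← div_pow, ← hST, ← Complex.ofReal_pow]
    exact Complex.ofReal_re _
  have he1 : ∀ N, ((∫ ω, S N ω ∂P : ℝ) : ℂ) = entryExpectation (hA N) (hB N) (hAB N)
      (wordTraces (varMatrix N) (conjVarMatrix N) [w]) / (N : ℂ) ^ traceWeight [w] := by
    intro N
    rw [← integral_complex_ofReal]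
    simp_rw [hST]
    rw [integral_div, show traceWeight [w] = 1 + 2 * l by
      simp [traceWeight, letterCount, hw, hlen]; ring]
    simp [wordTraces, entryExpectation, hT]
  have he2 : ∀ N, ((∫ ω, S N ω ^ 2 ∂P : ℝ) : ℂ) = entryExpectation (hA N) (hB N) (hAB N)
      (wordTraces (varMatrix N) (conjVarMatrix N) [w, w]) / (N : ℂ) ^ traceWeight [w, w] := by
    intro N
    rw [← integral_complex_ofReal]
    simp_rw [Complex.ofReal_pow, hST, div_pow]
    rw [integral_div, show traceWeight [w, w] = (1 + 2 * l) * 2 by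
      simp [traceWeight, letterCount, hw, hlen]; ring, pow_mul]
    simp [wordTraces, entryExpectation, hT, sq]
  obtain ⟨C1, hC10, hC1⟩ := entryExpectation_asymptotics hA hB hAB [w]
  obtain ⟨C2, hC20, hC2⟩ := entryExpectation_asymptotics hA hB hAB [w, w]
  set m := limitMoment l with hmdef
  have hsq : ∀ N, ∀ ω, (S N ω - m) ^ 2 = S N ω ^ 2 - 2 * m * S N ω + m ^ 2 := by
    intro N ω; ring
  have hconv := ae_tendsto_zero_of_integral_sq_le (P := P) (f := fun N ω => S N ω - m)
    (C := C2 + 2 * |m| * C1) ?_ ?_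
  · filter_upwards [hconv] with ω hω
    have := hω.add_const m
    simpa using this
  · intro N
    simp_rw [hsq]
    exact ((hi2 N).sub ((hi1 N).const_mul _)).add (integrable_const _)
  · intro N hN
    have h1 := hC1 N hN
    have h2 := hC2 N hN
    rw [← he1, List.map_singleton, List.prod_singleton, hm, ← Complex.ofReal_sub,
      Complex.norm_real, Real.norm_eq_abs] at h1
    rw [← he2, List.map_cons, List.map_singleton, List.prod_cons, List.prod_singleton, hm,
      ← Complex.ofReal_sub, Complex.norm_real, Real.norm_eq_abs] at h2
    simp_rw [hsq]
    have hI : Integrable (fun ω => S N ω ^ 2 - 2 * m * S N ω) P :=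
      (hi2 N).sub ((hi1 N).const_mul _)
    rw [integral_add hI (integrable_const _),
      integral_sub (hi2 N) ((hi1 N).const_mul _), integral_const_mul, integral_const]
    simp only [probReal_univ, smul_eq_mul, one_mul]
    have h3 : -(2 * m * (∫ ω, S N ω ∂P - m)) ≤ 2 * |m| * (C1 * ((N : ℝ) ^ 2)⁻¹) := by
      have h4 := mul_le_mul_of_nonneg_left h1 (by positivity : 0 ≤ 2 * |m|)
      have h5 := neg_abs_le (2 * m * (∫ ω, S N ω ∂P - m))
      rw [abs_mul, abs_mul, abs_two] at h5
      linarith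
    have h6 := (abs_le.mp h2).2
    nlinarith

include hA hB hAB in
theorem ae_tendsto_scaledEmpiricalMeasure : ∀ᵐ ω ∂P,
    (∀ f : BoundedContinuousFunction ℝ ℝ, Tendsto (fun N : ℕ =>
      ∫ x, f x ∂(scaledEmpiricalMeasure (Matrix.of (A N ω) * Matrix.of (B N ω)))) atTop
      (𝓝 (∫ x, f x ∂limitMeasure))) ∧
    (∀ l : ℕ, Tendsto (fun N : ℕ =>
      ∫ x, x ^ l ∂(scaledEmpiricalMeasure (Matrix.of (A N ω) * Matrix.of (B N ω)))) atTop
      (𝓝 (∫ x, x ^ l ∂limitMeasure))) := by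
  filter_upwards [ae_all_iff.mpr fun l => ae_tendsto_moment hA hB hAB l] with ω hω
  have hm : ∀ l : ℕ, Tendsto (fun N : ℕ =>
      ∫ x, x ^ l ∂(scaledEmpiricalMeasure (Matrix.of (A N ω) * Matrix.of (B N ω)))) atTop
      (𝓝 (∫ x, x ^ l ∂limitMeasure)) := by
    intro l; rw [integral_pow_limitMeasure]; exact hω l
  have := isProbabilityMeasure_limitMeasure
  refine ⟨fun f => ?_, hm⟩
  -- Any S beyond the right end 27/4 of the support would serve.
  refine tendsto_integral_of_tendsto_moments (R := 27 / 4) (S := 8) (by norm_num) (by norm_num)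
    (by norm_num) (ae_limitMeasure_mem.mono fun x hx => ⟨hx.1.le, hx.2.le⟩)
    (ν := fun N => scaledEmpiricalMeasure (Matrix.of (A N ω) * Matrix.of (B N ω))) ?_
    (fun n => ae_nonneg_scaledEmpiricalMeasure _) hm f
  filter_upwards [eventually_ne_atTop 0] with N hN f
  exact integrable_scaledEmpiricalMeasure hN _ f

end AlmostSure

/-! ### Biorthogonality as Laguerre orthogonality. -/

theorem integrableOn_pow_mul_exp_neg_mul (n : ℕ) {r : ℝ} (hr : 0 < r) :
    IntegrableOn (fun y : ℝ => y ^ n * Real.exp (-(r * y))) (Set.Ioi 0) := by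
  have h := integrableOn_rpow_mul_exp_neg_mul_rpow (p := 1) (s := n)
    (lt_of_lt_of_le (by norm_num) (Nat.cast_nonneg n)) zero_lt_one hr
  refine h.congr_fun (fun y _ => ?_) measurableSet_Ioi
  simp [Real.rpow_natCast]

theorem integral_pow_mul_exp_neg_mul (n : ℕ) {r : ℝ} (hr : 0 < r) :
    ∫ y in Set.Ioi (0 : ℝ), y ^ n * Real.exp (-(r * y)) = n.factorial * (1 / r) ^ (n + 1) := by
  have h := Real.integral_rpow_mul_exp_neg_mul_Ioi (a := n + 1) (r := r) (by positivity) hr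
  rw [Real.Gamma_nat_eq_factorial] at h
  rw [mul_comm, ← Real.rpow_natCast, Nat.cast_add_one, ← h]
  refine setIntegral_congr_fun measurableSet_Ioi fun y _ => ?_
  simp [Real.rpow_natCast]

/-- The linear functional `p ↦ ∫ p(y) e^{-y} dy` over the positive half-line. -/
noncomputable def expFunctional : ℝ[X] →ₗ[ℝ] ℝ :=
  lsum fun n => (n.factorial : ℝ) • LinearMap.id

/-- The linear map sending `x ^ a` to `a! x ^ a`. -/
noncomputable def factorialMap : ℝ[X] →ₗ[ℝ] ℝ[X] :=
  lsum fun n => (n.factorial : ℝ) • monomial n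

@[simp] theorem expFunctional_monomial (n : ℕ) (c : ℝ) :
    expFunctional (monomial n c) = n.factorial * c := by
  simp [expFunctional, lsum_apply, sum_monomial_index]

@[simp] theorem factorialMap_monomial (n : ℕ) (c : ℝ) :
    factorialMap (monomial n c) = monomial n (n.factorial * c) := by
  simp [factorialMap, lsum_apply, sum_monomial_index, smul_monomial]

theorem coeff_factorialMap (p : ℝ[X]) (n : ℕ) :
    (factorialMap p).coeff n = n.factorial * p.coeff n := by
  induction p using Polynomial.induction_on' with
  | add p q hp hq => simp [hp, hq, mul_add]
  | monomial k c =>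
    rw [factorialMap_monomial, coeff_monomial, coeff_monomial]
    split_ifs with h
    · rw [h]
    · simp

theorem integrableOn_eval_mul_exp_neg (p : ℝ[X]) :
    IntegrableOn (fun y : ℝ => p.eval y * Real.exp (-y)) (Set.Ioi 0) := by
  induction p using Polynomial.induction_on' with
  | add p q hp hq =>
    simp only [eval_add, add_mul]
    exact Integrable.add hp hq
  | monomial k c =>
    have := (integrableOn_pow_mul_exp_neg_mul k one_pos).const_mul c
    simpa [mul_assoc, IntegrableOn] using this

theorem integral_eval_mul_exp_neg (p : ℝ[X]) :
    ∫ y in Set.Ioi (0 : ℝ), p.eval y * Real.exp (-y) = expFunctional p := by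
  induction p using Polynomial.induction_on' with
  | add p q hp hq =>
    simp only [eval_add, add_mul, map_add]
    rw [integral_add (integrableOn_eval_mul_exp_neg p) (integrableOn_eval_mul_exp_neg q), hp, hq]
  | monomial k c =>
    have := integral_pow_mul_exp_neg_mul k one_pos
    simp only [one_mul, div_one, one_pow, mul_one] at this
    simp only [eval_monomial, mul_assoc, integral_const_mul, this, expFunctional_monomial]
    ring

theorem integrableOn_eval_mul_exp_neg_div (p : ℝ[X]) {y : ℝ} (hy : 0 < y) :
    IntegrableOn (fun x : ℝ => p.eval x * Real.exp (-(x / y))) (Set.Ioi 0) := by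
  induction p using Polynomial.induction_on' with
  | add p q hp hq =>
    simp only [eval_add, add_mul]
    exact Integrable.add hp hq
  | monomial k c =>
    have := (integrableOn_pow_mul_exp_neg_mul k (inv_pos.mpr hy)).const_mul c
    simpa [mul_assoc, div_eq_inv_mul, IntegrableOn] using this

theorem integral_eval_mul_exp_neg_div (p : ℝ[X]) {y : ℝ} (hy : 0 < y) :
    ∫ x in Set.Ioi (0 : ℝ), p.eval x * Real.exp (-(x / y)) = y * (factorialMap p).eval y := by
  induction p using Polynomial.induction_on' with
  | add p q hp hq =>
    simp only [eval_add, add_mul, map_add, mul_add]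
    rw [integral_add (integrableOn_eval_mul_exp_neg_div p hy)
      (integrableOn_eval_mul_exp_neg_div q hy), hp, hq]
  | monomial k c =>
    have := integral_pow_mul_exp_neg_mul k (inv_pos.mpr hy)
    simp only [one_div, inv_inv] at this
    simp only [eval_monomial, mul_assoc, integral_const_mul, div_eq_inv_mul, this,
      factorialMap_monomial]
    ring

/-- The integral over x sends x^a to a! y^{a+1}, and the extra y cancels the y⁻¹ of the weight. What
remains is the pairing of the Laguerre polynomials. -/
theorem integral_biorthWeight (p q : ℝ[X]) :
    (∫ y in Set.Ioi (0 : ℝ), ∫ x in Set.Ioi (0 : ℝ), biorthWeight x y * p.eval x * q.eval y) =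
      expFunctional (factorialMap p * q) := by
  rw [← integral_eval_mul_exp_neg]
  refine setIntegral_congr_fun measurableSet_Ioi fun y hy => ?_
  have hy' : (0 : ℝ) < y := hy
  have h : ∀ x : ℝ, biorthWeight x y * p.eval x * q.eval y =
      (y⁻¹ * Real.exp (-y) * q.eval y) * (p.eval x * Real.exp (-(x / y))) := by
    intro x
    rw [biorthWeight, sub_eq_add_neg, Real.exp_add]; ring
  simp only [h, integral_const_mul]
  rw [integral_eval_mul_exp_neg_div p hy', eval_mul]
  field_simp

/-- A nonnegative integrand with zero integral vanishes almost everywhere, while a nonzero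
polynomial has finitely many roots. -/
theorem eq_zero_of_expFunctional_mul_self {p : ℝ[X]} (h : expFunctional (p * p) = 0) : p = 0 := by
  rw [← integral_eval_mul_exp_neg] at h
  have hnn : 0 ≤ᵐ[volume.restrict (Set.Ioi (0 : ℝ))]
      fun y => (p * p).eval y * Real.exp (-y) := by
    refine Eventually.of_forall fun y => ?_
    simp only [eval_mul]
    exact mul_nonneg (mul_self_nonneg _) (Real.exp_pos _).le
  rw [integral_eq_zero_iff_of_nonneg_ae hnn (integrableOn_eval_mul_exp_neg _)] at h
  by_contra hp
  have hfin : {y : ℝ | p.IsRoot y}.Finite := by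
    by_contra hinf
    exact hp (eq_zero_of_infinite_isRoot p hinf)
  have h1 : ∀ᵐ y ∂(volume.restrict (Set.Ioi (0 : ℝ))), y ∈ {y : ℝ | p.IsRoot y} := by
    filter_upwards [h] with y hy
    simpa [(Real.exp_pos (-y)).ne'] using hy
  have h2 : ∀ᵐ y ∂(volume.restrict (Set.Ioi (0 : ℝ))), y ∉ {y : ℝ | p.IsRoot y} :=
    ae_restrict_of_ae (measure_eq_zero_iff_ae_notMem.mp (hfin.measure_zero volume))
  have h3 : ∀ᵐ y ∂(volume.restrict (Set.Ioi (0 : ℝ))), False := by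
    filter_upwards [h1, h2] with y a b using b a
  rw [ae_iff] at h3
  simp at h3

/-- The monic Laguerre polynomials. -/
noncomputable def monicLaguerre (k : ℕ) : ℝ[X] :=
  ∑ b ∈ Finset.range (k + 1),
    monomial b ((-1 : ℝ) ^ (k - b) * k.choose b * (k.factorial / b.factorial))

theorem coeff_monicLaguerre (k b : ℕ) : (monicLaguerre k).coeff b =
    (-1 : ℝ) ^ (k - b) * k.choose b * (k.factorial / b.factorial) := by
  rw [monicLaguerre, finsetSum_coeff]
  simp only [coeff_monomial]
  rw [Finset.sum_ite_eq']
  split_ifs with h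
  · rfl
  · rw [Finset.mem_range, not_lt] at h
    rw [Nat.choose_eq_zero_of_lt (by omega)]; simp

theorem natDegree_monicLaguerre (k : ℕ) : (monicLaguerre k).natDegree = k := by
  refine le_antisymm ?_ (le_natDegree_of_ne_zero ?_)
  · refine natDegree_le_iff_coeff_eq_zero.mpr fun N hN => ?_
    rw [coeff_monicLaguerre, Nat.choose_eq_zero_of_lt hN]; simp
  · rw [coeff_monicLaguerre]
    simp [Nat.factorial_ne_zero]

theorem monic_monicLaguerre (k : ℕ) : (monicLaguerre k).Monic := by
  rw [Monic, leadingCoeff, natDegree_monicLaguerre, coeff_monicLaguerre]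
  simp [Nat.factorial_ne_zero]

/-- The quotient (a+b)!/b! is a monic polynomial Q of degree a in b, and the pairing is k! times the
k-th forward difference of Q at 0: zero if a < k, and k! · k! if a = k. -/
theorem expFunctional_X_pow_mul_monicLaguerre {a k : ℕ} (h : a ≤ k) :
    expFunctional (X ^ a * monicLaguerre k) = if a = k then (k.factorial : ℝ) ^ 2 else 0 := by
  set Q : ℝ[X] := (ascPochhammer ℝ a).comp (X + C 1) with hQ
  have hmon : Q.Monic := (monic_ascPochhammer ℝ a).comp_X_add_C 1
  have hdeg : Q.natDegree = a := by
    rw [hQ, natDegree_comp, ascPochhammer_natDegree, natDegree_X_add_C, mul_one]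
  have hev : ∀ b : ℕ, (b.factorial : ℝ) * Q.eval (b : ℝ) = (a + b).factorial := by
    intro b
    have := Nat.factorial_mul_ascFactorial b a
    rw [hQ, eval_comp, eval_add, eval_X, eval_C, ← Nat.cast_add_one, ← Nat.cast_ascFactorial,
      ← Nat.cast_mul, this, add_comm]
  have hsum : expFunctional (X ^ a * monicLaguerre k) = k.factorial * (fwdDiff 1)^[k] Q.eval 0 := by
    rw [fwdDiff_iter_eq_sum_shift, monicLaguerre, Finset.mul_sum, map_sum, Finset.mul_sum]
    refine Finset.sum_congr rfl fun b _ => ?_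
    rw [X_pow_mul_monomial, expFunctional_monomial, add_comm b a, ← hev]
    have : (b.factorial : ℝ) ≠ 0 := by exact_mod_cast b.factorial_ne_zero
    simp only [nsmul_eq_mul, mul_one, zero_add, zsmul_eq_mul]
    push_cast
    field_simp
  rw [hsum]
  split_ifs with h'
  · have := Q.fwdDiff_iter_degree_eq_factorial
    rw [hdeg, hmon.leadingCoeff] at this
    rw [← h', this]
    simp [sq]
  · rw [Q.fwdDiff_iter_eq_zero_of_degree_lt (by omega)]
    simp

theorem degree_sub_lt_of_monic {p q : ℝ[X]} (hp : p.Monic) (hq : q.Monic) {k : ℕ}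
    (hpk : p.natDegree = k) (hqk : q.natDegree = k) : (p - q).degree < k := by
  have h1 := degree_eq_natDegree hp.ne_zero
  have h2 := degree_eq_natDegree hq.ne_zero
  rw [hpk] at h1
  rw [hqk] at h2
  rw [← h1]
  exact degree_sub_lt_left (h1.trans h2.symm) hp.ne_zero (hp.leadingCoeff.trans hq.leadingCoeff.symm)

theorem expFunctional_mul_monicLaguerre_of_lt {p : ℝ[X]} {k : ℕ} (h : p.degree < k) :
    expFunctional (p * monicLaguerre k) = 0 := by
  rw [p.as_sum_support_C_mul_X_pow, Finset.sum_mul, map_sum]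
  refine Finset.sum_eq_zero fun a ha => ?_
  have ha : a < k := by
    by_contra hak
    exact mem_support_iff.mp ha ((degree_lt_iff_coeff_zero _ _).mp h a (not_lt.mp hak))
  rw [mul_assoc, ← smul_eq_C_mul, map_smul, expFunctional_X_pow_mul_monicLaguerre (by omega),
    if_neg (by omega), smul_zero]

theorem degree_monicLaguerre (k : ℕ) : (monicLaguerre k).degree = k := by
  rw [degree_eq_natDegree (monic_monicLaguerre k).ne_zero, natDegree_monicLaguerre]

theorem expFunctional_monicLaguerre_mul (j k : ℕ) :
    expFunctional (monicLaguerre j * monicLaguerre k) =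
      if j = k then (k.factorial : ℝ) ^ 2 else 0 := by
  split_ifs with h
  · subst h
    have h3 := expFunctional_mul_monicLaguerre_of_lt (degree_sub_lt_of_monic
      (monic_monicLaguerre j) (monic_X_pow j) (natDegree_monicLaguerre j) (natDegree_X_pow j))
    rw [sub_mul, map_sub, expFunctional_X_pow_mul_monicLaguerre le_rfl, if_pos rfl] at h3
    linarith
  · rcases lt_or_gt_of_ne h with h | h
    · exact expFunctional_mul_monicLaguerre_of_lt (by
        rw [degree_monicLaguerre]; exact_mod_cast h)
    · rw [mul_comm]
      exact expFunctional_mul_monicLaguerre_of_lt (by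
        rw [degree_monicLaguerre]; exact_mod_cast h)

/-- The left member of the biorthogonal system. -/
noncomputable def biorthLeft (j : ℕ) : ℝ[X] :=
  ∑ a ∈ Finset.range (j + 1), monomial a ((-1 : ℝ) ^ (j - a) * j.choose a *
    ((j.factorial : ℝ) ^ 2 / (a.factorial : ℝ) ^ 2))

theorem coeff_biorthLeft (j a : ℕ) : (biorthLeft j).coeff a =
    (-1 : ℝ) ^ (j - a) * j.choose a * ((j.factorial : ℝ) ^ 2 / (a.factorial : ℝ) ^ 2) := by
  rw [biorthLeft, finsetSum_coeff]
  simp only [coeff_monomial]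
  rw [Finset.sum_ite_eq']
  split_ifs with h
  · rfl
  · rw [Finset.mem_range, not_lt] at h
    rw [Nat.choose_eq_zero_of_lt (by omega)]; simp

theorem natDegree_biorthLeft (k : ℕ) : (biorthLeft k).natDegree = k := by
  refine le_antisymm ?_ (le_natDegree_of_ne_zero ?_)
  · refine natDegree_le_iff_coeff_eq_zero.mpr fun N hN => ?_
    rw [coeff_biorthLeft, Nat.choose_eq_zero_of_lt hN]; simp
  · rw [coeff_biorthLeft]
    simp [Nat.factorial_ne_zero]

theorem monic_biorthLeft (k : ℕ) : (biorthLeft k).Monic := by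
  rw [Monic, leadingCoeff, natDegree_biorthLeft, coeff_biorthLeft]
  simp [Nat.factorial_ne_zero]

/-- This is where the second power of the factorials in `biorthLeft` comes from: it is the preimage
of a multiple of the Laguerre polynomial. -/
theorem factorialMap_biorthLeft (j : ℕ) :
    factorialMap (biorthLeft j) = (j.factorial : ℝ) • monicLaguerre j := by
  ext a
  rw [coeff_factorialMap, coeff_biorthLeft, coeff_smul, coeff_monicLaguerre, smul_eq_mul]
  have : (a.factorial : ℝ) ≠ 0 := by exact_mod_cast a.factorial_ne_zero
  field_simp

theorem isBiorthogonalSystem_biorthLeft_monicLaguerre :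
    IsBiorthogonalSystem biorthLeft monicLaguerre where
  monic_left := monic_biorthLeft
  natDegree_left := natDegree_biorthLeft
  monic_right := monic_monicLaguerre
  natDegree_right := natDegree_monicLaguerre
  biorthogonal j k := by
    rw [integral_biorthWeight, factorialMap_biorthLeft, smul_mul_assoc, map_smul,
      expFunctional_monicLaguerre_mul]
    split_ifs with h
    · subst h; simp; ring
    · simp

theorem natDegree_factorialMap (p : ℝ[X]) : (factorialMap p).natDegree = p.natDegree := by
  refine natDegree_eq_natDegree ?_
  refine le_antisymm ?_ ?_ <;>
  · refine degree_le_iff_coeff_zero _ _ |>.mpr fun n hn => ?_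
    have h := coeff_eq_zero_of_degree_lt hn
    simpa [coeff_factorialMap, Nat.factorial_ne_zero] using h

/-- A polynomial is orthogonal to all polynomials of degree below `k` as soon as it is orthogonal
to one polynomial of each such degree. -/
theorem expFunctional_mul_eq_zero_of_degree_lt {r : ℕ → ℝ[X]} (hr : ∀ j, (r j).natDegree = j)
    (hr0 : ∀ j, (r j).leadingCoeff ≠ 0) {k : ℕ} {q : ℝ[X]}
    (hq : ∀ j < k, expFunctional (r j * q) = 0) :
    ∀ (n : ℕ) (f : ℝ[X]), f.degree < n → n ≤ k → expFunctional (f * q) = 0 := by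
  intro n
  induction n with
  | zero =>
    intro f hf _
    have : f = 0 := by simpa using hf
    rw [this, zero_mul, map_zero]
  | succ n ih =>
    intro f hf hn
    rw [degree_lt_iff_coeff_zero] at hf
    set c := f.coeff n / (r n).leadingCoeff with hc
    have h1 : (f - c • r n).degree < n := by
      rw [degree_lt_iff_coeff_zero]
      intro m hm
      rw [coeff_sub, coeff_smul, smul_eq_mul]
      rcases hm.eq_or_lt with rfl | hm
      · have : (r n).coeff n = (r n).leadingCoeff := by rw [leadingCoeff, hr]
        rw [this, hc, div_mul_cancel₀ _ (hr0 n), sub_self]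
      · rw [hf m (by omega), coeff_eq_zero_of_natDegree_lt (by rw [hr]; omega)]
        simp
    have h2 := ih _ h1 (by omega)
    rw [sub_mul, map_sub, smul_mul_assoc, map_smul, hq n (by omega), smul_zero, sub_zero] at h2
    exact h2

/-- The difference of the two monic polynomials has degree below k, and both are orthogonal to all
such polynomials; so it is orthogonal to itself. -/
theorem IsBiorthogonalSystem.eq_monicLaguerre {p q : ℕ → ℝ[X]} (h : IsBiorthogonalSystem p q)
    (k : ℕ) : q k = monicLaguerre k := by
  have hd := degree_sub_lt_of_monic (h.monic_right k) (monic_monicLaguerre k) (h.natDegree_right k)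
    (natDegree_monicLaguerre k)
  have hq : expFunctional ((q k - monicLaguerre k) * q k) = 0 := by
    refine expFunctional_mul_eq_zero_of_degree_lt (r := fun j => factorialMap (p j))
      (fun j => by rw [natDegree_factorialMap, h.natDegree_left]) (fun j => ?_) (fun j hj => ?_)
      k _ hd le_rfl
    · rw [leadingCoeff, natDegree_factorialMap, coeff_factorialMap, h.natDegree_left]
      have := h.monic_left j
      rw [Monic, leadingCoeff, h.natDegree_left] at this
      rw [this, mul_one]
      exact_mod_cast j.factorial_ne_zero
    · have := h.biorthogonal j k
      rwa [integral_biorthWeight, if_neg hj.ne] at this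
  have h0 : expFunctional ((q k - monicLaguerre k) * (q k - monicLaguerre k)) = 0 := by
    rw [mul_sub, map_sub, hq, expFunctional_mul_monicLaguerre_of_lt hd, sub_zero]
  exact sub_eq_zero.mp (eq_zero_of_expFunctional_mul_self h0)

/-- The same argument after `factorialMap`, which multiplies coefficients by nonzero numbers and so
loses nothing. -/
theorem IsBiorthogonalSystem.eq_biorthLeft {p q : ℕ → ℝ[X]} (h : IsBiorthogonalSystem p q)
    (j : ℕ) : p j = biorthLeft j := by
  have hd := degree_sub_lt_of_monic (h.monic_left j) (monic_biorthLeft j) (h.natDegree_left j)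
    (natDegree_biorthLeft j)
  have hd' : (factorialMap (p j - biorthLeft j)).degree < j := by
    rw [degree_lt_iff_coeff_zero] at hd ⊢
    intro m hm
    rw [coeff_factorialMap, hd m hm, mul_zero]
  have hinj : factorialMap (p j - biorthLeft j) = 0 := by
    refine eq_zero_of_expFunctional_mul_self ?_
    refine expFunctional_mul_eq_zero_of_degree_lt (r := monicLaguerre) (k := j)
      natDegree_monicLaguerre (fun k => by rw [monic_monicLaguerre]; exact one_ne_zero)
      (fun k hk => ?_) j _ hd' le_rfl
    have h1 := h.biorthogonal j k
    have h2 := isBiorthogonalSystem_biorthLeft_monicLaguerre.biorthogonal j k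
    rw [integral_biorthWeight, if_neg hk.ne', h.eq_monicLaguerre] at h1
    rw [integral_biorthWeight, if_neg hk.ne'] at h2
    rw [map_sub, mul_comm, sub_mul, map_sub, h1, h2, sub_zero]
  have h0 : p j - biorthLeft j = 0 := by
    ext n
    have := congrArg (fun f => coeff f n) hinj
    simpa only [coeff_factorialMap, coeff_zero, mul_eq_zero, Nat.cast_eq_zero,
      Nat.factorial_ne_zero, false_or] using this
  exact sub_eq_zero.mp h0

/-! ### The kernel as a sum of explicit products. -/

/-- The moments `∫ s^{b-1} e^{-x/s-s} ds`. -/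
noncomputable def besselMoment (b : ℕ) (x : ℝ) : ℝ :=
  ∫ s in Set.Ioi (0 : ℝ), s ^ b * biorthWeight x s

/-- The sums `∑ C(j,a) (-y)^a / (a!)²`. -/
noncomputable def kernelLeft (j : ℕ) (y : ℝ) : ℝ :=
  ∑ a ∈ Finset.range (j + 1), (j.choose a : ℝ) * (-y) ^ a / (a.factorial : ℝ) ^ 2

/-- The sums `∑ (-1)^b C(j,b) κ_b(x) / b!` of Bessel moments. -/
noncomputable def kernelRight (j : ℕ) (x : ℝ) : ℝ :=
  ∑ b ∈ Finset.range (j + 1), (-1 : ℝ) ^ b * j.choose b / b.factorial * besselMoment b x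

/-- Near s = 0 the factor s⁻¹ is absorbed by the exponential, since x/s ≤ e^{x/s}. -/
theorem integrableOn_pow_mul_biorthWeight (b : ℕ) {x : ℝ} (hx : 0 < x) :
    IntegrableOn (fun s => s ^ b * biorthWeight x s) (Set.Ioi 0) := by
  refine Integrable.mono' ((integrableOn_pow_mul_exp_neg_mul b one_pos).const_mul x⁻¹) ?_ ?_
  · refine (ContinuousOn.aestronglyMeasurable ?_ measurableSet_Ioi)
    unfold biorthWeight
    have : ∀ s ∈ Set.Ioi (0 : ℝ), s ≠ 0 := fun s hs => ne_of_gt hs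
    fun_prop (disch := assumption)
  · refine ae_restrict_of_forall_mem measurableSet_Ioi fun s hs => ?_
    have hs' : (0 : ℝ) < s := hs
    have h1 : s⁻¹ * Real.exp (-(x / s)) ≤ x⁻¹ := by
      have h2 : x / s ≤ Real.exp (x / s) := by linarith [Real.add_one_le_exp (x / s)]
      rw [Real.exp_neg, ← mul_inv]
      refine inv_anti₀ hx ?_
      calc x = s * (x / s) := by field_simp
        _ ≤ _ := by gcongr
    rw [Real.norm_of_nonneg (by unfold biorthWeight; positivity), biorthWeight, sub_eq_add_neg,
      Real.exp_add, one_mul]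
    calc s ^ b * (s⁻¹ * (Real.exp (-(x / s)) * Real.exp (-s)))
        = s⁻¹ * Real.exp (-(x / s)) * (s ^ b * Real.exp (-s)) := by ring
      _ ≤ _ := by gcongr

theorem neg_one_pow_sub_real {j a : ℕ} (h : a ≤ j) :
    (-1 : ℝ) ^ (j - a) = (-1) ^ j * (-1) ^ a := by
  obtain ⟨c, rfl⟩ := Nat.exists_eq_add_of_le h
  rw [Nat.add_sub_cancel_left, pow_add, mul_right_comm, ← mul_pow]; simp

theorem IsBiorthogonalSystem.correlationKernel_eq {p q : ℕ → ℝ[X]}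
    (h : IsBiorthogonalSystem p q) (N : ℕ) {x : ℝ} (hx : 0 < x) (y : ℝ) :
    correlationKernel p q N x y = ∑ j ∈ Finset.range N, kernelRight j x * kernelLeft j y := by
  refine Finset.sum_congr rfl fun j _ => ?_
  have h1 : (p j).eval y = (-1) ^ j * (j.factorial : ℝ) ^ 2 * kernelLeft j y := by
    rw [h.eq_biorthLeft, biorthLeft, eval_finsetSum, kernelLeft, Finset.mul_sum]
    refine Finset.sum_congr rfl fun a ha => ?_
    rw [Finset.mem_range] at ha
    rw [eval_monomial, neg_one_pow_sub_real (by omega), neg_pow y]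
    ring
  have h2 : (∫ s in Set.Ioi (0 : ℝ), biorthWeight x s * (q j).eval s) =
      (-1) ^ j * j.factorial * kernelRight j x := by
    rw [h.eq_monicLaguerre, kernelRight, Finset.mul_sum]
    simp only [monicLaguerre, eval_finsetSum, eval_monomial, Finset.mul_sum]
    have e : ∀ (s : ℝ) (b : ℕ), biorthWeight x s * ((-1 : ℝ) ^ (j - b) * j.choose b *
        (j.factorial / b.factorial) * s ^ b) = ((-1 : ℝ) ^ (j - b) * j.choose b *
        (j.factorial / b.factorial)) * (s ^ b * biorthWeight x s) := fun s b => by ring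
    simp only [e]
    rw [integral_finsetSum _ fun b _ => (integrableOn_pow_mul_biorthWeight b hx).const_mul _]
    refine Finset.sum_congr rfl fun b hb => ?_
    rw [Finset.mem_range] at hb
    rw [integral_const_mul, neg_one_pow_sub_real (by omega), besselMoment]
    ring
  rw [h1, h2]
  have hj : (j.factorial : ℝ) ≠ 0 := by exact_mod_cast j.factorial_ne_zero
  have hs : ((-1 : ℝ) ^ j) * (-1) ^ j = 1 := by rw [← mul_pow]; simp
  field_simp
  linear_combination (kernelRight j x * kernelLeft j y) * hs

/-! ### Averages over a half circle and the Bessel series I₀(2ζ). -/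

theorem hasSum_iff_of_forall_eq {f g : ℕ → ℂ} {a : ℂ} (h : ∀ k, f k = g k) :
    HasSum f a ↔ HasSum g a := by rw [funext h]

/-- The average of a function over the angles between `-π/2` and `π/2`. -/
noncomputable def halfAvg (g : ℝ → ℂ) : ℂ :=
  (Real.pi : ℂ)⁻¹ * ∫ θ in (-(Real.pi / 2))..(Real.pi / 2), g θ

/-- The point of modulus `ρ` and argument `θ`. -/
noncomputable def polarPoint (ρ θ : ℝ) : ℂ := ρ * Complex.exp (θ * Complex.I)

theorem norm_polarPoint {ρ : ℝ} (hρ : 0 ≤ ρ) (θ : ℝ) : ‖polarPoint ρ θ‖ = ρ := by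
  rw [polarPoint, norm_mul, Complex.norm_exp_ofReal_mul_I, mul_one, Complex.norm_real,
    Real.norm_of_nonneg hρ]

theorem polarPoint_re (ρ θ : ℝ) : (polarPoint ρ θ).re = ρ * Real.cos θ := by
  rw [polarPoint, Complex.re_ofReal_mul, Complex.exp_ofReal_mul_I_re]

theorem polarPoint_im (ρ θ : ℝ) : (polarPoint ρ θ).im = ρ * Real.sin θ := by
  rw [polarPoint, Complex.im_ofReal_mul, Complex.exp_ofReal_mul_I_im]

theorem polarPoint_ne_zero {ρ : ℝ} (hρ : 0 < ρ) (θ : ℝ) : polarPoint ρ θ ≠ 0 := by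
  rw [← norm_pos_iff, norm_polarPoint hρ.le]; exact hρ

theorem continuous_polarPoint (ρ : ℝ) : Continuous (polarPoint ρ) := by
  unfold polarPoint; fun_prop

theorem hasSum_halfAvg {F : ℕ → ℝ → ℂ} {b : ℕ → ℝ} {f : ℝ → ℂ} (hc : ∀ k, Continuous (F k))
    (hb : ∀ k θ, ‖F k θ‖ ≤ b k) (hs : Summable b) (hf : ∀ θ, HasSum (fun k => F k θ) (f θ)) :
    HasSum (fun k => halfAvg (F k)) (halfAvg f) := by
  refine HasSum.mul_left _ ?_
  refine intervalIntegral.hasSum_integral_of_dominated_convergence (fun k _ => b k)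
    (fun k => (hc k).aestronglyMeasurable) (fun k => Eventually.of_forall fun θ _ => hb k θ)
    (Eventually.of_forall fun _ _ => hs) intervalIntegrable_const
    (Eventually.of_forall fun θ _ => hf θ)

/-- Even powers have period π in the angle, so half a circle suffices to extract coefficients. The
half chosen lies in the right half-plane, where the Bessel series has a sharp bound. -/
theorem halfAvg_polarPoint_zpow {ρ : ℝ} (n : ℤ) :
    halfAvg (fun θ => polarPoint ρ θ ^ (2 * n)) = if n = 0 then 1 else 0 := by
  have hpi : (Real.pi : ℂ) ≠ 0 := by exact_mod_cast Real.pi_ne_zero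
  rw [halfAvg]
  split_ifs with h
  · subst h
    simp [hpi]
  · have e : ∀ θ : ℝ, polarPoint ρ θ ^ (2 * n) =
        (ρ : ℂ) ^ (2 * n) * Complex.exp ((2 * n * Complex.I : ℂ) * θ) := by
      intro θ
      rw [polarPoint, mul_zpow, ← Complex.exp_int_mul]
      congr 2
      push_cast; ring
    simp only [e]
    have hc : (2 * n * Complex.I : ℂ) ≠ 0 := by simp [h]
    rw [intervalIntegral.integral_const_mul, integral_exp_mul_complex hc]
    have e1 : Complex.exp ((2 * n * Complex.I : ℂ) * ((Real.pi / 2 : ℝ) : ℂ)) =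
        Complex.exp ((2 * n * Complex.I : ℂ) * ((-(Real.pi / 2) : ℝ) : ℂ)) := by
      rw [Complex.exp_eq_exp_iff_exists_int]
      exact ⟨n, by push_cast; ring⟩
    rw [e1, sub_self]; simp

theorem continuous_polarPoint_zpow {ρ : ℝ} (hρ : 0 < ρ) (n : ℤ) :
    Continuous fun θ => polarPoint ρ θ ^ n :=
  (continuous_polarPoint ρ).zpow₀ n fun θ => Or.inl (polarPoint_ne_zero hρ θ)

theorem halfAvg_series_mul_zpow {ρ : ℝ} (hρ : 0 < ρ) {c : ℕ → ℂ}
    (hc : Summable fun k => ‖c k‖ * ρ ^ (2 * k)) {f : ℝ → ℂ}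
    (hf : ∀ θ, HasSum (fun k => c k * polarPoint ρ θ ^ (2 * k)) (f θ)) (n : ℤ) :
    halfAvg (fun θ => f θ * polarPoint ρ θ ^ (-(2 * n))) = if 0 ≤ n then c n.toNat else 0 := by
  have h1 := hasSum_halfAvg (F := fun k θ => c k * polarPoint ρ θ ^ (2 * ((k : ℤ) - n)))
    (b := fun k => ‖c k‖ * ρ ^ (2 * k) * ρ ^ (-(2 * n)))
    (f := fun θ => f θ * polarPoint ρ θ ^ (-(2 * n)))
    (fun k => continuous_const.mul (continuous_polarPoint_zpow hρ _)) ?_ (hc.mul_right _) ?_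
  · have h2 : ∀ k : ℕ, halfAvg (fun θ => c k * polarPoint ρ θ ^ (2 * ((k : ℤ) - n))) =
        if (k : ℤ) = n then c k else 0 := by
      intro k
      have := halfAvg_polarPoint_zpow (ρ := ρ) ((k : ℤ) - n)
      rw [halfAvg] at this ⊢
      rw [intervalIntegral.integral_const_mul, mul_left_comm, this]
      simp [sub_eq_zero]
    simp only [h2] at h1
    refine h1.unique ?_
    split_ifs with hn
    · obtain ⟨m, rfl⟩ := Int.eq_ofNat_of_zero_le hn
      simp only [Nat.cast_inj, Int.toNat_natCast]
      refine (hasSum_iff_of_forall_eq fun k => ?_).mpr (hasSum_ite_eq m (c m))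
      split_ifs with h <;> simp [h]
    · refine (hasSum_iff_of_forall_eq fun k => ?_).mpr hasSum_zero
      rw [if_neg (by omega)]
  · intro k θ
    rw [norm_mul, norm_zpow, norm_polarPoint hρ.le, mul_assoc, mul_sub, sub_eq_add_neg,
      zpow_add₀ hρ.ne']
    norm_cast
  · intro θ
    refine (hasSum_iff_of_forall_eq fun k => ?_).mpr ((hf θ).mul_right _)
    rw [mul_assoc, mul_sub, sub_eq_add_neg, zpow_add₀ (polarPoint_ne_zero hρ θ)]
    norm_cast

theorem halfAvg_const_mul (c : ℂ) (g : ℝ → ℂ) : halfAvg (fun θ => c * g θ) = c * halfAvg g := by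
  rw [halfAvg, halfAvg, intervalIntegral.integral_const_mul, mul_left_comm]

theorem halfAvg_sum {ι : Type*} (s : Finset ι) {g : ι → ℝ → ℂ} (hg : ∀ i ∈ s, Continuous (g i)) :
    halfAvg (fun θ => ∑ i ∈ s, g i θ) = ∑ i ∈ s, halfAvg (g i) := by
  simp only [halfAvg]
  rw [intervalIntegral.integral_finsetSum fun i hi => (hg i hi).intervalIntegrable _ _,
    Finset.mul_sum]

/-- The entire function `∑ ζ^{2k} / (k!)²`. -/
noncomputable def besselSeries (ζ : ℂ) : ℂ := ∑' k : ℕ, ζ ^ (2 * k) / (k.factorial : ℂ) ^ 2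

theorem summable_pow_div_factorial_sq (r : ℝ) :
    Summable fun k : ℕ => r ^ k / (k.factorial : ℝ) ^ 2 := by
  refine Summable.of_norm_bounded (Real.summable_pow_div_factorial |r|) fun k => ?_
  rw [norm_div, norm_pow, norm_pow, Real.norm_eq_abs, Real.norm_natCast]
  have : (1 : ℝ) ≤ k.factorial := by exact_mod_cast k.factorial_pos
  gcongr
  nlinarith

theorem hasSum_besselSeries (ζ : ℂ) :
    HasSum (fun k : ℕ => ζ ^ (2 * k) / (k.factorial : ℂ) ^ 2) (besselSeries ζ) := by
  refine Summable.hasSum (Summable.of_norm ?_)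
  refine (summable_pow_div_factorial_sq (‖ζ‖ ^ 2)).congr fun k => ?_
  simp [pow_mul]

theorem hasSum_besselSeries_mul (N : ℝ) (z : ℂ) :
    HasSum (fun k : ℕ => ((N : ℂ) ^ (2 * k) / (k.factorial : ℂ) ^ 2) * z ^ (2 * k))
      (besselSeries (N * z)) := by
  refine (hasSum_iff_of_forall_eq fun k => ?_).mpr (hasSum_besselSeries (N * z))
  rw [mul_pow]; ring

theorem summable_besselSeries_coeff (N ρ : ℝ) :
    Summable fun k : ℕ => ‖(N : ℂ) ^ (2 * k) / (k.factorial : ℂ) ^ 2‖ * ρ ^ (2 * k) := by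
  refine (summable_pow_div_factorial_sq ((|N| * ρ) ^ 2)).congr fun k => ?_
  rw [norm_div, norm_pow, norm_pow, Complex.norm_real, Complex.norm_natCast, Real.norm_eq_abs,
    ← pow_mul, mul_pow]
  ring

theorem halfAvg_besselSeries_mul_zpow {ρ : ℝ} (hρ : 0 < ρ) (N : ℝ) (n : ℤ) :
    halfAvg (fun θ => besselSeries (N * polarPoint ρ θ) * polarPoint ρ θ ^ (-(2 * n))) =
      if 0 ≤ n then (N : ℂ) ^ (2 * n.toNat) / (n.toNat.factorial : ℂ) ^ 2 else 0 :=
  halfAvg_series_mul_zpow hρ (summable_besselSeries_coeff N ρ)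
    (fun _ => hasSum_besselSeries_mul N _) n

theorem norm_besselSeries_le (ζ : ℂ) : ‖besselSeries ζ‖ ≤ Real.exp (‖ζ‖ ^ 2) := by
  have h : HasSum (fun k : ℕ => (‖ζ‖ ^ 2) ^ k / k.factorial) (Real.exp (‖ζ‖ ^ 2)) := by
    rw [Real.exp_eq_exp_ℝ]; exact NormedSpace.expSeries_div_hasSum_exp _
  refine tsum_of_norm_bounded h fun k => ?_
  have : (1 : ℝ) ≤ k.factorial := by exact_mod_cast k.factorial_pos
  rw [norm_div, norm_pow, norm_pow, Complex.norm_natCast, pow_mul]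
  gcongr
  nlinarith

theorem continuous_besselSeries : Continuous besselSeries := by
  rw [continuous_iff_continuousAt]
  intro ζ
  have h : ContinuousOn besselSeries (Metric.ball 0 (‖ζ‖ + 1)) := by
    refine continuousOn_tsum (u := fun k : ℕ => ((‖ζ‖ + 1) ^ 2) ^ k / (k.factorial : ℝ) ^ 2)
      (fun k => by fun_prop) (summable_pow_div_factorial_sq _) fun k z hz => ?_
    rw [mem_ball_zero_iff] at hz
    rw [norm_div, norm_pow, norm_pow, Complex.norm_natCast, ← pow_mul]
    gcongr
  exact h.continuousAt (Metric.isOpen_ball.mem_nhds (by simp))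

theorem continuous_besselSeries_polarPoint (N ρ : ℝ) :
    Continuous fun θ => besselSeries (N * polarPoint ρ θ) :=
  continuous_besselSeries.comp (continuous_const.mul (continuous_polarPoint ρ))

/-- The power z^{-2a} in the binomial expansion picks out the Bessel coefficient N^{2a}/(a!)². -/
theorem halfAvg_besselSeries_eq_kernelLeft {ρ : ℝ} (hρ : 0 < ρ) (N y : ℝ) (j : ℕ) :
    halfAvg (fun θ => besselSeries (N * polarPoint ρ θ) * (1 - y / polarPoint ρ θ ^ 2) ^ j) =
      (kernelLeft j (N ^ 2 * y) : ℂ) := by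
  have e : ∀ θ, besselSeries (N * polarPoint ρ θ) * (1 - y / polarPoint ρ θ ^ 2) ^ j =
      ∑ a ∈ Finset.range (j + 1), ((j.choose a : ℂ) * (-y) ^ a) *
        (besselSeries (N * polarPoint ρ θ) * polarPoint ρ θ ^ (-(2 * (a : ℤ)))) := by
    intro θ
    rw [sub_eq_neg_add, add_pow, Finset.mul_sum]
    refine Finset.sum_congr rfl fun a _ => ?_
    rw [one_pow, zpow_neg, show (2 * (a : ℤ)) = ((2 * a : ℕ) : ℤ) by push_cast; ring, zpow_natCast,
      pow_mul, ← neg_div, div_pow]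
    ring
  simp only [e]
  have hc : ∀ a ∈ Finset.range (j + 1), Continuous fun θ => ((j.choose a : ℂ) * (-y) ^ a) *
      (besselSeries (N * polarPoint ρ θ) * polarPoint ρ θ ^ (-(2 * (a : ℤ)))) := fun a _ =>
    continuous_const.mul
      ((continuous_besselSeries_polarPoint N ρ).mul (continuous_polarPoint_zpow hρ _))
  rw [halfAvg_sum _ hc, kernelLeft]
  push_cast
  refine Finset.sum_congr rfl fun a _ => ?_
  rw [halfAvg_const_mul, halfAvg_besselSeries_mul_zpow hρ, if_pos (Int.natCast_nonneg a)]
  simp only [Int.toNat_natCast]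
  rw [neg_mul_eq_mul_neg, mul_pow, ← pow_mul]
  ring

/-- Cauchy's formula for the Bessel series on a circle. -/
theorem halfAvg_besselSeries_cauchy {ρ : ℝ} (hρ : 0 < ρ) (N : ℝ) {ζ : ℂ} (hζ0 : ζ ≠ 0)
    (hζ : ‖ζ‖ ≠ ρ) :
    halfAvg (fun θ => besselSeries (N * polarPoint ρ θ) *
      (polarPoint ρ θ ^ 2 / (polarPoint ρ θ ^ 2 - ζ ^ 2))) =
      if ‖ζ‖ < ρ then besselSeries (N * ζ) else 0 := by
  set B := Real.exp ((|N| * ρ) ^ 2) with hB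
  have hBb : ∀ θ, ‖besselSeries (N * polarPoint ρ θ)‖ ≤ B := by
    intro θ
    refine (norm_besselSeries_le _).trans_eq ?_
    rw [norm_mul, norm_polarPoint hρ.le, Complex.norm_real, Real.norm_eq_abs]
  have hζp : 0 < ‖ζ‖ := norm_pos_iff.mpr hζ0
  split_ifs with h
  · have hq : (‖ζ‖ / ρ) ^ 2 < 1 := by
      rw [sq_lt_one_iff₀ (by positivity), div_lt_one hρ]; exact h
    -- Inside the circle the quotient is a geometric series in ζ²/z², and the averages rebuild the
    -- Bessel series at ζ.
    have h1 := hasSum_halfAvg (F := fun a θ => ζ ^ (2 * a) *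
        (besselSeries (N * polarPoint ρ θ) * polarPoint ρ θ ^ (-(2 * (a : ℤ)))))
      (b := fun a => B * ((‖ζ‖ / ρ) ^ 2) ^ a)
      (f := fun θ => besselSeries (N * polarPoint ρ θ) *
        (polarPoint ρ θ ^ 2 / (polarPoint ρ θ ^ 2 - ζ ^ 2)))
      (fun a => continuous_const.mul
        ((continuous_besselSeries_polarPoint N ρ).mul (continuous_polarPoint_zpow hρ _))) ?_
      ((summable_geometric_of_lt_one (by positivity) hq).mul_left _) ?_
    · simp only [halfAvg_const_mul, halfAvg_besselSeries_mul_zpow hρ, Int.natCast_nonneg, if_true,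
        Int.toNat_natCast] at h1
      refine h1.unique ((hasSum_iff_of_forall_eq fun a => ?_).mpr (hasSum_besselSeries_mul N ζ))
      ring
    · intro a θ
      rw [norm_mul, norm_mul, norm_zpow, norm_polarPoint hρ.le, norm_pow, zpow_neg,
        show (2 * (a : ℤ)) = ((2 * a : ℕ) : ℤ) by push_cast; ring, zpow_natCast, div_pow, div_pow,
        ← pow_mul, ← pow_mul]
      calc ‖ζ‖ ^ (2 * a) * (‖besselSeries (N * polarPoint ρ θ)‖ * (ρ ^ (2 * a))⁻¹)
          ≤ ‖ζ‖ ^ (2 * a) * (B * (ρ ^ (2 * a))⁻¹) := by gcongr; exact hBb θ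
        _ = _ := by ring
    · intro θ
      have hz := polarPoint_ne_zero hρ θ
      have hn : ‖ζ ^ 2 / polarPoint ρ θ ^ 2‖ < 1 := by
        rw [norm_div, norm_pow, norm_pow, norm_polarPoint hρ.le, ← div_pow]; exact hq
      have hne : polarPoint ρ θ ^ 2 - ζ ^ 2 ≠ 0 := by
        intro h0
        rw [← sub_eq_zero.mp h0, div_self (pow_ne_zero 2 hz)] at hn
        simp at hn
      have h2 := (hasSum_geometric_of_norm_lt_one hn).mul_left (besselSeries (N * polarPoint ρ θ))
      have e : (1 - ζ ^ 2 / polarPoint ρ θ ^ 2)⁻¹ =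
          polarPoint ρ θ ^ 2 / (polarPoint ρ θ ^ 2 - ζ ^ 2) := by
        rw [← inv_div (polarPoint ρ θ ^ 2 - ζ ^ 2), sub_div, div_self (pow_ne_zero 2 hz)]
      rw [e] at h2
      refine (hasSum_iff_of_forall_eq fun a => ?_).mpr h2
      rw [zpow_neg, show (2 * (a : ℤ)) = ((2 * a : ℕ) : ℤ) by push_cast; ring, zpow_natCast,
        div_pow, pow_mul, pow_mul]
      ring
  · have h' : ρ < ‖ζ‖ := lt_of_le_of_ne (not_lt.mp h) (Ne.symm hζ)
    have hq : (ρ / ‖ζ‖) ^ 2 < 1 := by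
      rw [sq_lt_one_iff₀ (by positivity), div_lt_one hζp]; exact h'
    -- Outside, the geometric series in z²/ζ² has positive powers of z² only, and every average
    -- vanishes.
    have h1 := hasSum_halfAvg (F := fun a θ => (-(ζ ^ (2 * (a + 1)))⁻¹) *
        (besselSeries (N * polarPoint ρ θ) * polarPoint ρ θ ^ (-(2 * (-((a : ℤ) + 1))))))
      (b := fun a => (B * (ρ / ‖ζ‖) ^ 2) * ((ρ / ‖ζ‖) ^ 2) ^ a)
      (f := fun θ => besselSeries (N * polarPoint ρ θ) *
        (polarPoint ρ θ ^ 2 / (polarPoint ρ θ ^ 2 - ζ ^ 2)))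
      (fun a => continuous_const.mul
        ((continuous_besselSeries_polarPoint N ρ).mul (continuous_polarPoint_zpow hρ _))) ?_
      ((summable_geometric_of_lt_one (by positivity) hq).mul_left _) ?_
    · have hneg : ∀ a : ℕ, ¬ (0 ≤ -((a : ℤ) + 1)) := fun a => by omega
      simp only [halfAvg_const_mul, halfAvg_besselSeries_mul_zpow hρ, hneg, if_false,
        mul_zero] at h1
      exact h1.unique hasSum_zero
    · intro a θ
      rw [norm_mul, norm_mul, norm_zpow, norm_polarPoint hρ.le, norm_neg, norm_inv, norm_pow,
        show (-(2 * (-((a : ℤ) + 1)))) = ((2 * (a + 1) : ℕ) : ℤ) by push_cast; ring, zpow_natCast,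
        mul_assoc, ← pow_succ', ← pow_mul, div_pow]
      calc (‖ζ‖ ^ (2 * (a + 1)))⁻¹ * (‖besselSeries (N * polarPoint ρ θ)‖ * ρ ^ (2 * (a + 1)))
          ≤ (‖ζ‖ ^ (2 * (a + 1)))⁻¹ * (B * ρ ^ (2 * (a + 1))) := by gcongr; exact hBb θ
        _ = _ := by ring
    · intro θ
      have hz := polarPoint_ne_zero hρ θ
      have hn : ‖polarPoint ρ θ ^ 2 / ζ ^ 2‖ < 1 := by
        rw [norm_div, norm_pow, norm_pow, norm_polarPoint hρ.le, ← div_pow]; exact hq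
      have hne : polarPoint ρ θ ^ 2 - ζ ^ 2 ≠ 0 := by
        intro h0
        rw [sub_eq_zero.mp h0, div_self (pow_ne_zero 2 hζ0)] at hn
        simp at hn
      have h2 := (hasSum_geometric_of_norm_lt_one hn).mul_left
        (besselSeries (N * polarPoint ρ θ) * (-(polarPoint ρ θ ^ 2 / ζ ^ 2)))
      have e : besselSeries (N * polarPoint ρ θ) * (-(polarPoint ρ θ ^ 2 / ζ ^ 2)) *
          (1 - polarPoint ρ θ ^ 2 / ζ ^ 2)⁻¹ = besselSeries (N * polarPoint ρ θ) *
          (polarPoint ρ θ ^ 2 / (polarPoint ρ θ ^ 2 - ζ ^ 2)) := by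
        have h3 : 1 - polarPoint ρ θ ^ 2 / ζ ^ 2 = (ζ ^ 2 - polarPoint ρ θ ^ 2) / ζ ^ 2 := by
          field_simp
        rw [h3, inv_div, mul_assoc, ← neg_sub (polarPoint ρ θ ^ 2)]
        congr 1
        have h4 : -(polarPoint ρ θ ^ 2 - ζ ^ 2) ≠ 0 := neg_ne_zero.mpr hne
        field_simp
      rw [e] at h2
      refine (hasSum_iff_of_forall_eq fun a => ?_).mpr h2
      rw [show (-(2 * (-((a : ℤ) + 1)))) = ((2 * (a + 1) : ℕ) : ℤ) by push_cast; ring,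
        zpow_natCast, div_pow, pow_mul, pow_mul, pow_succ, pow_succ]
      field_simp
      ring

/-- The integral representation of the Bessel series. -/
theorem besselSeries_eq_halfAvg (ζ : ℂ) : besselSeries ζ =
    Complex.exp (2 * ζ) * halfAvg (fun θ => Complex.exp (-(4 * ζ * Real.sin θ ^ 2))) := by
  have hexp : ∀ z : ℂ, HasSum (fun k : ℕ => z ^ k / k.factorial) (Complex.exp z) := by
    intro z; rw [Complex.exp_eq_exp_ℂ]; exact NormedSpace.expSeries_div_hasSum_exp _
  have h0 : ∀ a : ℕ, halfAvg (fun θ => Complex.exp (ζ * polarPoint 1 θ ^ 2) *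
      polarPoint 1 θ ^ (-(2 * (a : ℤ)))) = ζ ^ a / a.factorial := by
    intro a
    rw [halfAvg_series_mul_zpow one_pos (c := fun k => ζ ^ k / k.factorial), if_pos (by omega),
      Int.toNat_natCast]
    · refine (Real.summable_pow_div_factorial ‖ζ‖).congr fun k => ?_
      simp
    · intro θ
      refine (hasSum_iff_of_forall_eq fun k => ?_).mpr (hexp (ζ * polarPoint 1 θ ^ 2))
      rw [mul_pow, ← pow_mul]; ring
  have hc : Continuous fun θ => Complex.exp (ζ * polarPoint 1 θ ^ 2) := by
    have := continuous_polarPoint 1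
    fun_prop
  -- The coefficients of e^{ζz²} and e^{ζ/z²} pair up to ζ^{2a}/(a!)².
  have h1 := hasSum_halfAvg (F := fun a θ => (ζ ^ a / a.factorial) *
      (Complex.exp (ζ * polarPoint 1 θ ^ 2) * polarPoint 1 θ ^ (-(2 * (a : ℤ)))))
    (b := fun a => Real.exp ‖ζ‖ * (‖ζ‖ ^ a / a.factorial))
    (f := fun θ => Complex.exp (ζ * polarPoint 1 θ ^ 2) *
      Complex.exp (ζ * (polarPoint 1 θ ^ 2)⁻¹))
    (fun a => continuous_const.mul (hc.mul (continuous_polarPoint_zpow one_pos _))) ?_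
    ((Real.summable_pow_div_factorial ‖ζ‖).mul_left _) ?_
  · simp only [halfAvg_const_mul, h0] at h1
    have h2 : besselSeries ζ = halfAvg (fun θ => Complex.exp (ζ * polarPoint 1 θ ^ 2) *
        Complex.exp (ζ * (polarPoint 1 θ ^ 2)⁻¹)) := by
      refine HasSum.unique ?_ h1
      refine (hasSum_iff_of_forall_eq fun k => ?_).mpr (hasSum_besselSeries ζ)
      rw [pow_mul', sq]
      ring
    rw [h2, ← halfAvg_const_mul]
    congr 1
    ext θ
    rw [← Complex.exp_add, ← Complex.exp_add]
    congr 1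
    -- The exponent is 2ζ cos 2θ, and cos 2θ = 1 - 2 sin² θ releases the factor e^{2ζ}.
    have e1 : polarPoint 1 θ ^ 2 + (polarPoint 1 θ ^ 2)⁻¹ = 2 * Complex.cos (2 * θ) := by
      rw [Complex.two_cos, polarPoint, Complex.ofReal_one, one_mul, ← Complex.exp_nat_mul,
        ← Complex.exp_neg]
      congr 2 <;> push_cast <;> ring
    rw [← mul_add, e1, Complex.cos_two_mul, ← Complex.ofReal_cos, Complex.ofReal_cos]
    have e2 := Complex.sin_sq_add_cos_sq (θ : ℂ)
    push_cast
    linear_combination (4 * ζ) * e2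
  · intro a θ
    rw [norm_mul, norm_mul, norm_zpow, norm_polarPoint zero_le_one, one_zpow, mul_one, norm_div,
      norm_pow, Complex.norm_natCast, mul_comm]
    gcongr
    refine (Complex.norm_exp_le_exp_norm _).trans_eq ?_
    rw [norm_mul, norm_pow, norm_polarPoint zero_le_one]; simp
  · intro θ
    refine (hasSum_iff_of_forall_eq fun a => ?_).mpr ((hexp (ζ * (polarPoint 1 θ ^ 2)⁻¹)).mul_left _)
    rw [zpow_neg, show (2 * (a : ℤ)) = ((2 * a : ℕ) : ℤ) by push_cast; ring, zpow_natCast,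
      mul_pow, pow_mul, inv_pow]
    ring

/-! ### The Macdonald function, and both Bessel functions for large argument. -/

/-- The function `2 K₀(2ζ) = ∫ exp (-2 ζ cosh t) dt`, after the substitution `r = sinh (t / 2)`. -/
noncomputable def macdonald (ζ : ℂ) : ℂ :=
  Complex.exp (-(2 * ζ)) * ∫ r : ℝ, Complex.exp (-(4 * ζ) * (r : ℂ) ^ 2) *
    ((2 / Real.sqrt (1 + r ^ 2) : ℝ) : ℂ)

theorem two_div_sqrt_le (r : ℝ) : ‖((2 / Real.sqrt (1 + r ^ 2) : ℝ) : ℂ)‖ ≤ 2 := by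
  rw [Complex.norm_real, Real.norm_of_nonneg (by positivity)]
  refine div_le_self zero_le_two ?_
  rw [Real.one_le_sqrt]
  nlinarith [sq_nonneg r]

theorem continuous_two_div_sqrt : Continuous fun r : ℝ => ((2 / Real.sqrt (1 + r ^ 2) : ℝ) : ℂ) := by
  refine Complex.continuous_ofReal.comp (continuous_const.div (by fun_prop) fun r => ?_)
  positivity

theorem four_mul_re (ζ : ℂ) : (4 * ζ).re = 4 * ζ.re := by simp

theorem norm_gaussian_mul_le {ζ : ℂ} (r : ℝ) :
    ‖Complex.exp (-(4 * ζ) * (r : ℂ) ^ 2) * ((2 / Real.sqrt (1 + r ^ 2) : ℝ) : ℂ)‖ ≤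
      2 * Real.exp (-(4 * ζ.re) * r ^ 2) := by
  rw [norm_mul, norm_cexp_neg_mul_sq, four_mul_re, mul_comm]
  gcongr
  exact two_div_sqrt_le r

theorem integrable_gaussian_mul {ζ : ℂ} (hζ : 0 < ζ.re) : Integrable fun r : ℝ =>
    Complex.exp (-(4 * ζ) * (r : ℂ) ^ 2) * ((2 / Real.sqrt (1 + r ^ 2) : ℝ) : ℂ) := by
  refine Integrable.mono' ((integrable_exp_neg_mul_sq (b := 4 * ζ.re) (by positivity)).const_mul 2)
    ?_ (Eventually.of_forall norm_gaussian_mul_le)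
  exact ((by fun_prop : Continuous fun r : ℝ => Complex.exp (-(4 * ζ) * (r : ℂ) ^ 2)).mul
    continuous_two_div_sqrt).aestronglyMeasurable

/-- Differentiation under the integral sign; restricting to real parts above half that of ζ provides
a uniform Gaussian majorant. -/
theorem differentiableOn_macdonald : DifferentiableOn ℂ macdonald {ζ | 0 < ζ.re} := by
  intro ζ hζ
  have hζ' : 0 < ζ.re := hζ
  refine DifferentiableAt.differentiableWithinAt ?_
  refine DifferentiableAt.mul (by fun_prop) ?_
  have hb : Integrable fun r : ℝ => 8 * (r ^ (2 : ℝ) * Real.exp (-(2 * ζ.re) * r ^ 2)) :=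
    (integrable_rpow_mul_exp_neg_mul_sq (by positivity) (by norm_num)).const_mul 8
  have hs : {w : ℂ | ζ.re / 2 < w.re} ∈ 𝓝 ζ :=
    (isOpen_lt continuous_const Complex.continuous_re).mem_nhds (by simp [hζ'])
  refine (hasDerivAt_integral_of_dominated_loc_of_deriv_le (𝕜 := ℂ) (F := fun (ζ : ℂ) (r : ℝ) =>
    Complex.exp (-(4 * ζ) * (r : ℂ) ^ 2) * ((2 / Real.sqrt (1 + r ^ 2) : ℝ) : ℂ))
    (F' := fun (ζ : ℂ) (r : ℝ) => (-4 * (r : ℂ) ^ 2) * (Complex.exp (-(4 * ζ) * (r : ℂ) ^ 2) *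
      ((2 / Real.sqrt (1 + r ^ 2) : ℝ) : ℂ))) (bound := fun r : ℝ =>
      8 * (r ^ (2 : ℝ) * Real.exp (-(2 * ζ.re) * r ^ 2))) hs ?_ (integrable_gaussian_mul hζ') ?_ ?_
      hb ?_).2.differentiableAt
  · exact Eventually.of_forall fun w =>
      ((by fun_prop : Continuous fun r : ℝ => Complex.exp (-(4 * w) * (r : ℂ) ^ 2)).mul
        continuous_two_div_sqrt).aestronglyMeasurable
  · refine Continuous.aestronglyMeasurable (Continuous.mul (by fun_prop) ?_)
    exact (by fun_prop : Continuous fun r : ℝ => Complex.exp (-(4 * ζ) * (r : ℂ) ^ 2)).mul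
        continuous_two_div_sqrt
  · refine Eventually.of_forall fun r w hw => ?_
    have hw' : ζ.re / 2 < w.re := hw
    rw [norm_mul]
    have h1 : ‖(-4 * (r : ℂ) ^ 2)‖ = 4 * r ^ 2 := by simp
    rw [h1, Real.rpow_two]
    calc 4 * r ^ 2 * _ ≤ 4 * r ^ 2 * (2 * Real.exp (-(4 * w.re) * r ^ 2)) := by
          gcongr; exact norm_gaussian_mul_le r
      _ ≤ 4 * r ^ 2 * (2 * Real.exp (-(2 * ζ.re) * r ^ 2)) := by
          refine mul_le_mul_of_nonneg_left (mul_le_mul_of_nonneg_left (Real.exp_le_exp.mpr ?_)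
            zero_le_two) (by positivity)
          nlinarith [sq_nonneg r]
      _ = _ := by ring
  · refine Eventually.of_forall fun r w _ => ?_
    have h1 : HasDerivAt (fun w : ℂ => -(4 * w) * (r : ℂ) ^ 2) (-4 * (r : ℂ) ^ 2) w := by
      have := ((hasDerivAt_id w).const_mul 4).neg.mul_const ((r : ℂ) ^ 2)
      simpa using this
    have := h1.cexp.mul_const ((2 / Real.sqrt (1 + r ^ 2) : ℝ) : ℂ)
    exact this.congr_deriv (by ring)

theorem norm_macdonald_le {ζ : ℂ} (hζ : 0 < ζ.re) : ‖macdonald ζ‖ ≤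
    2 * Real.sqrt (Real.pi / 4) * (Real.exp (-(2 * ζ.re)) / Real.sqrt ζ.re) := by
  rw [macdonald, norm_mul, Complex.norm_exp]
  have h1 : (-(2 * ζ)).re = -(2 * ζ.re) := by simp
  have h2 := norm_integral_le_of_norm_le
    ((integrable_exp_neg_mul_sq (b := 4 * ζ.re) (by positivity)).const_mul 2)
    (Eventually.of_forall (norm_gaussian_mul_le (ζ := ζ)))
  rw [integral_const_mul, integral_gaussian, ← div_div, Real.sqrt_div (by positivity)] at h2
  rw [h1]
  calc _ ≤ Real.exp (-(2 * ζ.re)) * (2 * (Real.sqrt (Real.pi / 4) / Real.sqrt ζ.re)) := by gcongr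
    _ = _ := by ring

/-- Laplace's method: the scaling r ↦ r/√N fixes the Gaussian, and the algebraic factor tends to 2.
-/
theorem tendsto_macdonald {ζ : ℂ} (hζ : 0 < ζ.re) :
    Tendsto (fun N : ℕ => (Real.sqrt N : ℂ) * Complex.exp (2 * (N * ζ)) * macdonald (N * ζ)) atTop
      (𝓝 (2 * ∫ r : ℝ, Complex.exp (-(4 * ζ) * (r : ℂ) ^ 2))) := by
  have e : ∀ N : ℕ, N ≠ 0 → (∫ r : ℝ, Complex.exp (-(4 * ζ) * (r : ℂ) ^ 2) *
      ((2 / Real.sqrt (1 + (r / Real.sqrt N) ^ 2) : ℝ) : ℂ)) =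
      (Real.sqrt N : ℂ) * Complex.exp (2 * (N * ζ)) * macdonald (N * ζ) := by
    intro N hN
    have hs : 0 < Real.sqrt N := Real.sqrt_pos.mpr (by positivity)
    have h1 := Measure.integral_comp_div (fun r : ℝ => Complex.exp (-(4 * (N * ζ)) * (r : ℂ) ^ 2) *
      ((2 / Real.sqrt (1 + r ^ 2) : ℝ) : ℂ)) (Real.sqrt N)
    rw [abs_of_pos hs] at h1
    rw [macdonald, mul_assoc, ← mul_assoc (Complex.exp _), ← Complex.exp_add]
    simp only [add_neg_cancel, Complex.exp_zero, one_mul]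
    rw [← Complex.real_smul, ← h1]
    refine integral_congr_ae (Eventually.of_forall fun r => ?_)
    have hsq : ((Real.sqrt N : ℝ) : ℂ) ^ 2 = N := by
      rw [← Complex.ofReal_pow, Real.sq_sqrt (by positivity)]; simp
    have hN' : (N : ℂ) ≠ 0 := by exact_mod_cast hN
    have : -(4 * (N * ζ)) * ((r / Real.sqrt N : ℝ) : ℂ) ^ 2 = -(4 * ζ) * (r : ℂ) ^ 2 := by
      push_cast
      rw [div_pow, hsq]
      field_simp
    simp only [this]
  have hlim : Tendsto (fun N : ℕ => ∫ r : ℝ, Complex.exp (-(4 * ζ) * (r : ℂ) ^ 2) *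
      ((2 / Real.sqrt (1 + (r / Real.sqrt N) ^ 2) : ℝ) : ℂ)) atTop
      (𝓝 (∫ r : ℝ, Complex.exp (-(4 * ζ) * (r : ℂ) ^ 2) * ((2 : ℝ) : ℂ))) := by
    refine tendsto_integral_of_dominated_convergence
      (fun r => 2 * Real.exp (-(4 * ζ.re) * r ^ 2)) (fun N => ?_)
      ((integrable_exp_neg_mul_sq (by positivity)).const_mul 2) (fun N => ?_) ?_
    · exact ((by fun_prop : Continuous fun r : ℝ => Complex.exp (-(4 * ζ) * (r : ℂ) ^ 2)).mul
        (continuous_two_div_sqrt.comp (continuous_id.div_const _))).aestronglyMeasurable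
    · refine Eventually.of_forall fun r => ?_
      rw [norm_mul, norm_cexp_neg_mul_sq, four_mul_re, mul_comm]
      gcongr
      exact two_div_sqrt_le _
    · refine Eventually.of_forall fun r => ?_
      refine Tendsto.const_mul _ ((Complex.continuous_ofReal.tendsto _).comp ?_)
      have h1 : Tendsto (fun N : ℕ => r / Real.sqrt N) atTop (𝓝 0) :=
        Tendsto.const_div_atTop (Real.tendsto_sqrt_atTop.comp tendsto_natCast_atTop_atTop) r
      have h2 : Continuous fun u : ℝ => 2 / Real.sqrt (1 + u ^ 2) :=
        continuous_const.div (by fun_prop) fun u => by positivity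
      have := (h2.tendsto 0).comp h1
      simpa [Function.comp_def] using this
  have e2 : (∫ r : ℝ, Complex.exp (-(4 * ζ) * (r : ℂ) ^ 2) * ((2 : ℝ) : ℂ)) =
      2 * ∫ r : ℝ, Complex.exp (-(4 * ζ) * (r : ℂ) ^ 2) := by
    rw [integral_mul_const, Complex.ofReal_ofNat]; exact mul_comm _ _
  rw [e2] at hlim
  refine Tendsto.congr' ?_ hlim
  filter_upwards [eventually_ne_atTop 0] with N hN
  exact e N hN

theorem neg_sq_sin_le {θ : ℝ} (h : |θ| ≤ Real.pi / 2) :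
    4 / Real.pi ^ 2 * θ ^ 2 ≤ Real.sin θ ^ 2 := by
  have h1 := Real.mul_abs_le_abs_sin h
  have h2 : 0 ≤ 2 / Real.pi * |θ| := by positivity
  have h3 := mul_self_le_mul_self h2 h1
  rw [← sq, ← sq, mul_pow, sq_abs, sq_abs, div_pow] at h3
  linarith

theorem norm_cexp_neg_sin_sq_le {ζ : ℂ} (hζ : 0 < ζ.re) {θ : ℝ} (h : |θ| ≤ Real.pi / 2) :
    ‖Complex.exp (-(4 * ζ * Real.sin θ ^ 2))‖ ≤
      Real.exp (-(16 / Real.pi ^ 2 * ζ.re) * θ ^ 2) := by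
  rw [Complex.norm_exp]
  have h1 : (-(4 * ζ * (Real.sin θ : ℂ) ^ 2)).re = -(4 * ζ.re * Real.sin θ ^ 2) := by
    rw [← Complex.ofReal_pow, Complex.neg_re, Complex.re_mul_ofReal, four_mul_re]
  rw [h1, Real.exp_le_exp]
  have := mul_le_mul_of_nonneg_left (neg_sq_sin_le h) (by positivity : 0 ≤ 4 * ζ.re)
  have e : 4 * ζ.re * (4 / Real.pi ^ 2 * θ ^ 2) = 16 / Real.pi ^ 2 * ζ.re * θ ^ 2 := by ring
  linarith

/-- The bound |sin θ| ≥ 2|θ|/π dominates the integrand by a Gaussian; the remaining constant √(π/16)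
is at most 1. -/
theorem norm_besselSeries_le_of_re_pos {ζ : ℂ} (hζ : 0 < ζ.re) : ‖besselSeries ζ‖ ≤
    Real.exp (2 * ζ.re) / Real.sqrt ζ.re := by
  have hpi := Real.pi_pos
  rw [besselSeries_eq_halfAvg, norm_mul, Complex.norm_exp, halfAvg, norm_mul, norm_inv,
    Complex.norm_real, Real.norm_of_nonneg hpi.le]
  have h1 : (2 * ζ).re = 2 * ζ.re := by simp
  have hb : 0 < 16 / Real.pi ^ 2 * ζ.re := by positivity
  have hi := integrable_exp_neg_mul_sq hb
  have h2 : ‖∫ θ in (-(Real.pi / 2))..(Real.pi / 2),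
      Complex.exp (-(4 * ζ * Real.sin θ ^ 2))‖ ≤
      ∫ θ : ℝ, Real.exp (-(16 / Real.pi ^ 2 * ζ.re) * θ ^ 2) := by
    refine (intervalIntegral.norm_integral_le_of_norm_le (by linarith)
      (g := fun θ => Real.exp (-(16 / Real.pi ^ 2 * ζ.re) * θ ^ 2))
      (Eventually.of_forall fun θ hθ => ?_) hi.intervalIntegrable).trans ?_
    · exact norm_cexp_neg_sin_sq_le hζ (abs_le.mpr ⟨hθ.1.le, hθ.2⟩)
    · rw [intervalIntegral.integral_of_le (by linarith)]
      exact setIntegral_le_integral hi (Eventually.of_forall fun _ => (Real.exp_pos _).le)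
  rw [integral_gaussian, ← div_div, Real.sqrt_div (by positivity)] at h2
  have h3 : Real.pi⁻¹ * Real.sqrt (Real.pi / (16 / Real.pi ^ 2)) ≤ 1 := by
    rw [inv_mul_le_iff₀ hpi, mul_one, Real.sqrt_le_left hpi.le]
    have := Real.pi_le_four
    have e : Real.pi / (16 / Real.pi ^ 2) = Real.pi ^ 2 * (Real.pi / 16) := by field_simp
    rw [e]
    nlinarith [sq_nonneg Real.pi]
  rw [h1]
  calc _ ≤ Real.exp (2 * ζ.re) * (Real.pi⁻¹ *
        (Real.sqrt (Real.pi / (16 / Real.pi ^ 2)) / Real.sqrt ζ.re)) := by gcongr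
    _ = Real.exp (2 * ζ.re) / Real.sqrt ζ.re *
        (Real.pi⁻¹ * Real.sqrt (Real.pi / (16 / Real.pi ^ 2))) := by ring
    _ ≤ Real.exp (2 * ζ.re) / Real.sqrt ζ.re * 1 := by gcongr
    _ = _ := mul_one _

/-- The same scaling of the angle. The indicator extends the growing interval to the whole line, and
N sin²(φ/√N) = φ² sinc²(φ/√N) tends to φ². -/
theorem tendsto_besselSeries {ζ : ℂ} (hζ : 0 < ζ.re) :
    Tendsto (fun N : ℕ => (Real.sqrt N : ℂ) * Complex.exp (-(2 * (N * ζ))) * besselSeries (N * ζ))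
      atTop (𝓝 ((Real.pi : ℂ)⁻¹ * ∫ r : ℝ, Complex.exp (-(4 * ζ) * (r : ℂ) ^ 2))) := by
  have hpi := Real.pi_pos
  set F : ℕ → ℝ → ℂ := fun N => Set.indicator
    (Set.Ioc (-(Real.pi / 2) * Real.sqrt N) (Real.pi / 2 * Real.sqrt N))
    (fun φ => Complex.exp (-(4 * (N * ζ) * Real.sin (φ / Real.sqrt N) ^ 2))) with hF
  have e : ∀ N : ℕ, N ≠ 0 → (Real.pi : ℂ)⁻¹ * ∫ φ, F N φ =
      (Real.sqrt N : ℂ) * Complex.exp (-(2 * (N * ζ))) * besselSeries (N * ζ) := by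
    intro N hN
    have hs : 0 < Real.sqrt N := Real.sqrt_pos.mpr (by positivity)
    rw [hF]
    simp only
    rw [integral_indicator measurableSet_Ioc, ← intervalIntegral.integral_of_le (by
      refine mul_le_mul_of_nonneg_right (by linarith) hs.le),
      intervalIntegral.integral_comp_div
        (fun θ => Complex.exp (-(4 * (N * ζ) * Real.sin θ ^ 2))) hs.ne',
      mul_div_cancel_right₀ _ hs.ne', mul_div_cancel_right₀ _ hs.ne', besselSeries_eq_halfAvg,
      mul_assoc, ← mul_assoc (Complex.exp _), ← Complex.exp_add, neg_add_cancel, Complex.exp_zero,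
      one_mul, halfAvg, Complex.real_smul]
    ring
  have hlim : Tendsto (fun N : ℕ => ∫ φ, F N φ) atTop
      (𝓝 (∫ r : ℝ, Complex.exp (-(4 * ζ) * (r : ℂ) ^ 2))) := by
    refine tendsto_integral_of_dominated_convergence
      (fun r => Real.exp (-(16 / Real.pi ^ 2 * ζ.re) * r ^ 2)) (fun N => ?_)
      (integrable_exp_neg_mul_sq (by positivity)) (fun N => ?_) ?_
    · refine (Continuous.aestronglyMeasurable ?_).indicator measurableSet_Ioc
      fun_prop
    · refine Eventually.of_forall fun φ => ?_
      simp only [hF, Set.indicator]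
      split_ifs with hφ
      · rcases Nat.eq_zero_or_pos N with rfl | hN
        · simp at hφ
        have hs : 0 < Real.sqrt N := Real.sqrt_pos.mpr (by positivity)
        have hN' : (0 : ℝ) < N := by exact_mod_cast hN
        have hre : 0 < (N * ζ).re := by
          rw [← Complex.ofReal_natCast, Complex.re_ofReal_mul]; positivity
        have habs : |φ / Real.sqrt N| ≤ Real.pi / 2 := by
          rw [abs_div, abs_of_pos hs, div_le_iff₀ hs, abs_le]
          exact ⟨by linarith [hφ.1], hφ.2⟩
        refine (norm_cexp_neg_sin_sq_le hre habs).trans_eq ?_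
        congr 1
        rw [← Complex.ofReal_natCast, Complex.re_ofReal_mul, div_pow, Real.sq_sqrt hN'.le]
        field_simp
      · simp [Real.exp_nonneg]
    · refine Eventually.of_forall fun φ => ?_
      have hsq : Tendsto (fun N : ℕ => Real.sqrt N) atTop atTop :=
        Real.tendsto_sqrt_atTop.comp tendsto_natCast_atTop_atTop
      have hev : ∀ᶠ N : ℕ in atTop, F N φ =
          Complex.exp (-(4 * ζ) * (φ : ℂ) ^ 2 * (Real.sinc (φ / Real.sqrt N) : ℂ) ^ 2) := by
        filter_upwards [hsq.eventually_gt_atTop (|φ| / (Real.pi / 2)), eventually_ne_atTop 0]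
          with N h1 hN
        have hs : 0 < Real.sqrt N := Real.sqrt_pos.mpr (by positivity)
        rw [div_lt_iff₀ (by positivity), abs_lt] at h1
        simp only [hF]
        rw [Set.indicator_of_mem (by constructor <;> [linarith [h1.1]; linarith [h1.2]])]
        congr 1
        have hsin : (Real.sin (φ / Real.sqrt N)) = φ / Real.sqrt N * Real.sinc (φ / Real.sqrt N) := by
          by_cases h0 : φ / Real.sqrt N = 0
          · rw [h0]; simp
          · rw [Real.sinc_of_ne_zero h0, ← mul_div_assoc]
            exact (mul_div_cancel_left₀ _ h0).symm
        have hsq : ((Real.sqrt N : ℝ) : ℂ) ^ 2 = N := by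
          rw [← Complex.ofReal_pow, Real.sq_sqrt (by positivity)]; simp
        have hN' : (N : ℂ) ≠ 0 := by exact_mod_cast hN
        rw [hsin]
        push_cast
        rw [mul_pow, div_pow, hsq]
        field_simp
      refine Tendsto.congr' (hev.mono fun _ h => h.symm) ?_
      have h1 : Tendsto (fun N : ℕ => φ / Real.sqrt N) atTop (𝓝 0) := Tendsto.const_div_atTop hsq φ
      have h2 : Continuous fun u : ℝ => Complex.exp (-(4 * ζ) * (φ : ℂ) ^ 2 *
          (Real.sinc u : ℂ) ^ 2) := by
        have := Real.continuous_sinc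
        fun_prop
      have := (h2.tendsto 0).comp h1
      simpa [Function.comp_def] using this
  refine Tendsto.congr' ?_ (hlim.const_mul _)
  filter_upwards [eventually_ne_atTop 0] with N hN
  exact e N hN

/-- The product of the two Bessel functions at `N ζ` is asymptotic to `1 / (2 N ζ)`. -/
theorem tendsto_macdonald_mul_besselSeries {ζ : ℂ} (hζ : 0 < ζ.re) :
    Tendsto (fun N : ℕ => (N : ℂ) * macdonald (N * ζ) * besselSeries (N * ζ) * (2 * ζ)) atTop
      (𝓝 1) := by
  have h := ((tendsto_macdonald hζ).mul (tendsto_besselSeries hζ)).mul_const (2 * ζ)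
  have hζ0 : ζ ≠ 0 := by rintro rfl; simp at hζ
  have hpi : (Real.pi : ℂ) ≠ 0 := by exact_mod_cast Real.pi_ne_zero
  have h1 := integral_gaussian_sq_complex (b := 4 * ζ) (by rw [four_mul_re]; positivity)
  set G := ∫ r : ℝ, Complex.exp (-(4 * ζ) * (r : ℂ) ^ 2)
  -- Both limits contain the same Gaussian integral G, and only G² = π/(4ζ) is needed, so no branch
  -- of the square root has to be chosen.
  have e : 2 * G * ((Real.pi : ℂ)⁻¹ * G) * (2 * ζ) = 1 := by
    calc 2 * G * ((Real.pi : ℂ)⁻¹ * G) * (2 * ζ) = 4 * ζ * (Real.pi : ℂ)⁻¹ * G ^ 2 := by ring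
      _ = 1 := by rw [h1]; field_simp
  rw [e] at h
  refine h.congr fun N => ?_
  have hsq : (Real.sqrt N : ℂ) * (Real.sqrt N : ℂ) = N := by
    rw [← Complex.ofReal_mul, Real.mul_self_sqrt (by positivity)]; simp
  have hexp : Complex.exp (2 * (N * ζ)) * Complex.exp (-(2 * (N * ζ))) = 1 := by
    rw [← Complex.exp_add, add_neg_cancel, Complex.exp_zero]
  calc _ = (Real.sqrt N : ℂ) * (Real.sqrt N : ℂ) * (Complex.exp (2 * (N * ζ)) *
        Complex.exp (-(2 * (N * ζ)))) * macdonald (N * ζ) * besselSeries (N * ζ) * (2 * ζ) := by ring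
    _ = _ := by rw [hsq, hexp]; ring

/-! ### Bessel moments as derivatives of one function. -/

/-- The derivatives `∫ (-1/s)^i w(y, s) ds` of the Bessel moment of order zero. -/
noncomputable def besselDeriv (i : ℕ) (y : ℝ) : ℝ :=
  ∫ s in Set.Ioi (0 : ℝ), (-s⁻¹) ^ i * biorthWeight y s

theorem continuousOn_inv_pow_mul_biorthWeight (i : ℕ) (y : ℝ) :
    ContinuousOn (fun s => (-s⁻¹) ^ i * biorthWeight y s) (Set.Ioi 0) := by
  unfold biorthWeight
  have : ∀ s ∈ Set.Ioi (0 : ℝ), s ≠ 0 := fun s hs => ne_of_gt hs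
  fun_prop (disch := assumption)

theorem norm_inv_pow_mul_biorthWeight_le (i : ℕ) {y s : ℝ} (hy : 0 < y) (hs : 0 < s) :
    ‖(-s⁻¹) ^ i * biorthWeight y s‖ ≤
      ((i + 1).factorial : ℝ) / y ^ (i + 1) * Real.exp (-s) := by
  have h1 : (y / s) ^ (i + 1) ≤ (i + 1).factorial * Real.exp (y / s) := by
    have := Real.pow_div_factorial_le_exp (y / s) (by positivity) (i + 1)
    rw [div_le_iff₀ (by positivity)] at this
    linarith
  have h2 : s⁻¹ ^ (i + 1) * Real.exp (-(y / s)) ≤ ((i + 1).factorial : ℝ) / y ^ (i + 1) := by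
    rw [Real.exp_neg, ← div_eq_mul_inv, div_le_div_iff₀ (Real.exp_pos _) (by positivity),
      ← mul_pow, inv_mul_eq_div]
    exact h1
  rw [norm_mul, norm_pow, norm_neg, Real.norm_of_nonneg (by positivity),
    Real.norm_of_nonneg (by unfold biorthWeight; positivity), biorthWeight, sub_eq_add_neg,
    Real.exp_add]
  calc _ = s⁻¹ ^ (i + 1) * Real.exp (-(y / s)) * Real.exp (-s) := by ring
    _ ≤ _ := by gcongr

theorem integrableOn_inv_pow_mul_biorthWeight (i : ℕ) {y : ℝ} (hy : 0 < y) :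
    IntegrableOn (fun s => (-s⁻¹) ^ i * biorthWeight y s) (Set.Ioi 0) := by
  refine Integrable.mono' (g := fun s => ((i + 1).factorial : ℝ) / y ^ (i + 1) * Real.exp (-s))
    ?_ ((continuousOn_inv_pow_mul_biorthWeight i y).aestronglyMeasurable measurableSet_Ioi) ?_
  · have := integrableOn_pow_mul_exp_neg_mul 0 one_pos
    simp only [pow_zero, one_mul] at this
    exact this.const_mul _
  · exact ae_restrict_of_forall_mem measurableSet_Ioi fun s hs =>
      norm_inv_pow_mul_biorthWeight_le i hy hs

theorem hasDerivAt_besselDeriv (i : ℕ) {y : ℝ} (hy : 0 < y) :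
    HasDerivAt (besselDeriv i) (besselDeriv (i + 1) y) y := by
  have hs : Set.Ioi (y / 2) ∈ 𝓝 y := Ioi_mem_nhds (by linarith)
  refine (hasDerivAt_integral_of_dominated_loc_of_deriv_le (𝕜 := ℝ)
    (F := fun y s => (-s⁻¹) ^ i * biorthWeight y s)
    (F' := fun y s => (-s⁻¹) ^ (i + 1) * biorthWeight y s) (bound := fun s =>
      ((i + 1 + 1).factorial : ℝ) / (y / 2) ^ (i + 1 + 1) * Real.exp (-s)) hs
    (Eventually.of_forall fun w =>
      (continuousOn_inv_pow_mul_biorthWeight i w).aestronglyMeasurable measurableSet_Ioi)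
    (integrableOn_inv_pow_mul_biorthWeight i hy)
    ((continuousOn_inv_pow_mul_biorthWeight (i + 1) y).aestronglyMeasurable measurableSet_Ioi)
    ?_ ?_ ?_).2
  · refine ae_restrict_of_forall_mem measurableSet_Ioi fun s hs w hw => ?_
    have hw' : y / 2 < w := hw
    refine (norm_inv_pow_mul_biorthWeight_le (i + 1) (by linarith) hs).trans ?_
    gcongr
  · have := integrableOn_pow_mul_exp_neg_mul 0 one_pos
    simp only [pow_zero, one_mul] at this
    exact this.const_mul _
  · refine ae_restrict_of_forall_mem measurableSet_Ioi fun s _ w _ => ?_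
    unfold biorthWeight
    have h1 : HasDerivAt (fun w : ℝ => -(w / s) - s) (-s⁻¹) w := by
      have := (((hasDerivAt_id w).div_const s).neg).sub_const s
      simpa using this
    exact ((h1.exp.const_mul s⁻¹).const_mul ((-s⁻¹) ^ i)).congr_deriv (by ring)

/-- The substitution s ↦ y/s swaps the two terms of the exponent and preserves ds/s. -/
theorem besselMoment_eq_besselDeriv (i : ℕ) {y : ℝ} (hy : 0 < y) :
    besselMoment i y = (-y) ^ i * besselDeriv i y := by
  have himg : (fun s : ℝ => y / s) '' Set.Ioi 0 = Set.Ioi 0 := by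
    ext t
    constructor
    · rintro ⟨s, hs, rfl⟩
      exact div_pos hy hs
    · intro ht
      have ht' : (0 : ℝ) < t := ht
      exact ⟨y / t, div_pos hy ht', by field_simp⟩
  have hinj : Set.InjOn (fun s : ℝ => y / s) (Set.Ioi 0) := by
    intro s hs t ht h
    have hs' : (0 : ℝ) < s := hs
    have ht' : (0 : ℝ) < t := ht
    simp only at h
    field_simp at h
    exact h.symm
  have hder : ∀ s ∈ Set.Ioi (0 : ℝ),
      HasDerivWithinAt (fun s : ℝ => y / s) (-(y / s ^ 2)) (Set.Ioi 0) s := by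
    intro s hs
    have hs' : (0 : ℝ) < s := hs
    have := ((hasDerivAt_inv hs'.ne').const_mul y).hasDerivWithinAt (s := Set.Ioi 0)
    simp only [← div_eq_mul_inv] at this
    exact this.congr_deriv (by field_simp)
  rw [besselMoment, ← himg, integral_image_eq_integral_abs_deriv_smul measurableSet_Ioi hder hinj,
    besselDeriv, ← integral_const_mul]
  refine setIntegral_congr_fun measurableSet_Ioi fun s hs => ?_
  have hs' : (0 : ℝ) < s := hs
  rw [abs_neg, abs_of_pos (by positivity), smul_eq_mul, ← mul_assoc ((-y) ^ i), ← mul_pow]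
  have e1 : -y * -s⁻¹ = y / s := by field_simp
  have e2 : biorthWeight y (y / s) = s / y * Real.exp (-(y / s) - s) := by
    rw [biorthWeight, inv_div]
    congr 2
    field_simp
    ring
  rw [e1, e2, biorthWeight]
  field_simp

/-- With s = z e^t the exponent is -2z cosh t, and t = 2 arsinh r gives cosh t = 1 + 2r². This links
the Bessel moments to a function holomorphic in the right half-plane. -/
theorem macdonald_ofReal {z : ℝ} (hz : 0 < z) :
    macdonald z = (besselDeriv 0 (z ^ 2) : ℂ) := by
  set f : ℝ → ℝ := fun r => z * Real.exp (2 * Real.arsinh r) with hf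
  have himg : f '' Set.univ = Set.Ioi 0 := by
    ext t
    constructor
    · rintro ⟨s, -, rfl⟩
      exact mul_pos hz (Real.exp_pos _)
    · intro ht
      have ht' : (0 : ℝ) < t := ht
      refine ⟨Real.sinh (Real.log (t / z) / 2), trivial, ?_⟩
      simp only [hf]
      rw [Real.arsinh_sinh, mul_div_cancel₀ _ two_ne_zero, Real.exp_log (by positivity)]
      field_simp
  have hinj : Set.InjOn f Set.univ := by
    intro s _ t _ h
    simp only [hf] at h
    have h1 := Real.exp_injective (mul_left_cancel₀ hz.ne' h)
    exact Real.arsinh_injective (by linarith)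
  have hder : ∀ r ∈ Set.univ, HasDerivWithinAt f (f r * (2 / Real.sqrt (1 + r ^ 2))) Set.univ r := by
    intro r _
    have := (((Real.hasDerivAt_arsinh r).const_mul 2).exp).const_mul z
    refine (this.congr_deriv ?_).hasDerivWithinAt
    simp only [hf]; ring
  have hpos : ∀ r, 0 < f r := fun r => mul_pos hz (Real.exp_pos _)
  have h1 : besselDeriv 0 (z ^ 2) = Real.exp (-(2 * z)) *
      ∫ r : ℝ, Real.exp (-(4 * z) * r ^ 2) * (2 / Real.sqrt (1 + r ^ 2)) := by
    rw [besselDeriv, ← himg, integral_image_eq_integral_abs_deriv_smul MeasurableSet.univ hder hinj,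
      ← integral_const_mul, setIntegral_univ]
    refine integral_congr_ae (Eventually.of_forall fun r => ?_)
    have hp := hpos r
    have hs : 0 < Real.sqrt (1 + r ^ 2) := by positivity
    simp only [pow_zero, one_mul, smul_eq_mul]
    rw [abs_of_pos (by positivity), biorthWeight, ← mul_assoc (Real.exp _), ← Real.exp_add]
    have e1 : -(z ^ 2 / f r) - f r = -(2 * z) + -(4 * z) * r ^ 2 := by
      have hE : z ^ 2 / f r = z * Real.exp (-(2 * Real.arsinh r)) := by
        simp only [hf]; rw [Real.exp_neg]; field_simp
      have hc : Real.exp (2 * Real.arsinh r) + Real.exp (-(2 * Real.arsinh r)) =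
          2 + 4 * r ^ 2 := by
        have h2 := Real.cosh_eq (2 * Real.arsinh r)
        rw [Real.cosh_two_mul, Real.cosh_sq, Real.sinh_arsinh] at h2
        linarith
      rw [hE]
      simp only [hf]
      linear_combination (-z) * hc
    rw [e1]
    field_simp
  rw [h1, macdonald]
  push_cast
  rw [← integral_complex_ofReal]
  push_cast
  rfl

/-! ### Polygonal paths in the quadrant: half of Cauchy's formula. -/

/-- The affine parametrization of the segment from `P` to `Q`. -/
noncomputable def segPoint (P Q : ℂ) (t : ℝ) : ℂ := P + t * (Q - P)

/-- The integral of a complex function along the segment from `P` to `Q`. -/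
noncomputable def segIntegral (f : ℂ → ℂ) (P Q : ℂ) : ℂ :=
  ∫ t in (0 : ℝ)..1, f (segPoint P Q t) * (Q - P)

theorem segPoint_re (P Q : ℂ) (t : ℝ) : (segPoint P Q t).re = (1 - t) * P.re + t * Q.re := by
  simp [segPoint]; ring

theorem segPoint_im (P Q : ℂ) (t : ℝ) : (segPoint P Q t).im = (1 - t) * P.im + t * Q.im := by
  simp [segPoint]; ring

theorem continuous_segPoint (P Q : ℂ) : Continuous (segPoint P Q) := by
  unfold segPoint; fun_prop

theorem segIntegral_eq_sub {F f : ℂ → ℂ} {P Q : ℂ} {S : Set ℂ} (hS : ∀ t ∈ Set.Icc (0 : ℝ) 1,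
    segPoint P Q t ∈ S) (hF : ∀ ζ ∈ S, HasDerivAt F (f ζ) ζ) (hf : ContinuousOn f S) :
    segIntegral f P Q = F Q - F P := by
  have hu : Set.uIcc (0 : ℝ) 1 = Set.Icc 0 1 := Set.uIcc_of_le zero_le_one
  have h := intervalIntegral.integral_eq_sub_of_hasDerivAt (a := 0) (b := 1)
    (f := fun t => F (segPoint P Q t)) (f' := fun t => f (segPoint P Q t) * (Q - P)) ?_ ?_
  · rw [segIntegral, h]
    simp [segPoint]
  · intro t ht
    rw [hu] at ht
    have h1 : HasDerivAt (segPoint P Q) (Q - P) t := by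
      have h0 : HasDerivAt (fun x : ℝ => (x : ℂ)) 1 t := Complex.ofRealCLM.hasDerivAt
      exact ((h0.mul_const (Q - P)).const_add P).congr_deriv (one_mul _)
    exact (hF _ (hS t ht)).comp t h1
  · refine ContinuousOn.intervalIntegrable ?_
    rw [hu]
    exact (hf.comp (continuous_segPoint P Q).continuousOn hS).mul continuousOn_const

theorem intervalIntegrable_segPoint {f : ℂ → ℂ} {P Q : ℂ} {S : Set ℂ}
    (hS : ∀ t ∈ Set.Icc (0 : ℝ) 1, segPoint P Q t ∈ S) (hf : ContinuousOn f S) :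
    IntervalIntegrable (fun t => f (segPoint P Q t) * (Q - P)) volume 0 1 := by
  refine ContinuousOn.intervalIntegrable ?_
  rw [Set.uIcc_of_le zero_le_one]
  exact (hf.comp (continuous_segPoint P Q).continuousOn hS).mul continuousOn_const

/-- The integral along a polygonal path. -/
noncomputable def pathIntegral (f : ℂ → ℂ) (P : ℕ → ℂ) (n : ℕ) : ℂ :=
  ∑ i ∈ Finset.range n, segIntegral f (P i) (P (i + 1))

/-- The part of the quadrant on which `ζ² ≠ y`. -/
def quadrantMinus (y : ℝ) : Set ℂ := {ζ | 0 < ζ.re ∧ 0 ≤ ζ.im ∧ ζ ^ 2 ≠ y}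

/-- A polygonal path in the first quadrant from a real point to the left of `√y` to a real point
to its right. -/
structure IsQuadrantPath (P : ℕ → ℂ) (n : ℕ) (y : ℝ) : Prop where
  mem : ∀ i < n, ∀ t ∈ Set.Icc (0 : ℝ) 1, segPoint (P i) (P (i + 1)) t ∈ quadrantMinus y
  im_start : (P 0).im = 0
  im_end : (P n).im = 0
  re_start : 0 < (P 0).re
  re_end : 0 < (P n).re
  sq_start : (P 0).re ^ 2 < y
  sq_end : y < (P n).re ^ 2

section QuadrantPath

variable {P : ℕ → ℂ} {n : ℕ} {y : ℝ} (hP : IsQuadrantPath P n y)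
include hP

theorem IsQuadrantPath.integral_eq_sub {F f : ℂ → ℂ}
    (hF : ∀ ζ ∈ quadrantMinus y, HasDerivAt F (f ζ) ζ) (hf : ContinuousOn f (quadrantMinus y)) :
    pathIntegral f P n = F (P n) - F (P 0) := by
  rw [pathIntegral, ← Finset.sum_range_sub (fun i => F (P i))]
  refine Finset.sum_congr rfl fun i hi => ?_
  exact segIntegral_eq_sub (hP.mem i (Finset.mem_range.mp hi)) hF hf

theorem IsQuadrantPath.integral_sub {f g : ℂ → ℂ} (hf : ContinuousOn f (quadrantMinus y))
    (hg : ContinuousOn g (quadrantMinus y)) :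
    pathIntegral (fun ζ => f ζ - g ζ) P n = pathIntegral f P n - pathIntegral g P n := by
  rw [pathIntegral, pathIntegral, pathIntegral, ← Finset.sum_sub_distrib]
  refine Finset.sum_congr rfl fun i hi => ?_
  have hm := hP.mem i (Finset.mem_range.mp hi)
  rw [segIntegral, segIntegral, segIntegral, ← intervalIntegral.integral_sub
    (intervalIntegrable_segPoint hm hf) (intervalIntegrable_segPoint hm hg)]
  simp only [sub_mul]

theorem IsQuadrantPath.integral_sum {ι : Type*} (s : Finset ι) {f : ι → ℂ → ℂ}
    (hf : ∀ k ∈ s, ContinuousOn (f k) (quadrantMinus y)) :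
    pathIntegral (fun ζ => ∑ k ∈ s, f k ζ) P n = ∑ k ∈ s, pathIntegral (f k) P n := by
  simp only [pathIntegral]
  rw [Finset.sum_comm]
  refine Finset.sum_congr rfl fun i hi => ?_
  have hm := hP.mem i (Finset.mem_range.mp hi)
  simp only [segIntegral, Finset.sum_mul]
  rw [intervalIntegral.integral_finsetSum fun k hk => intervalIntegrable_segPoint hm (hf k hk)]

omit hP in
theorem pathIntegral_const_mul (c : ℂ) (f : ℂ → ℂ) :
    pathIntegral (fun ζ => c * f ζ) P n = c * pathIntegral f P n := by
  simp only [pathIntegral, segIntegral, mul_assoc, intervalIntegral.integral_const_mul,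
    Finset.mul_sum]

omit hP in
theorem quadrantMinus_sub_ne_zero {ζ : ℂ} (hζ : ζ ∈ quadrantMinus y) : ζ ^ 2 - y ≠ 0 :=
  sub_ne_zero.mpr hζ.2.2

omit hP in
-- The increment is an integral along the real axis. One exceptional point c is allowed because the
-- function it is applied to is a `dslope`, whose value at c is a derivative.
theorem im_primitive_sub_eq_zero {Φ k : ℂ → ℂ} {c a b : ℝ} (ha : 0 < a) (hb : 0 < b)
    (hΦ : ∀ ζ : ℂ, 0 < ζ.re → HasDerivAt Φ (k ζ) ζ) (hk : ContinuousOn k {ζ | 0 < ζ.re})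
    (hreal : ∀ t : ℝ, 0 < t → t ≠ c → (k t).im = 0) : (Φ b - Φ a).im = 0 := by
  have hpos : ∀ t ∈ Set.uIcc a b, 0 < t := fun t ht =>
    lt_of_lt_of_le (lt_min ha hb) ht.1
  have hcont : ContinuousOn (fun t : ℝ => k t) (Set.uIcc a b) :=
    hk.comp Complex.continuous_ofReal.continuousOn fun t ht => by simpa using hpos t ht
  have h := intervalIntegral.integral_eq_sub_of_hasDerivAt (a := a) (b := b)
    (f := fun t : ℝ => Φ t) (f' := fun t : ℝ => k t)
    (fun t ht => (hΦ t (by simpa using hpos t ht)).comp_ofReal) hcont.intervalIntegrable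
  rw [← h]
  have h2 : ∫ t in a..b, k t = ∫ t in a..b, (((k t).re : ℝ) : ℂ) := by
    refine intervalIntegral.integral_congr_ae ?_
    have hc : ∀ᵐ t : ℝ ∂volume, t ≠ c := by
      rw [ae_iff]
      simp
    filter_upwards [hc] with t htc ht
    exact Complex.ext (by simp) (by simpa using hreal t (hpos t (Set.uIoc_subset_uIcc ht)) htc)
  rw [h2, intervalIntegral.integral_ofReal, Complex.ofReal_im]

/-- Subtracting the value at √y leaves a holomorphic `dslope` term with a primitive in the
half-plane and real values on the axis, which adds no imaginary part. The polar term integrates to a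
logarithm whose argument goes from π/2 to -π/2. -/
theorem IsQuadrantPath.im_integral_simple {H : ℂ → ℂ}
    (hH : DifferentiableOn ℂ H {ζ | 0 < ζ.re}) {g : ℝ → ℝ}
    (hg : ∀ z : ℝ, 0 < z → H z = (g (z ^ 2) : ℂ)) :
    (pathIntegral (fun ζ => H ζ * (2 * ζ) / (ζ ^ 2 - y)) P n).im = -Real.pi * g y := by
  have hy : 0 < y := lt_of_le_of_lt (sq_nonneg _) hP.sq_start
  set c := Real.sqrt y with hc
  have hc0 : 0 < c := Real.sqrt_pos.mpr hy
  have hcy : c ^ 2 = y := Real.sq_sqrt hy.le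
  have hU : IsOpen {ζ : ℂ | 0 < ζ.re} := isOpen_lt continuous_const Complex.continuous_re
  have hD : DifferentiableOn ℂ (dslope H c) {ζ | 0 < ζ.re} :=
    (Complex.differentiableOn_dslope (hU.mem_nhds (by simpa using hc0))).mpr hH
  set k : ℂ → ℂ := fun ζ => dslope H c ζ * (2 * ζ / (ζ + c)) with hk
  have hne : ∀ ζ ∈ {ζ : ℂ | 0 < ζ.re}, ζ + c ≠ 0 := by
    intro ζ hζ h0
    have hζ' : 0 < ζ.re := hζ
    have := congrArg Complex.re h0
    simp at this
    linarith
  have hkd : DifferentiableOn ℂ k {ζ | 0 < ζ.re} := by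
    refine hD.mul (DifferentiableOn.div (by fun_prop) (by fun_prop) hne)
  have hconv : Convex ℝ {ζ : ℂ | 0 < ζ.re} := convex_halfSpace_re_gt 0
  obtain ⟨Φ, hΦ'⟩ := hconv.exists_forall_hasDerivWithinAt hkd
  have hΦ : ∀ ζ : ℂ, 0 < ζ.re → HasDerivAt Φ (k ζ) ζ := fun ζ hζ =>
    (hΦ' ζ hζ).hasDerivAt (hU.mem_nhds hζ)
  have hHc : H c = (g y : ℂ) := by rw [hg c hc0, hcy]
  -- On the quadrant -i(ζ²-y) has real part 2 Re ζ Im ζ ≥ 0, so after this rotation one branch of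
  -- the logarithm serves the whole path.
  set F : ℂ → ℂ := fun ζ => Φ ζ + g y * Complex.log (-Complex.I * (ζ ^ 2 - y)) with hF
  have hslit : ∀ ζ ∈ quadrantMinus y, -Complex.I * (ζ ^ 2 - y) ∈ Complex.slitPlane := by
    intro ζ hζ
    have e1 : (-Complex.I * (ζ ^ 2 - y)).re = 2 * ζ.re * ζ.im := by simp [sq]; ring
    have e2 : (-Complex.I * (ζ ^ 2 - y)).im = -(ζ.re ^ 2 - ζ.im ^ 2 - y) := by simp [sq]
    rw [Complex.mem_slitPlane_iff, e1, e2]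
    rcases hζ.2.1.eq_or_lt with h | h
    · right
      intro h0
      refine hζ.2.2 (Complex.ext ?_ ?_)
      · rw [Complex.ofReal_re, sq, Complex.mul_re]; nlinarith
      · rw [Complex.ofReal_im, sq, Complex.mul_im, ← h]; ring
    · left
      have := hζ.1
      positivity
  rw [hP.integral_eq_sub (F := F)]
  · have e1 : ∀ a : ℝ, F a = Φ a + g y * Complex.log (-Complex.I * ((a ^ 2 - y : ℝ) : ℂ)) := by
      intro a; simp only [hF]; push_cast; rfl
    have hre : ∀ i, (P i).im = 0 → P i = ((P i).re : ℂ) := fun i hi =>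
      Complex.ext (by simp) (by simpa using hi)
    have h1 : (Complex.log (-Complex.I * (((P 0).re ^ 2 - y : ℝ) : ℂ))).im = Real.pi / 2 := by
      rw [Complex.log_im, show -Complex.I * (((P 0).re ^ 2 - y : ℝ) : ℂ) =
        ((y - (P 0).re ^ 2 : ℝ) : ℂ) * Complex.I by push_cast; ring,
        Complex.arg_real_mul _ (sub_pos.mpr hP.sq_start), Complex.arg_I]
    have h2 : (Complex.log (-Complex.I * (((P n).re ^ 2 - y : ℝ) : ℂ))).im = -(Real.pi / 2) := by
      rw [Complex.log_im, mul_comm, Complex.arg_real_mul _ (sub_pos.mpr hP.sq_end),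
        Complex.arg_neg_I]
    have h3 := im_primitive_sub_eq_zero (c := c) hP.re_start hP.re_end hΦ hkd.continuousOn ?_
    · rw [hre 0 hP.im_start, hre n hP.im_end, e1, e1]
      rw [Complex.sub_im] at h3 ⊢
      rw [Complex.add_im, Complex.add_im, Complex.im_ofReal_mul, Complex.im_ofReal_mul, h1, h2]
      linarith
    · intro t ht htc
      have htc' : (t : ℂ) ≠ c := by exact_mod_cast htc
      simp only [hk]
      rw [dslope_of_ne _ htc', slope_def_field, hg t ht, hHc,
        show ((g (t ^ 2) : ℂ) - g y) / ((t : ℂ) - c) * (2 * t / (t + c)) =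
          (((g (t ^ 2) - g y) / (t - c) * (2 * t / (t + c)) : ℝ) : ℂ) by push_cast; rfl,
        Complex.ofReal_im]
  · intro ζ hζ
    have h1 : HasDerivAt (fun ζ : ℂ => -Complex.I * (ζ ^ 2 - y)) (-Complex.I * (2 * ζ)) ζ := by
      have := (((hasDerivAt_id ζ).pow 2).sub_const (y : ℂ)).const_mul (-Complex.I)
      simpa using this
    have h2 := (hΦ ζ hζ.1).add ((h1.clog (hslit ζ hζ)).const_mul (g y : ℂ))
    refine h2.congr_deriv ?_
    have hn := quadrantMinus_sub_ne_zero hζ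
    have hζc : ζ - c ≠ 0 := by
      intro h0
      apply hn
      rw [sub_eq_zero.mp h0, ← hcy]; push_cast; ring
    have hζc' : ζ + c ≠ 0 := hne ζ hζ.1
    have hfac : ζ ^ 2 - (y : ℂ) = (ζ - c) * (ζ + c) := by rw [← hcy]; push_cast; ring
    simp only [hk]
    rw [dslope_of_ne _ (sub_ne_zero.mp hζc), slope_def_field, hHc,
      mul_div_mul_left _ _ (neg_ne_zero.mpr Complex.I_ne_zero), hfac]
    field_simp
    ring
  · refine ContinuousOn.div ?_ (by fun_prop) fun ζ hζ => quadrantMinus_sub_ne_zero hζ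
    exact (hH.continuousOn.mono fun ζ hζ => hζ.1).mul (by fun_prop)

/-- Integration by parts lowers the order of the pole. The function K = H'/(2ζ) is the derivative of
H in the variable ζ², and the boundary terms are real. -/
theorem IsQuadrantPath.im_integral_pow (i : ℕ) : ∀ {H : ℂ → ℂ}
    (_ : DifferentiableOn ℂ H {ζ | 0 < ζ.re}) {g : ℕ → ℝ → ℝ}
    (_ : ∀ i, ∀ y : ℝ, 0 < y → HasDerivAt (g i) (g (i + 1) y) y)
    (_ : ∀ z : ℝ, 0 < z → H z = (g 0 (z ^ 2) : ℂ)),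
    (pathIntegral (fun ζ => H ζ * (2 * ζ) / (ζ ^ 2 - y) ^ (i + 1)) P n).im =
      -Real.pi * (g i y / i.factorial) := by
  have hU : IsOpen {ζ : ℂ | 0 < ζ.re} := isOpen_lt continuous_const Complex.continuous_re
  induction i with
  | zero =>
    intro H hH g _ hg
    simpa using hP.im_integral_simple hH hg
  | succ i ih =>
    intro H hH g hgd hg
    set K : ℂ → ℂ := fun ζ => deriv H ζ / (2 * ζ) with hK
    have hne : ∀ ζ ∈ {ζ : ℂ | 0 < ζ.re}, 2 * ζ ≠ 0 := by
      rintro ζ hζ h0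
      have : ζ = 0 := by simpa using h0
      rw [this] at hζ
      simp at hζ
    have hKd : DifferentiableOn ℂ K {ζ | 0 < ζ.re} :=
      (hH.deriv hU).div (by fun_prop) hne
    have hHd : ∀ ζ : ℂ, 0 < ζ.re → HasDerivAt H (deriv H ζ) ζ := fun ζ hζ =>
      (hH.differentiableAt (hU.mem_nhds hζ)).hasDerivAt
    have hKg : ∀ z : ℝ, 0 < z → K z = (g 1 (z ^ 2) : ℂ) := by
      intro z hz
      have h1 : HasDerivAt (fun t : ℝ => H t) (deriv H z) z :=
        (hHd z (by simpa using hz)).comp_ofReal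
      have h2 : HasDerivAt (fun t : ℝ => g 0 (t ^ 2)) (g 1 (z ^ 2) * (2 * z)) z := by
        exact ((hgd 0 (z ^ 2) (by positivity)).comp z (hasDerivAt_pow 2 z)).congr_deriv (by simp)
      have h3 : HasDerivAt (fun t : ℝ => H t) ((g 1 (z ^ 2) * (2 * z) : ℝ) : ℂ) z := by
        refine h2.ofReal_comp.congr_of_eventuallyEq ?_
        filter_upwards [Ioi_mem_nhds hz] with t ht using hg t ht
      simp only [hK]
      rw [h1.unique h3]
      have hz' : (z : ℂ) ≠ 0 := by exact_mod_cast hz.ne'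
      push_cast
      field_simp
    have hi := ih hKd (g := fun i => g (i + 1)) (fun i => hgd (i + 1)) hKg
    have hsub : {ζ : ℂ | 0 < ζ.re} ⊇ quadrantMinus y := fun ζ hζ => hζ.1
    have hpne : ∀ m : ℕ, ∀ ζ ∈ quadrantMinus y, (ζ ^ 2 - (y : ℂ)) ^ m ≠ 0 := fun m ζ hζ =>
      pow_ne_zero _ (quadrantMinus_sub_ne_zero hζ)
    have hc1 : ContinuousOn (fun ζ => K ζ * (2 * ζ) / (ζ ^ 2 - (y : ℂ)) ^ (i + 1))
        (quadrantMinus y) :=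
      ((hKd.continuousOn.mono hsub).mul (by fun_prop)).div (by fun_prop) (hpne _)
    have hc2 : ContinuousOn (fun ζ => ((i : ℂ) + 1) *
        (H ζ * (2 * ζ) / (ζ ^ 2 - (y : ℂ)) ^ (i + 1 + 1))) (quadrantMinus y) :=
      continuousOn_const.mul
        (((hH.continuousOn.mono hsub).mul (by fun_prop)).div (by fun_prop) (hpne _))
    have hFTC := hP.integral_eq_sub (F := fun ζ => H ζ / (ζ ^ 2 - (y : ℂ)) ^ (i + 1))
      (f := fun ζ => K ζ * (2 * ζ) / (ζ ^ 2 - (y : ℂ)) ^ (i + 1) - ((i : ℂ) + 1) *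
        (H ζ * (2 * ζ) / (ζ ^ 2 - (y : ℂ)) ^ (i + 1 + 1))) ?_ (hc1.sub hc2)
    · rw [hP.integral_sub hc1 hc2, pathIntegral_const_mul] at hFTC
      have hreal : ∀ m, (P m).im = 0 → 0 < (P m).re →
          (H (P m) / (P m ^ 2 - (y : ℂ)) ^ (i + 1)).im = 0 := by
        intro m h0 h1
        have : P m = ((P m).re : ℂ) := Complex.ext (by simp) (by simpa using h0)
        rw [this, hg _ h1, ← Complex.ofReal_pow, ← Complex.ofReal_sub, ← Complex.ofReal_pow,
          ← Complex.ofReal_div, Complex.ofReal_im]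
      have h1 := congrArg Complex.im hFTC
      have e : ((i : ℂ) + 1) = (((i : ℝ) + 1 : ℝ) : ℂ) := by push_cast; rfl
      rw [Complex.sub_im, Complex.sub_im, hreal n hP.im_end hP.re_end,
        hreal 0 hP.im_start hP.re_start, hi, e, Complex.im_ofReal_mul] at h1
      rw [Nat.factorial_succ]
      push_cast
      field_simp
      field_simp at h1
      linarith
    · intro ζ hζ
      have hn := quadrantMinus_sub_ne_zero hζ
      have h1 : HasDerivAt (fun ζ : ℂ => (ζ ^ 2 - (y : ℂ)) ^ (i + 1))
          (((i : ℂ) + 1) * (ζ ^ 2 - y) ^ i * (2 * ζ)) ζ := by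
        exact ((((hasDerivAt_id ζ).pow 2).sub_const (y : ℂ)).pow (i + 1)).congr_deriv (by simp)
      refine ((hHd ζ hζ.1).div h1 (hpne _ ζ hζ)).congr_deriv ?_
      have hz : ζ ≠ 0 := by
        rintro rfl
        have := hζ.1
        simp at this
      simp only [hK]
      field_simp
      ring

/-- Binomial expansion of ζ² = y + (ζ²-y). -/
theorem IsQuadrantPath.im_integral_mul_pow (j : ℕ) {H : ℂ → ℂ}
    (hH : DifferentiableOn ℂ H {ζ | 0 < ζ.re}) {g : ℕ → ℝ → ℝ}
    (hgd : ∀ i, ∀ y : ℝ, 0 < y → HasDerivAt (g i) (g (i + 1) y) y)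
    (hg : ∀ z : ℝ, 0 < z → H z = (g 0 (z ^ 2) : ℂ)) :
    (pathIntegral (fun ζ => H ζ * (2 * ζ) * ((ζ ^ 2) ^ j / (ζ ^ 2 - y) ^ (j + 1))) P n).im =
      -Real.pi * ∑ i ∈ Finset.range (j + 1), j.choose i * y ^ i * (g i y / i.factorial) := by
  have hsub : {ζ : ℂ | 0 < ζ.re} ⊇ quadrantMinus y := fun ζ hζ => hζ.1
  have hpne : ∀ m : ℕ, ∀ ζ ∈ quadrantMinus y, (ζ ^ 2 - (y : ℂ)) ^ m ≠ 0 := fun m ζ hζ =>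
    pow_ne_zero _ (quadrantMinus_sub_ne_zero hζ)
  have hc : ∀ i ∈ Finset.range (j + 1), ContinuousOn (fun ζ => (((j.choose i * y ^ i : ℝ)) : ℂ) *
      (H ζ * (2 * ζ) / (ζ ^ 2 - (y : ℂ)) ^ (i + 1))) (quadrantMinus y) := fun i _ =>
    continuousOn_const.mul
      (((hH.continuousOn.mono hsub).mul (by fun_prop)).div (by fun_prop) (hpne _))
  have h1 : pathIntegral (fun ζ => H ζ * (2 * ζ) * ((ζ ^ 2) ^ j / (ζ ^ 2 - y) ^ (j + 1))) P n =
      pathIntegral (fun ζ => ∑ i ∈ Finset.range (j + 1), (((j.choose i * y ^ i : ℝ)) : ℂ) *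
        (H ζ * (2 * ζ) / (ζ ^ 2 - (y : ℂ)) ^ (i + 1))) P n := by
    refine Finset.sum_congr rfl fun m hm => ?_
    refine intervalIntegral.integral_congr fun t ht => ?_
    rw [Set.uIcc_of_le zero_le_one] at ht
    have hζ := hP.mem m (Finset.mem_range.mp hm) t ht
    simp only
    set ζ := segPoint (P m) (P (m + 1)) t
    have hn := quadrantMinus_sub_ne_zero hζ
    congr 1
    have hb : (ζ ^ 2) ^ j = ∑ i ∈ Finset.range (j + 1),
        (j.choose i * y ^ i : ℂ) * (ζ ^ 2 - y) ^ (j - i) := by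
      conv_lhs => rw [show ζ ^ 2 = (y : ℂ) + (ζ ^ 2 - y) by ring]
      rw [add_pow]
      exact Finset.sum_congr rfl fun i _ => by ring
    rw [hb, Finset.sum_div, Finset.mul_sum]
    refine Finset.sum_congr rfl fun i hi => ?_
    rw [Finset.mem_range] at hi
    obtain ⟨d, rfl⟩ := Nat.exists_eq_add_of_le (Nat.lt_succ_iff.mp hi)
    rw [Nat.add_sub_cancel_left]
    push_cast
    field_simp
    ring
  rw [h1, hP.integral_sum _ hc, Complex.im_sum, Finset.mul_sum]
  refine Finset.sum_congr rfl fun i _ => ?_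
  rw [pathIntegral_const_mul, Complex.im_ofReal_mul, hP.im_integral_pow i hH hgd hg]
  ring

/-- Up to scaling, `kernelRight j` is the j-th derivative of y^j g(y) divided by j!, where g is the
Bessel moment of order zero. The path integral is the upper half of the Cauchy integral for it. -/
theorem IsQuadrantPath.kernelRight_eq (j : ℕ) {N : ℝ} (hN : 0 < N) :
    kernelRight j (N ^ 2 * y) = -Real.pi⁻¹ * (pathIntegral (fun ζ => macdonald (N * ζ) * (2 * ζ) *
      ((ζ ^ 2) ^ j / (ζ ^ 2 - y) ^ (j + 1))) P n).im := by
  have hy : 0 < y := lt_of_le_of_lt (sq_nonneg _) hP.sq_start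
  rw [hP.im_integral_mul_pow j (H := fun ζ => macdonald (N * ζ))
    (g := fun i y => (N ^ 2) ^ i * besselDeriv i (N ^ 2 * y))]
  · rw [← mul_assoc, neg_mul_neg, inv_mul_cancel₀ Real.pi_ne_zero, one_mul, kernelRight]
    refine Finset.sum_congr rfl fun i _ => ?_
    rw [besselMoment_eq_besselDeriv i (by positivity), ← neg_one_mul (N ^ 2 * y), mul_pow, mul_pow]
    have hs : ((-1 : ℝ) ^ i) * (-1) ^ i = 1 := by rw [← mul_pow]; simp
    linear_combination (j.choose i / i.factorial * ((N ^ 2) ^ i * y ^ i) *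
      besselDeriv i (N ^ 2 * y)) * hs
  · refine differentiableOn_macdonald.comp (by fun_prop) fun ζ hζ => ?_
    have hζ' : 0 < ζ.re := hζ
    show 0 < ((N : ℂ) * ζ).re
    rw [Complex.re_ofReal_mul]
    positivity
  · intro i w hw
    have h1 := hasDerivAt_besselDeriv i (y := N ^ 2 * w) (by positivity)
    have h2 : HasDerivAt (fun w : ℝ => N ^ 2 * w) (N ^ 2) w := by
      simpa using (hasDerivAt_id w).const_mul (N ^ 2)
    refine ((h1.comp w h2).const_mul ((N ^ 2) ^ i)).congr_deriv ?_
    ring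
  · intro z hz
    rw [← Complex.ofReal_mul, macdonald_ofReal (by positivity), mul_pow]
    simp

omit hP in
theorem continuousOn_macdonald_mul {N : ℝ} (hN : 0 < N) :
    ContinuousOn (fun ζ : ℂ => macdonald (N * ζ)) (quadrantMinus y) := by
  refine differentiableOn_macdonald.continuousOn.comp (by fun_prop) fun ζ hζ => ?_
  have hζ' : 0 < ζ.re := hζ.1
  show 0 < ((N : ℂ) * ζ).re
  rw [Complex.re_ofReal_mul]
  positivity

/-- The integrand of the contour integral for the scaled kernel. -/
noncomputable def kernelIntegrand (N y : ℝ) (M : ℕ) (ζ : ℂ) : ℂ :=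
  N * macdonald (N * ζ) * (2 * ζ) * ∑ j ∈ Finset.range M,
    (kernelLeft j (N ^ 2 * y) : ℂ) * ((ζ ^ 2) ^ j / (ζ ^ 2 - y) ^ (j + 1))

omit hP in
theorem continuousOn_kernelIntegrand {N : ℝ} (hN : 0 < N) (M : ℕ) :
    ContinuousOn (kernelIntegrand N y M) (quadrantMinus y) := by
  have h1 := continuousOn_macdonald_mul (y := y) hN
  refine ((continuousOn_const.mul h1).mul (by fun_prop)).mul ?_
  refine continuousOn_finsetSum _ fun j _ => continuousOn_const.mul ?_
  exact ContinuousOn.div (by fun_prop) (by fun_prop) fun ζ hζ =>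
    pow_ne_zero _ (quadrantMinus_sub_ne_zero hζ)

theorem IsQuadrantPath.kernel_eq (M : ℕ) {N : ℝ} (hN : 0 < N) :
    N * ∑ j ∈ Finset.range M, kernelRight j (N ^ 2 * y) * kernelLeft j (N ^ 2 * y) =
      -Real.pi⁻¹ * (pathIntegral (kernelIntegrand N y M) P n).im := by
  have h1 := continuousOn_macdonald_mul (y := y) hN
  have e : kernelIntegrand N y M = fun ζ => ∑ j ∈ Finset.range M,
      ((N * kernelLeft j (N ^ 2 * y) : ℝ) : ℂ) * (macdonald (N * ζ) * (2 * ζ) *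
      ((ζ ^ 2) ^ j / (ζ ^ 2 - y) ^ (j + 1))) := by
    ext ζ
    rw [kernelIntegrand, Finset.mul_sum]
    refine Finset.sum_congr rfl fun j _ => ?_
    push_cast
    ring
  have hc : ∀ j ∈ Finset.range M, ContinuousOn (fun ζ : ℂ =>
      ((N * kernelLeft j (N ^ 2 * y) : ℝ) : ℂ) * (macdonald (N * ζ) * (2 * ζ) *
      ((ζ ^ 2) ^ j / (ζ ^ 2 - y) ^ (j + 1)))) (quadrantMinus y) := fun j _ =>
    continuousOn_const.mul ((h1.mul (by fun_prop)).mul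
      (ContinuousOn.div (by fun_prop) (by fun_prop) fun ζ hζ =>
        pow_ne_zero _ (quadrantMinus_sub_ne_zero hζ)))
  rw [e, hP.integral_sum _ hc, Complex.im_sum, Finset.mul_sum, Finset.mul_sum]
  refine Finset.sum_congr rfl fun j _ => ?_
  rw [pathIntegral_const_mul, Complex.im_ofReal_mul, hP.kernelRight_eq j hN]
  ring

end QuadrantPath

/-! ### Integrable majorants on the half circle. -/

theorem intervalIntegrable_abs_sub_rpow {r : ℝ} (hr : -1 < r) (c a b : ℝ) :
    IntervalIntegrable (fun x : ℝ => |x - c| ^ r) volume a b := by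
  have h0 : ∀ d : ℝ, 0 ≤ d → IntervalIntegrable (fun x : ℝ => |x| ^ r) volume 0 d := by
    intro d hd
    refine (intervalIntegral.intervalIntegrable_rpow' hr (a := 0) (b := d)).congr ?_
    intro x hx
    rw [Set.uIoc_of_le hd] at hx
    simp only
    rw [abs_of_pos hx.1]
  have h1 : ∀ d : ℝ, IntervalIntegrable (fun x : ℝ => |x| ^ r) volume 0 d := by
    intro d
    rcases le_total 0 d with hd | hd
    · exact h0 d hd
    · have := (h0 (-d) (by linarith)).comp_sub_left 0
      simpa using this
  have h2 : IntervalIntegrable (fun x : ℝ => |x| ^ r) volume (a - c) (b - c) :=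
    (h1 _).symm.trans (h1 _)
  simpa using h2.comp_sub_right c

/-- Replacing the larger base by the smaller one decouples two singularities; the exponent -3/4 is
still integrable. -/
theorem rpow_mul_rpow_le_add {a b : ℝ} (ha : 0 < a) (hb : 0 < b) :
    a ^ (-(1 / 2) : ℝ) * b ^ (-(1 / 4) : ℝ) ≤ a ^ (-(3 / 4) : ℝ) + b ^ (-(3 / 4) : ℝ) := by
  rcases le_total a b with h | h
  · have h1 : b ^ (-(1 / 4) : ℝ) ≤ a ^ (-(1 / 4) : ℝ) :=
      Real.rpow_le_rpow_of_nonpos ha h (by norm_num)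
    calc a ^ (-(1 / 2) : ℝ) * b ^ (-(1 / 4) : ℝ) ≤ a ^ (-(1 / 2) : ℝ) * a ^ (-(1 / 4) : ℝ) := by
          gcongr
      _ = a ^ (-(3 / 4) : ℝ) := by rw [← Real.rpow_add ha]; norm_num
      _ ≤ _ := le_add_of_nonneg_right (by positivity)
  · have h1 : a ^ (-(1 / 2) : ℝ) ≤ b ^ (-(1 / 2) : ℝ) :=
      Real.rpow_le_rpow_of_nonpos hb h (by norm_num)
    calc a ^ (-(1 / 2) : ℝ) * b ^ (-(1 / 4) : ℝ) ≤ b ^ (-(1 / 2) : ℝ) * b ^ (-(1 / 4) : ℝ) := by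
          gcongr
      _ = b ^ (-(3 / 4) : ℝ) := by rw [← Real.rpow_add hb]; norm_num
      _ ≤ _ := le_add_of_nonneg_left (by positivity)

/-- An integrable majorant on the half circle, singular at its ends and at `θ₀`. -/
noncomputable def circleMajorant (θ₀ θ : ℝ) : ℝ :=
  2 * (|θ - Real.pi / 2| ^ (-(3 / 4) : ℝ) + |θ - -(Real.pi / 2)| ^ (-(3 / 4) : ℝ)) +
    |θ - θ₀| ^ (-(3 / 4) : ℝ)

theorem intervalIntegrable_circleMajorant (θ₀ a b : ℝ) :
    IntervalIntegrable (circleMajorant θ₀) volume a b :=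
  (((intervalIntegrable_abs_sub_rpow (by norm_num) _ a b).add
    (intervalIntegrable_abs_sub_rpow (by norm_num) _ a b)).const_mul 2).add
    (intervalIntegrable_abs_sub_rpow (by norm_num) _ a b)

theorem cos_rpow_mul_rpow_le {θ θ₀ : ℝ} (hθ : θ ∈ Set.Ioo (-(Real.pi / 2)) (Real.pi / 2))
    (hne : θ ≠ θ₀) :
    Real.cos θ ^ (-(1 / 2) : ℝ) * |θ - θ₀| ^ (-(1 / 4) : ℝ) ≤ circleMajorant θ₀ θ := by
  have hpi := Real.pi_pos
  have hcos := Real.cos_pos_of_mem_Ioo hθ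
  refine (rpow_mul_rpow_le_add hcos (abs_pos.mpr (sub_ne_zero.mpr hne))).trans ?_
  refine add_le_add ?_ le_rfl
  have key : ∀ u : ℝ, 0 < u → 2 / Real.pi * u ≤ Real.cos θ →
      Real.cos θ ^ (-(3 / 4) : ℝ) ≤ 2 * u ^ (-(3 / 4) : ℝ) := by
    intro u hu hle
    have h1 : u / 2 ≤ Real.cos θ := by
      refine le_trans ?_ hle
      rw [div_mul_eq_mul_div, div_le_div_iff₀ two_pos hpi]
      nlinarith [Real.pi_le_four]
    calc Real.cos θ ^ (-(3 / 4) : ℝ) ≤ (u / 2) ^ (-(3 / 4) : ℝ) :=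
          Real.rpow_le_rpow_of_nonpos (by positivity) h1 (by norm_num)
      _ = 2 ^ (3 / 4 : ℝ) * u ^ (-(3 / 4) : ℝ) := by
          rw [Real.div_rpow hu.le zero_le_two, Real.rpow_neg zero_le_two]
          field_simp
      _ ≤ 2 ^ (1 : ℝ) * u ^ (-(3 / 4) : ℝ) := by
          gcongr <;> norm_num
      _ = _ := by rw [Real.rpow_one]
  rcases le_total 0 θ with h | h
  · have h2 := Real.one_sub_mul_le_cos h hθ.2.le
    have h3 := key (Real.pi / 2 - θ) (by linarith [hθ.2]) (by
      refine le_trans (le_of_eq ?_) h2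
      field_simp)
    rw [abs_sub_comm, abs_of_pos (by linarith [hθ.2] : 0 < Real.pi / 2 - θ)]
    have : 0 ≤ |θ - -(Real.pi / 2)| ^ (-(3 / 4) : ℝ) := by positivity
    linarith
  · have h2 := Real.one_sub_mul_le_cos (x := -θ) (by linarith) (by linarith [hθ.1])
    rw [Real.cos_neg] at h2
    have h3 := key (θ - -(Real.pi / 2)) (by linarith [hθ.1]) (by
      refine le_trans (le_of_eq ?_) h2
      field_simp
      ring)
    rw [abs_of_pos (by linarith [hθ.1] : 0 < θ - -(Real.pi / 2))]
    have : 0 ≤ |θ - Real.pi / 2| ^ (-(3 / 4) : ℝ) := by positivity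
    linarith

/-- A chord has length 2ρ |sin((θ-θ₀)/2)|, bounded below by |sin x| ≥ 2|x|/π and π ≤ 4. -/
theorem norm_polarPoint_sub_ge {ρ θ θ₀ : ℝ} (hρ : 0 < ρ)
    (hθ : θ ∈ Set.Ioo (-(Real.pi / 2)) (Real.pi / 2))
    (hθ₀ : θ₀ ∈ Set.Ioo (-(Real.pi / 2)) (Real.pi / 2)) :
    ρ * (|θ - θ₀| / 2) ≤ ‖polarPoint ρ θ - polarPoint ρ θ₀‖ := by
  have hpi := Real.pi_pos
  have h1 : polarPoint ρ θ - polarPoint ρ θ₀ = ρ * Complex.exp (((θ + θ₀) / 2 : ℝ) * Complex.I) *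
      (2 * Complex.I * (Real.sin ((θ - θ₀) / 2) : ℂ)) := by
    rw [Complex.ofReal_sin, Complex.sin, polarPoint, polarPoint]
    have e1 : (θ : ℂ) * Complex.I = ((θ + θ₀) / 2 : ℝ) * Complex.I +
        ((θ - θ₀) / 2 : ℝ) * Complex.I := by push_cast; ring
    have e2 : (θ₀ : ℂ) * Complex.I = ((θ + θ₀) / 2 : ℝ) * Complex.I +
        -((θ - θ₀) / 2 : ℝ) * Complex.I := by push_cast; ring
    rw [e1, e2, Complex.exp_add, Complex.exp_add]
    have hI := Complex.I_sq
    linear_combination (ρ * Complex.exp (((θ + θ₀) / 2 : ℝ) * Complex.I) *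
      (Complex.exp (((θ - θ₀) / 2 : ℝ) * Complex.I) -
        Complex.exp (-((θ - θ₀) / 2 : ℝ) * Complex.I))) * hI
  have h2 : |(θ - θ₀) / 2| ≤ Real.pi / 2 := by
    rw [abs_le]
    constructor <;> linarith [hθ.1, hθ.2, hθ₀.1, hθ₀.2]
  have h3 := Real.mul_abs_le_abs_sin h2
  rw [h1, norm_mul, norm_mul, norm_mul, norm_mul, Complex.norm_exp_ofReal_mul_I, Complex.norm_I,
    Complex.norm_real, Complex.norm_real, Real.norm_of_nonneg hρ.le, Real.norm_eq_abs]
  simp only [mul_one, Complex.norm_ofNat]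
  refine mul_le_mul_of_nonneg_left ?_ hρ.le
  refine le_trans ?_ (mul_le_mul_of_nonneg_left h3 zero_le_two)
  rw [abs_div, abs_two]
  have h4 : 1 / 4 ≤ 1 / Real.pi := one_div_le_one_div_of_le hpi Real.pi_le_four
  have h5 : 2 * (2 / Real.pi * (|θ - θ₀| / 2)) = 2 * (1 / Real.pi) * |θ - θ₀| := by ring
  rw [h5]
  nlinarith [abs_nonneg (θ - θ₀)]

/-- The distance u = |z-ζ| is at least the distance of ζ from the circle and, as ζ approaches the
circle non-tangentially at angle θ₀, also at least a multiple of |θ-θ₀|. Writing 1/u = u^{-3/4}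
u^{-1/4} charges the first factor to the path and the second to the angle, and both are integrable.
-/
theorem inv_norm_sq_sub_sq_le {ρ θ θ₀ C D : ℝ} (hρ : 0 < ρ) (hC : 0 ≤ C) (hD : 0 < D)
    (hθ : θ ∈ Set.Ioo (-(Real.pi / 2)) (Real.pi / 2))
    (hθ₀ : θ₀ ∈ Set.Ioo (-(Real.pi / 2)) (Real.pi / 2)) (hne : θ ≠ θ₀) {ζ : ℂ} (hζ : 0 < ζ.re)
    (h1 : D ≤ |‖ζ‖ - ρ|) (h2 : ‖ζ - polarPoint ρ θ₀‖ ≤ C * |‖ζ‖ - ρ|) :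
    ‖polarPoint ρ θ ^ 2 - ζ ^ 2‖⁻¹ ≤
      ζ.re⁻¹ * D ^ (-(3 / 4) : ℝ) * (ρ / (2 * (1 + C))) ^ (-(1 / 4) : ℝ) *
        |θ - θ₀| ^ (-(1 / 4) : ℝ) := by
  set z := polarPoint ρ θ with hz
  set u := ‖z - ζ‖ with hu
  have habs : |‖ζ‖ - ρ| ≤ u := by
    have := abs_norm_sub_norm_le ζ z
    rwa [norm_polarPoint hρ.le, norm_sub_rev] at this
  have hu1 : D ≤ u := h1.trans habs
  have hu0 : 0 < u := hD.trans_le hu1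
  have hτ : 0 < |θ - θ₀| := abs_pos.mpr (sub_ne_zero.mpr hne)
  have hu2 : ρ / (2 * (1 + C)) * |θ - θ₀| ≤ u := by
    have h3 := norm_polarPoint_sub_ge hρ hθ hθ₀
    have h4 : ‖z - polarPoint ρ θ₀‖ ≤ u + C * u := by
      calc ‖z - polarPoint ρ θ₀‖ = ‖(z - ζ) + (ζ - polarPoint ρ θ₀)‖ := by congr 1; ring
        _ ≤ u + ‖ζ - polarPoint ρ θ₀‖ := norm_add_le _ _
        _ ≤ u + C * u := by gcongr; exact h2.trans (mul_le_mul_of_nonneg_left habs hC)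
    rw [div_mul_eq_mul_div, div_le_iff₀ (by positivity)]
    nlinarith
  have h5 : ζ.re ≤ ‖z + ζ‖ := by
    have hre : 0 < z.re := by
      rw [hz, polarPoint_re]; exact mul_pos hρ (Real.cos_pos_of_mem_Ioo hθ)
    refine le_trans ?_ (Complex.re_le_norm _)
    rw [Complex.add_re]
    linarith
  have h6 : ζ.re * u ≤ ‖z ^ 2 - ζ ^ 2‖ := by
    rw [show z ^ 2 - ζ ^ 2 = (z + ζ) * (z - ζ) by ring, norm_mul]
    gcongr
  have h7 : u⁻¹ = u ^ (-(3 / 4) : ℝ) * u ^ (-(1 / 4) : ℝ) := by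
    rw [← Real.rpow_add hu0, ← Real.rpow_neg_one]; norm_num
  calc ‖z ^ 2 - ζ ^ 2‖⁻¹ ≤ (ζ.re * u)⁻¹ := inv_anti₀ (by positivity) h6
    _ = ζ.re⁻¹ * (u ^ (-(3 / 4) : ℝ) * u ^ (-(1 / 4) : ℝ)) := by rw [mul_inv, h7]
    _ ≤ ζ.re⁻¹ * (D ^ (-(3 / 4) : ℝ) * (ρ / (2 * (1 + C)) * |θ - θ₀|) ^ (-(1 / 4) : ℝ)) := by
        have e1 := Real.rpow_le_rpow_of_nonpos hD hu1 (by norm_num : (-(3 / 4) : ℝ) ≤ 0)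
        have e2 := Real.rpow_le_rpow_of_nonpos (by positivity) hu2
          (by norm_num : (-(1 / 4) : ℝ) ≤ 0)
        gcongr
    _ = _ := by rw [Real.mul_rpow (by positivity) hτ.le]; ring

/-- Geometric summation of the integrand of the kernel. -/
theorem kernelIntegrand_eq {ρ y : ℝ} (hρ : 0 < ρ) (hy : 0 < y) (N : ℝ) (M : ℕ) {ζ : ℂ}
    (hζ : ζ ∈ quadrantMinus y) (hζρ : ‖ζ‖ ≠ ρ) :
    kernelIntegrand N y M ζ = N * macdonald (N * ζ) * (2 * ζ) * ((y : ℂ)⁻¹ *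
      (halfAvg (fun θ => besselSeries (N * polarPoint ρ θ) *
        (((1 - y / polarPoint ρ θ ^ 2) / (1 - y / ζ ^ 2)) ^ M *
          (polarPoint ρ θ ^ 2 / (polarPoint ρ θ ^ 2 - ζ ^ 2)))) -
        if ‖ζ‖ < ρ then besselSeries (N * ζ) else 0)) := by
  have hζ0 : ζ ≠ 0 := by
    rintro rfl
    have := hζ.1
    simp at this
  have hy0 : (y : ℂ) ≠ 0 := by exact_mod_cast hy.ne'
  have hn := quadrantMinus_sub_ne_zero hζ
  have hzne : ∀ θ, polarPoint ρ θ ^ 2 - ζ ^ 2 ≠ 0 := by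
    intro θ h0
    apply hζρ
    have := congrArg norm (sub_eq_zero.mp h0)
    rw [norm_pow, norm_pow, norm_polarPoint hρ.le] at this
    exact ((sq_eq_sq₀ hρ.le (norm_nonneg _)).mp this).symm
  have hcB := continuous_besselSeries_polarPoint N ρ
  have hcz := continuous_polarPoint ρ
  have hz2 : ∀ θ, polarPoint ρ θ ^ 2 ≠ 0 := fun θ => pow_ne_zero 2 (polarPoint_ne_zero hρ θ)
  have hcx : Continuous fun θ => 1 - y / polarPoint ρ θ ^ 2 :=
    continuous_const.sub (continuous_const.div (hcz.pow 2) hz2)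
  have hcq : Continuous fun θ => polarPoint ρ θ ^ 2 / (polarPoint ρ θ ^ 2 - ζ ^ 2) :=
    (hcz.pow 2).div ((hcz.pow 2).sub continuous_const) hzne
  rw [kernelIntegrand, ← halfAvg_besselSeries_cauchy hρ N hζ0 hζρ]
  congr 1
  have h1 : ∑ j ∈ Finset.range M, (kernelLeft j (N ^ 2 * y) : ℂ) *
      ((ζ ^ 2) ^ j / (ζ ^ 2 - y) ^ (j + 1)) =
      halfAvg (fun θ => ∑ j ∈ Finset.range M, ((ζ ^ 2) ^ j / (ζ ^ 2 - y) ^ (j + 1)) *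
        (besselSeries (N * polarPoint ρ θ) * (1 - y / polarPoint ρ θ ^ 2) ^ j)) := by
    have hc : ∀ j ∈ Finset.range M, Continuous fun θ => ((ζ ^ 2) ^ j / (ζ ^ 2 - y) ^ (j + 1)) *
        (besselSeries (N * polarPoint ρ θ) * (1 - y / polarPoint ρ θ ^ 2) ^ j) := fun j _ =>
      continuous_const.mul (hcB.mul (hcx.pow j))
    rw [halfAvg_sum _ hc]
    refine Finset.sum_congr rfl fun j _ => ?_
    rw [halfAvg_const_mul, halfAvg_besselSeries_eq_kernelLeft hρ, mul_comm]
  have h2 : ∀ f g : ℝ → ℂ, Continuous f → Continuous g →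
      halfAvg f - halfAvg g = halfAvg fun θ => f θ - g θ := by
    intro f g hf hg
    rw [halfAvg, halfAvg, halfAvg, intervalIntegral.integral_sub (hf.intervalIntegrable _ _)
      (hg.intervalIntegrable _ _), mul_sub]
  have hc1 : Continuous fun θ => besselSeries (N * polarPoint ρ θ) *
      (((1 - y / polarPoint ρ θ ^ 2) / (1 - y / ζ ^ 2)) ^ M *
        (polarPoint ρ θ ^ 2 / (polarPoint ρ θ ^ 2 - ζ ^ 2))) :=
    hcB.mul (((hcx.div_const _).pow M).mul hcq)
  rw [h1, h2 _ (fun θ => besselSeries (N * polarPoint ρ θ) *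
    (polarPoint ρ θ ^ 2 / (polarPoint ρ θ ^ 2 - ζ ^ 2))) hc1 (hcB.mul hcq), ← halfAvg_const_mul]
  congr 1
  ext θ
  have hzθ := hzne θ
  have hz0 := polarPoint_ne_zero hρ θ
  set z := polarPoint ρ θ
  -- The ratio of the geometric series over j. Dividing by ξ - 1 produces z²/(z²-ζ²); the -1 in ξ^M
  -- - 1 is the term that Cauchy's formula evaluates.
  set ξ := (1 - y / z ^ 2) / (1 - y / ζ ^ 2) with hξ
  have hξ' : ξ = (1 - y / z ^ 2) * (ζ ^ 2 / (ζ ^ 2 - y)) := by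
    rw [hξ, div_eq_mul_inv, show 1 - (y : ℂ) / ζ ^ 2 = (ζ ^ 2 - y) / ζ ^ 2 by field_simp, inv_div]
  have hξ1 : ξ - 1 = y * (z ^ 2 - ζ ^ 2) / (z ^ 2 * (ζ ^ 2 - y)) := by
    rw [hξ']; field_simp; ring
  have hξ0 : ξ - 1 ≠ 0 := by
    rw [hξ1]
    exact div_ne_zero (mul_ne_zero hy0 hzθ) (mul_ne_zero (pow_ne_zero 2 hz0) hn)
  have h3 : ∑ j ∈ Finset.range M, ((ζ ^ 2) ^ j / (ζ ^ 2 - y) ^ (j + 1)) *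
      (besselSeries (N * z) * (1 - y / z ^ 2) ^ j) =
      besselSeries (N * z) / (ζ ^ 2 - y) * ∑ j ∈ Finset.range M, ξ ^ j := by
    rw [Finset.mul_sum]
    refine Finset.sum_congr rfl fun j _ => ?_
    rw [hξ', mul_pow, div_pow, pow_succ]
    field_simp
    ring
  rw [h3, geom_sum_eq (sub_ne_zero.mp hξ0), hξ1]
  field_simp

/-! ### The limit along one segment of the path. -/

/-- The growth rate `exp (2 Re ζ) |1 - y / ζ²|`, compared on the circle and on the path. -/
noncomputable def growthRate (y : ℝ) (ζ : ℂ) : ℝ := Real.exp (2 * ζ.re) * ‖1 - y / ζ ^ 2‖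

theorem inv_sqrt_eq_rpow {x : ℝ} (hx : 0 ≤ x) : (Real.sqrt x)⁻¹ = x ^ (-(1 / 2) : ℝ) := by
  rw [Real.sqrt_eq_rpow, ← Real.rpow_neg hx]

/-- The exponential in the Bessel bound and |1-y/z²|^N combine into the N-th power of the growth
rate on the circle. The root in that bound and the kernel 1/|z²-ζ²| are absorbed by
`circleMajorant`. -/
theorem norm_halfAvg_remainder_le {ρ θ₀ C D y M₀ : ℝ} (hρ : 0 < ρ) (hC : 0 ≤ C) (hD : 0 < D)
    (hθ₀ : θ₀ ∈ Set.Ioo (-(Real.pi / 2)) (Real.pi / 2)) (hM₀ : 0 ≤ M₀)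
    (hcirc : ∀ θ ∈ Set.Ioo (-(Real.pi / 2)) (Real.pi / 2), growthRate y (polarPoint ρ θ) ≤ M₀)
    {N : ℕ} (hN : 0 < N) {ζ : ℂ} (hζ : 0 < ζ.re) (h1 : D ≤ |‖ζ‖ - ρ|)
    (h2 : ‖ζ - polarPoint ρ θ₀‖ ≤ C * |‖ζ‖ - ρ|) :
    ‖halfAvg (fun θ => besselSeries (((N : ℝ) : ℂ) * polarPoint ρ θ) *
        (((1 - y / polarPoint ρ θ ^ 2) / (1 - y / ζ ^ 2)) ^ N *
          (polarPoint ρ θ ^ 2 / (polarPoint ρ θ ^ 2 - ζ ^ 2))))‖ ≤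
      (M₀ / ‖1 - y / ζ ^ 2‖) ^ N * (Real.sqrt N)⁻¹ * (ζ.re⁻¹ * D ^ (-(3 / 4) : ℝ)) *
        (Real.pi⁻¹ * ((Real.sqrt ρ)⁻¹ * ρ ^ 2 * (ρ / (2 * (1 + C))) ^ (-(1 / 4) : ℝ)) *
          ∫ θ in (-(Real.pi / 2))..(Real.pi / 2), circleMajorant θ₀ θ) := by
  have hpi := Real.pi_pos
  have hN' : (0 : ℝ) < N := by exact_mod_cast hN
  set L := (M₀ / ‖1 - y / ζ ^ 2‖) ^ N * (Real.sqrt N)⁻¹ * (ζ.re⁻¹ * D ^ (-(3 / 4) : ℝ)) *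
    ((Real.sqrt ρ)⁻¹ * ρ ^ 2 * (ρ / (2 * (1 + C))) ^ (-(1 / 4) : ℝ)) with hL
  have hL0 : 0 ≤ L := by positivity
  rw [halfAvg, norm_mul, norm_inv, Complex.norm_real, Real.norm_of_nonneg hpi.le]
  have key : ‖∫ θ in (-(Real.pi / 2))..(Real.pi / 2),
      besselSeries (((N : ℝ) : ℂ) * polarPoint ρ θ) *
        (((1 - y / polarPoint ρ θ ^ 2) / (1 - y / ζ ^ 2)) ^ N *
          (polarPoint ρ θ ^ 2 / (polarPoint ρ θ ^ 2 - ζ ^ 2)))‖ ≤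
      ∫ θ in (-(Real.pi / 2))..(Real.pi / 2), L * circleMajorant θ₀ θ := by
    refine intervalIntegral.norm_integral_le_of_norm_le (by linarith) ?_
      ((intervalIntegrable_circleMajorant θ₀ _ _).const_mul L)
    have hn1 : ∀ᵐ θ : ℝ ∂volume, θ ≠ θ₀ := by rw [ae_iff]; simp
    have hn2 : ∀ᵐ θ : ℝ ∂volume, θ ≠ Real.pi / 2 := by rw [ae_iff]; simp
    filter_upwards [hn1, hn2] with θ hne hne2 hθ'
    have hθ : θ ∈ Set.Ioo (-(Real.pi / 2)) (Real.pi / 2) := ⟨hθ'.1, lt_of_le_of_ne hθ'.2 hne2⟩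
    have hcos := Real.cos_pos_of_mem_Ioo hθ
    have hzre : (((N : ℝ) : ℂ) * polarPoint ρ θ).re = N * (ρ * Real.cos θ) := by
      rw [Complex.re_ofReal_mul, polarPoint_re]
    have hI := norm_besselSeries_le_of_re_pos (ζ := ((N : ℝ) : ℂ) * polarPoint ρ θ)
      (by rw [hzre]; positivity)
    rw [hzre] at hI
    have hinv := inv_norm_sq_sub_sq_le hρ hC hD hθ hθ₀ hne hζ h1 h2
    have hmaj := cos_rpow_mul_rpow_le hθ hne
    have hc := hcirc θ hθ
    rw [growthRate, polarPoint_re] at hc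
    rw [norm_mul, norm_mul, norm_pow, norm_div, norm_div, norm_pow, norm_polarPoint hρ.le]
    have hexp : Real.exp (2 * (N * (ρ * Real.cos θ))) = Real.exp (2 * (ρ * Real.cos θ)) ^ N := by
      rw [← Real.exp_nat_mul]; congr 1; ring
    have hsq : (Real.sqrt (N * (ρ * Real.cos θ)))⁻¹ =
        (Real.sqrt N)⁻¹ * ((Real.sqrt ρ)⁻¹ * Real.cos θ ^ (-(1 / 2) : ℝ)) := by
      rw [Real.sqrt_mul hN'.le, Real.sqrt_mul hρ.le, mul_inv, mul_inv, inv_sqrt_eq_rpow hcos.le]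
    set E := Real.exp (2 * (ρ * Real.cos θ))
    set A := ‖1 - y / polarPoint ρ θ ^ 2‖
    set B := ‖1 - y / ζ ^ 2‖
    calc ‖besselSeries (((N : ℝ) : ℂ) * polarPoint ρ θ)‖ *
          ((A / B) ^ N * (ρ ^ 2 / ‖polarPoint ρ θ ^ 2 - ζ ^ 2‖))
        ≤ (E ^ N * (Real.sqrt (N * (ρ * Real.cos θ)))⁻¹) *
          ((A / B) ^ N * (ρ ^ 2 * (ζ.re⁻¹ * D ^ (-(3 / 4) : ℝ) *
            (ρ / (2 * (1 + C))) ^ (-(1 / 4) : ℝ) * |θ - θ₀| ^ (-(1 / 4) : ℝ)))) := by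
          rw [hexp, div_eq_mul_inv] at hI
          rw [div_eq_mul_inv (ρ ^ 2)]
          gcongr
      _ = (E * A / B) ^ N * ((Real.sqrt N)⁻¹ * (ζ.re⁻¹ * D ^ (-(3 / 4) : ℝ)) *
          ((Real.sqrt ρ)⁻¹ * ρ ^ 2 * (ρ / (2 * (1 + C))) ^ (-(1 / 4) : ℝ))) *
          (Real.cos θ ^ (-(1 / 2) : ℝ) * |θ - θ₀| ^ (-(1 / 4) : ℝ)) := by
          rw [hsq, mul_div_assoc, mul_pow]; ring
      _ ≤ (M₀ / B) ^ N * ((Real.sqrt N)⁻¹ * (ζ.re⁻¹ * D ^ (-(3 / 4) : ℝ)) *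
          ((Real.sqrt ρ)⁻¹ * ρ ^ 2 * (ρ / (2 * (1 + C))) ^ (-(1 / 4) : ℝ))) *
          circleMajorant θ₀ θ := by
          have hb : 0 ≤ E * A / B := by positivity
          have hb2 : E * A / B ≤ M₀ / B := div_le_div_of_nonneg_right hc (norm_nonneg _)
          have hm0 : 0 ≤ Real.cos θ ^ (-(1 / 2) : ℝ) * |θ - θ₀| ^ (-(1 / 4) : ℝ) := by positivity
          gcongr
      _ = L * circleMajorant θ₀ θ := by rw [hL]; ring
  rw [intervalIntegral.integral_const_mul] at key
  calc _ ≤ Real.pi⁻¹ * (L * ∫ θ in (-(Real.pi / 2))..(Real.pi / 2), circleMajorant θ₀ θ) := by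
        gcongr
    _ = _ := by rw [hL]; ring

theorem norm_nat_mul_macdonald_le {N : ℕ} (hN : 0 < N) {ζ : ℂ} (hζ : 0 < ζ.re) :
    ‖((N : ℝ) : ℂ) * macdonald (((N : ℝ) : ℂ) * ζ) * (2 * ζ)‖ ≤
      4 * ‖ζ‖ * (Real.sqrt ζ.re)⁻¹ * Real.sqrt N * Real.exp (-(2 * ζ.re)) ^ N := by
  have hN' : (0 : ℝ) < N := by exact_mod_cast hN
  have hre : (((N : ℝ) : ℂ) * ζ).re = N * ζ.re := by rw [Complex.re_ofReal_mul]
  have h := norm_macdonald_le (ζ := ((N : ℝ) : ℂ) * ζ) (by rw [hre]; positivity)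
  rw [hre] at h
  have h4 : Real.sqrt (Real.pi / 4) ≤ 1 := by
    rw [Real.sqrt_le_one]
    linarith [Real.pi_le_four]
  have hexp : Real.exp (-(2 * (N * ζ.re))) = Real.exp (-(2 * ζ.re)) ^ N := by
    rw [← Real.exp_nat_mul]; congr 1; ring
  have hsq : (N : ℝ) / Real.sqrt N = Real.sqrt N := Real.div_sqrt
  rw [hexp, Real.sqrt_mul hN'.le] at h
  rw [norm_mul, norm_mul, norm_mul, Complex.norm_real, Real.norm_of_nonneg hN'.le,
    Complex.norm_ofNat]
  calc _ ≤ N * (2 * 1 * (Real.exp (-(2 * ζ.re)) ^ N / (Real.sqrt N * Real.sqrt ζ.re))) *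
        (2 * ‖ζ‖) := by
        refine mul_le_mul_of_nonneg_right (mul_le_mul_of_nonneg_left (h.trans ?_) hN'.le)
          (by positivity)
        gcongr
    _ = 4 * ‖ζ‖ * (Real.sqrt ζ.re)⁻¹ * (N / Real.sqrt N) * Real.exp (-(2 * ζ.re)) ^ N := by
        field_simp; ring
    _ = _ := by rw [hsq]

/-- The exponentials cancel, which gives a bound uniform in N for dominated convergence. -/
theorem norm_main_term_le {N : ℕ} (hN : 0 < N) {ζ : ℂ} (hζ : 0 < ζ.re) :
    ‖((N : ℝ) : ℂ) * macdonald (((N : ℝ) : ℂ) * ζ) * (2 * ζ) *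
      besselSeries (((N : ℝ) : ℂ) * ζ)‖ ≤ 4 * ‖ζ‖ * ζ.re⁻¹ := by
  have hN' : (0 : ℝ) < N := by exact_mod_cast hN
  have hre : (((N : ℝ) : ℂ) * ζ).re = N * ζ.re := by rw [Complex.re_ofReal_mul]
  have h1 := norm_nat_mul_macdonald_le hN hζ
  have h2 := norm_besselSeries_le_of_re_pos (ζ := ((N : ℝ) : ℂ) * ζ) (by rw [hre]; positivity)
  rw [hre] at h2
  have hexp : Real.exp (2 * (N * ζ.re)) = Real.exp (2 * ζ.re) ^ N := by
    rw [← Real.exp_nat_mul]; congr 1; ring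
  have hcancel : Real.exp (-(2 * ζ.re)) ^ N * Real.exp (2 * ζ.re) ^ N = 1 := by
    rw [← mul_pow, ← Real.exp_add]; simp
  have hs : Real.sqrt ζ.re * Real.sqrt ζ.re = ζ.re := Real.mul_self_sqrt hζ.le
  have hsN : 0 < Real.sqrt N := Real.sqrt_pos.mpr hN'
  have hsz : 0 < Real.sqrt ζ.re := Real.sqrt_pos.mpr hζ
  rw [hexp, Real.sqrt_mul hN'.le] at h2
  rw [norm_mul]
  calc _ ≤ (4 * ‖ζ‖ * (Real.sqrt ζ.re)⁻¹ * Real.sqrt N * Real.exp (-(2 * ζ.re)) ^ N) *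
        (Real.exp (2 * ζ.re) ^ N / (Real.sqrt N * Real.sqrt ζ.re)) := by gcongr
    _ = 4 * ‖ζ‖ * (Real.sqrt ζ.re * Real.sqrt ζ.re)⁻¹ *
        (Real.exp (-(2 * ζ.re)) ^ N * Real.exp (2 * ζ.re) ^ N) := by field_simp
    _ = _ := by rw [hcancel, hs, mul_one]

/-- The limit of the integral of the kernel integrand over one segment of the path: `δ` is the
indicator of the disk of radius `ρ` on that segment. -/
theorem tendsto_segIntegral_kernelIntegrand {ρ θ₀ C c τ y M₀ δ : ℝ} {P Q : ℂ} (hρ : 0 < ρ)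
    (hy : 0 < y) (hC : 0 ≤ C) (hc : 0 < c)
    (hθ₀ : θ₀ ∈ Set.Ioo (-(Real.pi / 2)) (Real.pi / 2)) (hM₀ : 0 ≤ M₀)
    (hcirc : ∀ θ ∈ Set.Ioo (-(Real.pi / 2)) (Real.pi / 2), growthRate y (polarPoint ρ θ) ≤ M₀)
    (hmem : ∀ t ∈ Set.Icc (0 : ℝ) 1, segPoint P Q t ∈ quadrantMinus y)
    (hbig : ∀ t ∈ Set.Ioo (0 : ℝ) 1, M₀ < growthRate y (segPoint P Q t))
    (hdist : ∀ t ∈ Set.Ioo (0 : ℝ) 1, c * |t - τ| ≤ |‖segPoint P Q t‖ - ρ|)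
    (hnear : ∀ t ∈ Set.Ioo (0 : ℝ) 1,
      ‖segPoint P Q t - polarPoint ρ θ₀‖ ≤ C * |‖segPoint P Q t‖ - ρ|)
    (hδ : ∀ t ∈ Set.Ioo (0 : ℝ) 1, (if ‖segPoint P Q t‖ < ρ then 1 else 0) = δ) :
    Tendsto (fun N : ℕ => segIntegral (kernelIntegrand N y N) P Q) atTop
      (𝓝 (-((δ / y : ℝ) : ℂ) * (Q - P))) := by
  obtain ⟨t₁, ht₁, hmin⟩ := isCompact_Icc.exists_isMinOn (Set.nonempty_Icc.mpr zero_le_one)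
    (Complex.continuous_re.comp (continuous_segPoint P Q)).continuousOn
  obtain ⟨t₂, ht₂, hmax⟩ := isCompact_Icc.exists_isMaxOn (Set.nonempty_Icc.mpr zero_le_one)
    (continuous_segPoint P Q).norm.continuousOn
  set r := (segPoint P Q t₁).re with hr
  set R := ‖segPoint P Q t₂‖ with hR
  have hr0 : 0 < r := (hmem t₁ ht₁).1
  have hre : ∀ t ∈ Set.Icc (0 : ℝ) 1, r ≤ (segPoint P Q t).re := fun t ht => hmin ht
  have hnorm : ∀ t ∈ Set.Icc (0 : ℝ) 1, ‖segPoint P Q t‖ ≤ R := fun t ht => hmax ht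
  set G := Real.pi⁻¹ * ((Real.sqrt ρ)⁻¹ * ρ ^ 2 * (ρ / (2 * (1 + C))) ^ (-(1 / 4) : ℝ)) *
    ∫ θ in (-(Real.pi / 2))..(Real.pi / 2), circleMajorant θ₀ θ with hG
  have hG0 : 0 ≤ G := by
    have : 0 ≤ ∫ θ in (-(Real.pi / 2))..(Real.pi / 2), circleMajorant θ₀ θ :=
      intervalIntegral.integral_nonneg (by linarith [Real.pi_pos]) fun θ _ => by
        unfold circleMajorant; positivity
    positivity
  set rem : ℕ → ℂ → ℂ := fun N ζ => halfAvg (fun θ => besselSeries (((N : ℝ) : ℂ) *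
    polarPoint ρ θ) * (((1 - y / polarPoint ρ θ ^ 2) / (1 - y / ζ ^ 2)) ^ N *
      (polarPoint ρ θ ^ 2 / (polarPoint ρ θ ^ 2 - ζ ^ 2)))) with hrem
  set main : ℕ → ℂ → ℂ := fun N ζ => ((N : ℝ) : ℂ) * macdonald (((N : ℝ) : ℂ) * ζ) * (2 * ζ) *
    besselSeries (((N : ℝ) : ℂ) * ζ) with hmain
  set err : ℕ → ℂ → ℂ := fun N ζ => ((N : ℝ) : ℂ) * macdonald (((N : ℝ) : ℂ) * ζ) * (2 * ζ) *
    ((y : ℂ)⁻¹ * rem N ζ) with herr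
  -- The parameter τ, where the segment may touch the circle, is a null set and is left out.
  have hsplit : ∀ t ∈ Set.Ioo (0 : ℝ) 1, t ≠ τ → ∀ N : ℕ,
      kernelIntegrand N y N (segPoint P Q t) =
        err N (segPoint P Q t) - ((δ / y : ℝ) : ℂ) * main N (segPoint P Q t) := by
    intro t ht htτ N
    have hne : ‖segPoint P Q t‖ ≠ ρ := by
      have h1 := hdist t ht
      have h2 : 0 < c * |t - τ| := mul_pos hc (abs_pos.mpr (sub_ne_zero.mpr htτ))
      intro h3
      rw [h3, sub_self, abs_zero] at h1
      linarith
    rw [kernelIntegrand_eq hρ hy N N (hmem t (Set.Ioo_subset_Icc_self ht)) hne]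
    simp only [herr, hmain, hrem]
    have h3 : (if ‖segPoint P Q t‖ < ρ then besselSeries (((N : ℝ) : ℂ) * segPoint P Q t) else 0) =
        (δ : ℂ) * besselSeries (((N : ℝ) : ℂ) * segPoint P Q t) := by
      rw [← hδ t ht]
      split_ifs <;> simp
    rw [h3]
    push_cast
    ring
  -- The factors √N and 1/√N cancel, leaving the N-th power of a ratio below 1 times an integrable
  -- power of |t-τ|.
  have herrb : ∀ t ∈ Set.Ioo (0 : ℝ) 1, t ≠ τ → ∀ N : ℕ, 0 < N → ‖err N (segPoint P Q t)‖ ≤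
      (M₀ / growthRate y (segPoint P Q t)) ^ N *
        (4 * R * (Real.sqrt r)⁻¹ * y⁻¹ * r⁻¹ * G * (c * |t - τ|) ^ (-(3 / 4) : ℝ)) := by
    intro t ht htτ N hN
    have htI := Set.Ioo_subset_Icc_self ht
    set ζ := segPoint P Q t with hζ
    have hζre : 0 < ζ.re := (hmem t htI).1
    have hD : 0 < c * |t - τ| := mul_pos hc (abs_pos.mpr (sub_ne_zero.mpr htτ))
    have h1 := norm_halfAvg_remainder_le hρ hC hD hθ₀ hM₀ hcirc hN hζre (hdist t ht) (hnear t ht)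
    rw [← hG] at h1
    have h2 := norm_nat_mul_macdonald_le hN hζre
    have hsN : 0 < Real.sqrt N := Real.sqrt_pos.mpr (by exact_mod_cast hN)
    have e1 : Real.exp (-(2 * ζ.re)) ^ N * (M₀ / ‖1 - y / ζ ^ 2‖) ^ N =
        (M₀ / growthRate y ζ) ^ N := by
      rw [← mul_pow, growthRate, Real.exp_neg, mul_comm (Real.exp _), ← div_div]
      congr 1
      field_simp
    have hrle := hre t htI
    have hnle := hnorm t htI
    have hs : (Real.sqrt ζ.re)⁻¹ ≤ (Real.sqrt r)⁻¹ :=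
      inv_anti₀ (Real.sqrt_pos.mpr hr0) (Real.sqrt_le_sqrt hrle)
    have hi : ζ.re⁻¹ ≤ r⁻¹ := inv_anti₀ hr0 hrle
    have hg0 : 0 ≤ (M₀ / growthRate y ζ) ^ N := by
      unfold growthRate; positivity
    have hq0 : 0 ≤ (c * |t - τ|) ^ (-(3 / 4) : ℝ) := by positivity
    simp only [herr, hrem]
    rw [norm_mul, norm_mul ((y : ℂ)⁻¹), norm_inv, Complex.norm_real, Real.norm_of_nonneg hy.le]
    calc _ ≤ (4 * ‖ζ‖ * (Real.sqrt ζ.re)⁻¹ * Real.sqrt N * Real.exp (-(2 * ζ.re)) ^ N) *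
          (y⁻¹ * ((M₀ / ‖1 - y / ζ ^ 2‖) ^ N * (Real.sqrt N)⁻¹ *
            (ζ.re⁻¹ * (c * |t - τ|) ^ (-(3 / 4) : ℝ)) * G)) := by gcongr
      _ = (Real.exp (-(2 * ζ.re)) ^ N * (M₀ / ‖1 - y / ζ ^ 2‖) ^ N) *
          (4 * ‖ζ‖ * (Real.sqrt ζ.re)⁻¹ * y⁻¹ * ζ.re⁻¹ * G * (c * |t - τ|) ^ (-(3 / 4) : ℝ)) := by
          field_simp
      _ ≤ _ := by
          rw [e1]
          gcongr
  have hu : Set.uIoc (0 : ℝ) 1 = Set.Ioc 0 1 := Set.uIoc_of_le zero_le_one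
  have hn1 : ∀ᵐ t : ℝ ∂volume, t ≠ τ := by rw [ae_iff]; simp
  have hn2 : ∀ᵐ t : ℝ ∂volume, t ≠ 1 := by rw [ae_iff]; simp
  have hlim : -((δ / y : ℝ) : ℂ) * (Q - P) =
      ∫ _ in (0 : ℝ)..1, -((δ / y : ℝ) : ℂ) * (Q - P) := by simp
  rw [hlim]
  -- The ratio of growth rates is at most 1, which gives the majorant, and less than 1, which sends
  -- the error to 0 pointwise; the main term tends to 1.
  refine intervalIntegral.tendsto_integral_filter_of_dominated_convergence
    (fun t => (4 * R * (Real.sqrt r)⁻¹ * y⁻¹ * r⁻¹ * G * c ^ (-(3 / 4) : ℝ) *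
      |t - τ| ^ (-(3 / 4) : ℝ) + |δ / y| * (4 * R * r⁻¹)) * ‖Q - P‖) ?_ ?_ ?_ ?_
  · filter_upwards [eventually_gt_atTop 0] with N hN
    have h1 := intervalIntegrable_segPoint hmem
      (continuousOn_kernelIntegrand (y := y) (N := N) (by exact_mod_cast hN) N)
    rw [hu]
    exact h1.1.aestronglyMeasurable
  · filter_upwards [eventually_gt_atTop 0] with N hN
    filter_upwards [hn1, hn2] with t ht1 ht2 ht
    rw [hu] at ht
    have ht' : t ∈ Set.Ioo (0 : ℝ) 1 := ⟨ht.1, lt_of_le_of_ne ht.2 ht2⟩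
    have htI := Set.Ioo_subset_Icc_self ht'
    rw [norm_mul, hsplit t ht' ht1]
    gcongr
    refine (norm_sub_le _ _).trans (add_le_add ?_ ?_)
    · refine (herrb t ht' ht1 N hN).trans ?_
      rw [Real.mul_rpow hc.le (abs_nonneg _)]
      have hb := hbig t ht'
      have hle : (M₀ / growthRate y (segPoint P Q t)) ^ N ≤ 1 := by
        refine pow_le_one₀ (div_nonneg hM₀ (hM₀.trans hb.le)) ?_
        exact div_le_one_of_le₀ hb.le (hM₀.trans hb.le)
      refine (mul_le_of_le_one_left ?_ hle).trans_eq (by ring)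
      have : 0 ≤ R := norm_nonneg _
      positivity
    · rw [norm_mul, Complex.norm_real, Real.norm_eq_abs]
      refine mul_le_mul_of_nonneg_left ?_ (abs_nonneg _)
      refine (norm_main_term_le hN (hmem t htI).1).trans ?_
      have := inv_anti₀ hr0 (hre t htI)
      have := hnorm t htI
      have := (hmem t htI).1
      gcongr
  · refine IntervalIntegrable.mul_const ?_ _
    exact ((intervalIntegrable_abs_sub_rpow (by norm_num) τ 0 1).const_mul _).add
      intervalIntegrable_const
  · filter_upwards [hn1, hn2] with t ht1 ht2 ht
    rw [hu] at ht
    have ht' : t ∈ Set.Ioo (0 : ℝ) 1 := ⟨ht.1, lt_of_le_of_ne ht.2 ht2⟩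
    have htI := Set.Ioo_subset_Icc_self ht'
    refine Tendsto.mul_const _ ?_
    simp only [hsplit t ht' ht1]
    have hb := hbig t ht'
    have h1 : Tendsto (fun N => err N (segPoint P Q t)) atTop (𝓝 0) := by
      have hlt : M₀ / growthRate y (segPoint P Q t) < 1 :=
        (div_lt_one (hM₀.trans_lt hb)).mpr hb
      have h2 := (tendsto_pow_atTop_nhds_zero_of_lt_one
        (div_nonneg hM₀ (hM₀.trans hb.le)) hlt).mul_const
        (4 * R * (Real.sqrt r)⁻¹ * y⁻¹ * r⁻¹ * G * (c * |t - τ|) ^ (-(3 / 4) : ℝ))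
      rw [zero_mul] at h2
      refine squeeze_zero_norm' ?_ h2
      filter_upwards [eventually_gt_atTop 0] with N hN using herrb t ht' ht1 N hN
    have h2 : Tendsto (fun N => main N (segPoint P Q t)) atTop (𝓝 1) := by
      refine (tendsto_macdonald_mul_besselSeries (hmem t htI).1).congr fun N => ?_
      simp only [hmain, Complex.ofReal_natCast]
      ring
    simpa using h1.sub (h2.const_mul ((δ / y : ℝ) : ℂ))

theorem tendsto_correlationKernel {P : ℕ → ℂ} {n : ℕ} {y : ℝ} (hP : IsQuadrantPath P n y)
    {l : ℕ → ℂ} (hl : ∀ i < n, Tendsto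
      (fun N : ℕ => segIntegral (kernelIntegrand N y N) (P i) (P (i + 1))) atTop (𝓝 (l i)))
    {p q : ℕ → ℝ[X]} (h : IsBiorthogonalSystem p q) :
    Tendsto (fun N : ℕ => (N : ℝ) * correlationKernel p q N ((N : ℝ) ^ 2 * y) ((N : ℝ) ^ 2 * y))
      atTop (𝓝 (-Real.pi⁻¹ * (∑ i ∈ Finset.range n, l i).im)) := by
  have hy : 0 < y := lt_of_le_of_lt (sq_nonneg _) hP.sq_start
  have h1 : Tendsto (fun N : ℕ => pathIntegral (kernelIntegrand N y N) P n) atTop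
      (𝓝 (∑ i ∈ Finset.range n, l i)) :=
    tendsto_finsetSum _ fun i hi => hl i (Finset.mem_range.mp hi)
  have h2 := ((Complex.continuous_im.tendsto _).comp h1).const_mul (-Real.pi⁻¹)
  refine h2.congr' ?_
  filter_upwards [eventually_gt_atTop 0] with N hN
  have hN' : (0 : ℝ) < N := by exact_mod_cast hN
  rw [h.correlationKernel_eq N (by positivity), hP.kernel_eq N hN']
  rfl

/-! ### Size of the growth rate, and the outer segments. -/

theorem mem_quadrantMinus_of_im_pos {y : ℝ} {ζ : ℂ} (h1 : 0 < ζ.re) (h2 : 0 < ζ.im) :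
    ζ ∈ quadrantMinus y := by
  refine ⟨h1, h2.le, fun h => ?_⟩
  have := congrArg Complex.im h
  rw [sq, Complex.mul_im, Complex.ofReal_im] at this
  nlinarith [mul_pos h1 h2]

theorem mem_quadrantMinus_of_norm_sq_ne {y : ℝ} (hy : 0 < y) {ζ : ℂ} (h1 : 0 < ζ.re)
    (h2 : 0 ≤ ζ.im) (h : ‖ζ‖ ^ 2 ≠ y) : ζ ∈ quadrantMinus y := by
  refine ⟨h1, h2, fun h0 => h ?_⟩
  rw [← norm_pow, h0, Complex.norm_real, Real.norm_of_nonneg hy.le]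

theorem norm_sq_eq (ζ : ℂ) : ‖ζ‖ ^ 2 = ζ.re ^ 2 + ζ.im ^ 2 := by
  rw [Complex.sq_norm, Complex.normSq_apply]; ring

theorem growthRate_sq (y : ℝ) {ζ : ℂ} (hζ : ζ ≠ 0) : growthRate y ζ ^ 2 =
    Real.exp (4 * ζ.re) * (((ζ.re ^ 2 + ζ.im ^ 2) ^ 2 - 2 * y * (ζ.re ^ 2 - ζ.im ^ 2) + y ^ 2) /
      (ζ.re ^ 2 + ζ.im ^ 2) ^ 2) := by
  have h1 : 1 - (y : ℂ) / ζ ^ 2 = (ζ ^ 2 - y) / ζ ^ 2 := by field_simp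
  rw [growthRate, mul_pow, ← Real.exp_nat_mul, h1, norm_div, div_pow, norm_pow, norm_sq_eq ζ,
    norm_sq_eq (ζ ^ 2 - y)]
  congr 2
  · push_cast; ring
  · simp only [sq, Complex.sub_re, Complex.sub_im, Complex.mul_re, Complex.mul_im,
      Complex.ofReal_re, Complex.ofReal_im]
    ring

/-- Far to the right the exponential dominates, so the path can be brought down to the real axis
there. -/
theorem growthRate_ge_of_le_re {y X : ℝ} (hy : 0 < y) {ζ : ℂ} (hX : 0 < X)
    (hre : X ≤ ζ.re) : Real.exp (2 * X) * (1 - y / X ^ 2) ≤ growthRate y ζ := by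
  have hn : X ≤ ‖ζ‖ := hre.trans (Complex.re_le_norm ζ)
  have h1 : ‖(y : ℂ) / ζ ^ 2‖ ≤ y / X ^ 2 := by
    rw [norm_div, norm_pow, Complex.norm_real, Real.norm_of_nonneg hy.le]
    gcongr
  have h2 : 1 - y / X ^ 2 ≤ ‖1 - (y : ℂ) / ζ ^ 2‖ := by
    have := norm_sub_norm_le (1 : ℂ) ((y : ℂ) / ζ ^ 2)
    rw [norm_one] at this
    linarith
  have h3 : Real.exp (2 * X) ≤ Real.exp (2 * ζ.re) := Real.exp_le_exp.mpr (by linarith)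
  rw [growthRate]
  calc _ ≤ Real.exp (2 * X) * ‖1 - (y : ℂ) / ζ ^ 2‖ := by gcongr
    _ ≤ _ := by gcongr

/-- Near the origin the pole y/ζ² dominates, so the path can leave the real axis there. -/
theorem growthRate_ge_of_norm_sq_le {y d : ℝ} (hy : 0 < y) {ζ : ℂ} (hζ : 0 < ζ.re)
    (hn : ‖ζ‖ ^ 2 ≤ d) : y / d - 1 ≤ growthRate y ζ := by
  have hn0 : 0 < ‖ζ‖ := hζ.trans_le (Complex.re_le_norm ζ)
  have h1 : y / d ≤ ‖(y : ℂ) / ζ ^ 2‖ := by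
    rw [norm_div, norm_pow, Complex.norm_real, Real.norm_of_nonneg hy.le]
    gcongr
  have h2 : y / d - 1 ≤ ‖1 - (y : ℂ) / ζ ^ 2‖ := by
    have := norm_sub_norm_le ((y : ℂ) / ζ ^ 2) 1
    rw [norm_one, norm_sub_rev] at this
    linarith
  have h3 : 1 ≤ Real.exp (2 * ζ.re) := Real.one_le_exp (by linarith)
  rw [growthRate]
  calc _ ≤ 1 * ‖1 - (y : ℂ) / ζ ^ 2‖ := by rw [one_mul]; exact h2
    _ ≤ _ := by gcongr

section Segments

variable {ρ θ₀ y M₀ : ℝ} (hρ : 0 < ρ) (hy : 0 < y)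
  (hθ₀ : θ₀ ∈ Set.Ioo (-(Real.pi / 2)) (Real.pi / 2)) (hM₀ : 0 ≤ M₀)
  (hcirc : ∀ θ ∈ Set.Ioo (-(Real.pi / 2)) (Real.pi / 2), growthRate y (polarPoint ρ θ) ≤ M₀)
include hρ hy hθ₀ hM₀ hcirc

/-- The case of a segment at a positive distance from the circle. -/
theorem tendsto_segIntegral_of_far {δ ε : ℝ} {P Q : ℂ} (hε : 0 < ε)
    (hmem : ∀ t ∈ Set.Icc (0 : ℝ) 1, segPoint P Q t ∈ quadrantMinus y)
    (hbig : ∀ t ∈ Set.Ioo (0 : ℝ) 1, M₀ < growthRate y (segPoint P Q t))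
    (hfar : ∀ t ∈ Set.Ioo (0 : ℝ) 1, ε ≤ |‖segPoint P Q t‖ - ρ|)
    (hδ : ∀ t ∈ Set.Ioo (0 : ℝ) 1, (if ‖segPoint P Q t‖ < ρ then 1 else 0) = δ) :
    Tendsto (fun N : ℕ => segIntegral (kernelIntegrand N y N) P Q) atTop
      (𝓝 (-((δ / y : ℝ) : ℂ) * (Q - P))) := by
  -- Off the circle the contact conditions hold trivially: τ = 0 and c = ε work since t < 1, and C
  -- absorbs |ζ| + ρ ≤ ||ζ|-ρ| + 2ρ.
  refine tendsto_segIntegral_kernelIntegrand (τ := 0) (C := 1 + 2 * ρ / ε) hρ hy (by positivity)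
    hε hθ₀ hM₀ hcirc hmem hbig (fun t ht => ?_) (fun t ht => ?_) hδ
  · rw [sub_zero, abs_of_pos ht.1]
    have := hfar t ht
    nlinarith [ht.2]
  · have h1 := hfar t ht
    have h2 : ‖segPoint P Q t - polarPoint ρ θ₀‖ ≤ ‖segPoint P Q t‖ + ρ := by
      have := norm_sub_le (segPoint P Q t) (polarPoint ρ θ₀)
      rwa [norm_polarPoint hρ.le] at this
    have h3 := le_abs_self (‖segPoint P Q t‖ - ρ)
    have h4 : 2 * ρ ≤ 2 * ρ / ε * |‖segPoint P Q t‖ - ρ| := by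
      rw [div_mul_eq_mul_div, le_div_iff₀ hε]
      gcongr
    rw [add_mul, one_mul]
    linarith

/-- The two segments of the path beyond the critical point `a + b i`. -/
theorem tendsto_segIntegral_outer {a b : ℝ} (ha : 0 < a) (hb : 0 ≤ b)
    (hab : polarPoint ρ θ₀ = ⟨a, b⟩) (hab' : a ^ 2 + b ^ 2 = ρ ^ 2)
    (hmem : (⟨a, b⟩ : ℂ) ∈ quadrantMinus y)
    (hmono : ∀ s : ℝ, 0 < s → M₀ < growthRate y ⟨a + s, b + s⟩) {L : ℝ}
    (hL : L = ρ + 1 + 2 * y + M₀) :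
    (∀ t ∈ Set.Icc (0 : ℝ) 1, segPoint ⟨a, b⟩ ⟨a + L, b + L⟩ t ∈ quadrantMinus y) ∧
    (∀ t ∈ Set.Icc (0 : ℝ) 1, segPoint ⟨a + L, b + L⟩ ⟨a + L, 0⟩ t ∈ quadrantMinus y) ∧
    Tendsto (fun N : ℕ => segIntegral (kernelIntegrand N y N) ⟨a, b⟩ ⟨a + L, b + L⟩) atTop
      (𝓝 0) ∧
    Tendsto (fun N : ℕ => segIntegral (kernelIntegrand N y N) ⟨a + L, b + L⟩ ⟨a + L, 0⟩) atTop
      (𝓝 0) ∧ y < (a + L) ^ 2 := by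
  -- In L the part ρ + 1 keeps the vertical segment outside the disk at distance at least 1, 1 + 2y
  -- makes y/(a+L)² ≤ 1/2, and M₀ lets e^{2(a+L)}/2 exceed M₀.
  have hL0 : 0 < L := by rw [hL]; positivity
  have hLy : y < (a + L) ^ 2 := by
    have : 1 + 2 * y ≤ a + L := by rw [hL]; linarith
    nlinarith
  have hseg : ∀ t, segPoint ⟨a, b⟩ ⟨a + L, b + L⟩ t = ⟨a + t * L, b + t * L⟩ := by
    intro t
    apply Complex.ext
    · rw [segPoint_re]; ring
    · rw [segPoint_im]; ring
  have hseg2 : ∀ t, segPoint ⟨a + L, b + L⟩ ⟨a + L, 0⟩ t = ⟨a + L, (1 - t) * (b + L)⟩ := by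
    intro t
    apply Complex.ext
    · rw [segPoint_re]; ring
    · rw [segPoint_im]; ring
  have hm1 : ∀ t ∈ Set.Icc (0 : ℝ) 1, segPoint ⟨a, b⟩ ⟨a + L, b + L⟩ t ∈ quadrantMinus y := by
    intro t ht
    rw [hseg]
    rcases ht.1.eq_or_lt with rfl | h0
    · simpa using hmem
    · exact mem_quadrantMinus_of_im_pos (by positivity) (by positivity)
  have hnormge : ∀ t ∈ Set.Icc (0 : ℝ) 1, L ≤ ‖segPoint ⟨a + L, b + L⟩ ⟨a + L, 0⟩ t‖ := by
    intro t _
    rw [hseg2]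
    refine le_trans ?_ (Complex.re_le_norm _)
    simp only
    linarith
  have hm2 : ∀ t ∈ Set.Icc (0 : ℝ) 1, segPoint ⟨a + L, b + L⟩ ⟨a + L, 0⟩ t ∈ quadrantMinus y := by
    intro t ht
    refine mem_quadrantMinus_of_norm_sq_ne hy ?_ ?_ ?_
    · rw [hseg2]; simp only; linarith
    · rw [hseg2]; simp only
      have := ht.2
      exact mul_nonneg (by linarith) (by linarith)
    · rw [hseg2, norm_sq_eq]
      simp only
      have := sq_nonneg ((1 - t) * (b + L))
      linarith
  refine ⟨hm1, hm2, ?_, ?_, hLy⟩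
  · have hsub : ∀ t ∈ Set.Ioo (0 : ℝ) 1, t * L ≤ ‖segPoint ⟨a, b⟩ ⟨a + L, b + L⟩ t‖ - ρ := by
      intro t ht
      have htL : 0 < t * L := mul_pos ht.1 hL0
      have : ρ + t * L ≤ ‖segPoint ⟨a, b⟩ ⟨a + L, b + L⟩ t‖ := by
        refine le_of_sq_le_sq ?_ (norm_nonneg _)
        rw [hseg, norm_sq_eq]
        simp only
        -- Because of this inequality the modulus grows at least as fast as ρ + tL along the
        -- diagonal.
        have hab2 : ρ ≤ a + b := by
          refine le_of_sq_le_sq ?_ (by positivity)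
          rw [← hab']
          nlinarith [mul_nonneg ha.le hb]
        nlinarith [mul_le_mul_of_nonneg_right hab2 htL.le, sq_nonneg (t * L)]
      linarith
    have h := tendsto_segIntegral_kernelIntegrand (τ := 0) (C := 2) (c := L) (δ := 0)
      (P := ⟨a, b⟩) (Q := ⟨a + L, b + L⟩) hρ hy (by norm_num) hL0 hθ₀ hM₀ hcirc hm1
      (fun t ht => ?_) (fun t ht => ?_) (fun t ht => ?_) (fun t ht => ?_)
    · simpa using h
    · rw [hseg]
      exact hmono _ (mul_pos ht.1 hL0)
    · rw [sub_zero, abs_of_pos ht.1, mul_comm]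
      exact (hsub t ht).trans (le_abs_self _)
    · have h1 : ‖segPoint ⟨a, b⟩ ⟨a + L, b + L⟩ t - polarPoint ρ θ₀‖ ≤ 2 * (t * L) := by
        have htL : 0 < t * L := mul_pos ht.1 hL0
        rw [hab, hseg]
        refine le_of_sq_le_sq ?_ (by positivity)
        rw [norm_sq_eq]
        simp only [Complex.sub_re, Complex.sub_im]
        nlinarith [sq_nonneg (t * L)]
      have := (hsub t ht).trans (le_abs_self _)
      linarith
    · rw [if_neg]
      have := hsub t ht
      have htL : 0 < t * L := mul_pos ht.1 hL0
      linarith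
  · have hge : ∀ t ∈ Set.Icc (0 : ℝ) 1, 1 ≤ ‖segPoint ⟨a + L, b + L⟩ ⟨a + L, 0⟩ t‖ - ρ := by
      intro t ht
      have := hnormge t ht
      linarith
    have h := tendsto_segIntegral_of_far (δ := 0) (ε := 1) (P := ⟨a + L, b + L⟩)
      (Q := ⟨a + L, 0⟩) hρ hy hθ₀ hM₀ hcirc one_pos hm2
      (fun t ht => ?_) (fun t ht => ?_) (fun t ht => ?_)
    · simpa using h
    · have h1 := growthRate_ge_of_le_re (X := a + L) hy (by positivity)
        (ζ := segPoint ⟨a + L, b + L⟩ ⟨a + L, 0⟩ t) (by rw [hseg2])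
      refine lt_of_lt_of_le ?_ h1
      have hX : 1 + 2 * y + M₀ ≤ a + L := by rw [hL]; linarith
      have h2 : y / (a + L) ^ 2 ≤ 1 / 2 := by
        rw [div_le_div_iff₀ (by positivity) two_pos]
        nlinarith
      have h3 := Real.add_one_le_exp (2 * (a + L))
      have h4 : Real.exp (2 * (a + L)) * (1 / 2) ≤
          Real.exp (2 * (a + L)) * (1 - y / (a + L) ^ 2) := by
        gcongr
        linarith
      linarith
    · exact (hge t (Set.Ioo_subset_Icc_self ht)).trans (le_abs_self _)
    · rw [if_neg]
      have := hge t (Set.Ioo_subset_Icc_self ht)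
      linarith

end Segments

/-! ### Monotonicity along the diagonal, and the case y ≥ 27/4. -/

/-- Growth along the direction `1 + i`. -/
theorem growthRate_lt_of_diagonal {y a b : ℝ} (ha : 0 < a)
    (hpos : ∀ s : ℝ, 0 < s → 0 < ((((a + s) ^ 2 + (b + s) ^ 2) ^ 2 -
      2 * y * ((a + s) ^ 2 - (b + s) ^ 2) + y ^ 2) * ((a + s) ^ 2 + (b + s) ^ 2) +
      y * (((a + s) - (b + s)) * ((a + s) ^ 2 + (b + s) ^ 2 + 4 * (a + s) * (b + s)) -
        y * ((a + s) + (b + s))))) {s : ℝ} (hs : 0 < s) :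
    growthRate y ⟨a, b⟩ < growthRate y ⟨a + s, b + s⟩ := by
  -- The squared growth rate along the diagonal; the expression in `hpos` is the numerator of its
  -- derivative up to a positive factor.
  set F : ℝ → ℝ := fun s => Real.exp (4 * (a + s)) * (((((a + s) ^ 2 + (b + s) ^ 2) ^ 2 -
      2 * y * ((a + s) ^ 2 - (b + s) ^ 2) + y ^ 2)) / ((a + s) ^ 2 + (b + s) ^ 2) ^ 2) with hF
  have hF' : ∀ s, 0 ≤ s → growthRate y ⟨a + s, b + s⟩ ^ 2 = F s := by
    intro s hs
    rw [growthRate_sq y]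
    intro h
    have := congrArg Complex.re h
    simp at this
    linarith
  have hQ : ∀ s, 0 ≤ s → (a + s) ^ 2 + (b + s) ^ 2 ≠ 0 := by
    intro s hs
    have : 0 < a + s := by linarith
    positivity
  have hder : ∀ s, 0 ≤ s → HasDerivAt F (Real.exp (4 * (a + s)) * (4 *
      ((((a + s) ^ 2 + (b + s) ^ 2) ^ 2 -
      2 * y * ((a + s) ^ 2 - (b + s) ^ 2) + y ^ 2) * ((a + s) ^ 2 + (b + s) ^ 2) +
      y * (((a + s) - (b + s)) * ((a + s) ^ 2 + (b + s) ^ 2 + 4 * (a + s) * (b + s)) -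
        y * ((a + s) + (b + s))))) / ((a + s) ^ 2 + (b + s) ^ 2) ^ 3) s := by
    intro s hs
    have hq := hQ s hs
    have d1 : HasDerivAt (fun s : ℝ => (a + s) ^ 2) (2 * (a + s)) s := by
      exact (((hasDerivAt_id s).const_add a).pow 2).congr_deriv (by simp)
    have d2 : HasDerivAt (fun s : ℝ => (b + s) ^ 2) (2 * (b + s)) s := by
      exact (((hasDerivAt_id s).const_add b).pow 2).congr_deriv (by simp)
    have d3 : HasDerivAt (fun s : ℝ => Real.exp (4 * (a + s))) (Real.exp (4 * (a + s)) * 4) s := by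
      exact ((((hasDerivAt_id s).const_add a).const_mul 4).exp).congr_deriv (by simp)
    have d4 : HasDerivAt (fun s : ℝ => ((a + s) ^ 2 + (b + s) ^ 2) ^ 2)
        (2 * ((a + s) ^ 2 + (b + s) ^ 2) * (2 * (a + s) + 2 * (b + s))) s :=
      ((d1.add d2).pow 2).congr_deriv (by simp)
    have d5 : HasDerivAt (fun s : ℝ => ((a + s) ^ 2 + (b + s) ^ 2) ^ 2 -
        2 * y * ((a + s) ^ 2 - (b + s) ^ 2) + y ^ 2)
        (2 * ((a + s) ^ 2 + (b + s) ^ 2) * (2 * (a + s) + 2 * (b + s)) -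
          2 * y * (2 * (a + s) - 2 * (b + s))) s :=
      (d4.sub ((d1.sub d2).const_mul (2 * y))).add_const (y ^ 2)
    refine (d3.mul (d5.div d4 (pow_ne_zero 2 hq))).congr_deriv ?_
    generalize Real.exp (4 * (a + s)) = e
    simp only [Pi.div_apply]
    generalize hqq : (a + s) ^ 2 + (b + s) ^ 2 = q at *
    field_simp
    rw [← hqq]
    ring
  have hmono : StrictMonoOn F (Set.Icc 0 s) := by
    refine strictMonoOn_of_deriv_pos (convex_Icc 0 s)
      (fun u hu => (hder u hu.1).continuousAt.continuousWithinAt) fun u hu => ?_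
    rw [interior_Icc] at hu
    rw [(hder u hu.1.le).deriv]
    have h1 := hpos u hu.1
    have : 0 < a + u := by linarith [hu.1]
    have : 0 < (a + u) ^ 2 + (b + u) ^ 2 := by positivity
    positivity
  have h1 := hmono (Set.left_mem_Icc.mpr hs.le) (Set.right_mem_Icc.mpr hs.le) hs
  rw [← hF' 0 le_rfl, ← hF' s hs.le, add_zero, add_zero] at h1
  refine lt_of_pow_lt_pow_left₀ 2 ?_ h1
  unfold growthRate
  positivity

/-- From the edge `27 / 4` on, the growth rate on the circle of radius `3 / 2` is largest at the
real point. -/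
theorem growthRate_polarPoint_le_of_edge_le {y : ℝ} (hy : 27 / 4 ≤ y) (θ : ℝ) :
    growthRate y (polarPoint (3 / 2) θ) ≤ Real.exp 3 * (4 * y / 9 - 1) := by
  have hne := polarPoint_ne_zero (ρ := 3 / 2) (by norm_num) θ
  have hnorm := norm_sq_eq (polarPoint (3 / 2) θ)
  rw [norm_polarPoint (by norm_num)] at hnorm
  have hX : (polarPoint (3 / 2) θ).re ≤ 3 / 2 := by
    exact (Complex.re_le_norm _).trans_eq (norm_polarPoint (by norm_num) θ)
  refine le_of_sq_le_sq ?_ (by have := Real.exp_pos 3; have : 0 ≤ 4 * y / 9 - 1 := by linarith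
                               positivity)
  rw [growthRate_sq y hne, ← hnorm, mul_pow, ← Real.exp_nat_mul]
  set X := (polarPoint (3 / 2) θ).re
  set Y := (polarPoint (3 / 2) θ).im
  have hY : Y ^ 2 = 9 / 4 - X ^ 2 := by linarith
  rw [hY]
  -- The bound e^t ≥ 1 + t leaves a polynomial inequality in the nonnegative quantities u = y - 27/4
  -- and w = 3/2 - X.
  have h1 := Real.add_one_le_exp (4 * (3 / 2 - X))
  have h2 : Real.exp ((2 : ℕ) * 3) = Real.exp (4 * X) * Real.exp (4 * (3 / 2 - X)) := by
    rw [← Real.exp_add]; congr 1; push_cast; ring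
  rw [h2, mul_assoc (Real.exp (4 * X)) (Real.exp _)]
  refine mul_le_mul_of_nonneg_left ?_ (Real.exp_pos _).le
  have h3 : (4 * (3 / 2 - X) + 1) * (4 * y / 9 - 1) ^ 2 ≤
      Real.exp (4 * (3 / 2 - X)) * (4 * y / 9 - 1) ^ 2 := by gcongr
  refine le_trans ?_ h3
  rw [div_le_iff₀ (by norm_num)]
  obtain ⟨u, rfl⟩ : ∃ u, y = 27 / 4 + u := ⟨y - 27 / 4, by ring⟩
  have hu : 0 ≤ u := by linarith
  obtain ⟨w, hw⟩ : ∃ w, X = 3 / 2 - w := ⟨3 / 2 - X, by ring⟩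
  have hw0 : 0 ≤ w := by linarith
  rw [hw]
  nlinarith [mul_nonneg hw0 hu, mul_nonneg hw0 (sq_nonneg u), mul_nonneg hu (sq_nonneg w),
    sq_nonneg w]

/-- In terms of u = y - 27/4 the only negative coefficient is that of -12uσ³, and the square
2σ²(u-3σ)² absorbs it. -/
theorem growthRate_lt_of_edge_le {y : ℝ} (hy : 27 / 4 ≤ y) {s : ℝ} (hs : 0 < s) :
    growthRate y ⟨3 / 2, 0⟩ < growthRate y ⟨3 / 2 + s, 0 + s⟩ := by
  refine growthRate_lt_of_diagonal (by norm_num) (fun σ hσ => ?_) hs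
  obtain ⟨u, rfl⟩ : ∃ u, y = 27 / 4 + u := ⟨y - 27 / 4, by ring⟩
  have hu : 0 ≤ u := by linarith
  have h : 0 < (27 / 8 * u + 3 / 4 * u ^ 2) + u ^ 2 * σ + (243 / 4 + 9 * u + 2 * u ^ 2) * σ ^ 2 +
      (27 - 12 * u) * σ ^ 3 + 81 * σ ^ 4 + 36 * σ ^ 5 + 8 * σ ^ 6 := by
    have h1 : 0 ≤ 2 * u ^ 2 * σ ^ 2 - 12 * u * σ ^ 3 + 18 * σ ^ 4 := by
      nlinarith [sq_nonneg (σ * (u - 3 * σ))]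
    have h2 : 0 < (27 / 8 * u + 3 / 4 * u ^ 2) + u ^ 2 * σ + (243 / 4 + 9 * u) * σ ^ 2 +
      27 * σ ^ 3 + 63 * σ ^ 4 + 36 * σ ^ 5 + 8 * σ ^ 6 := by positivity
    linarith
  refine h.trans_eq ?_
  ring

theorem growthRate_at_three_halves {y : ℝ} (hy : 27 / 4 ≤ y) :
    growthRate y ⟨3 / 2, 0⟩ = Real.exp 3 * (4 * y / 9 - 1) := by
  have h : (⟨3 / 2, 0⟩ : ℂ) = ((3 / 2 : ℝ) : ℂ) := rfl
  rw [growthRate, h, ← Complex.ofReal_pow, ← Complex.ofReal_div, ← Complex.ofReal_one,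
    ← Complex.ofReal_sub, Complex.norm_real, Complex.ofReal_re, Real.norm_eq_abs,
    abs_of_nonpos (by norm_num; linarith)]
  congr 1
  · norm_num
  · ring

/-- The path starts at 3/2 on the circle, to the left of √y, and then stays outside the disk, so no
segment contributes. The point 3/2 is the double saddle for y = 27/4 and remains a usable starting
point beyond. -/
theorem tendsto_correlationKernel_of_edge_le {y : ℝ} (hy : 27 / 4 ≤ y) {p q : ℕ → ℝ[X]}
    (h : IsBiorthogonalSystem p q) :
    Tendsto (fun N : ℕ => (N : ℝ) * correlationKernel p q N ((N : ℝ) ^ 2 * y) ((N : ℝ) ^ 2 * y))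
      atTop (𝓝 0) := by
  have hy0 : 0 < y := by linarith
  set M₀ := Real.exp 3 * (4 * y / 9 - 1) with hM
  have hM0 : 0 ≤ M₀ := mul_nonneg (Real.exp_pos _).le (by linarith)
  have hpi := Real.pi_pos
  have hθ : (0 : ℝ) ∈ Set.Ioo (-(Real.pi / 2)) (Real.pi / 2) := ⟨by linarith, by linarith⟩
  have hpol : polarPoint (3 / 2) 0 = ⟨3 / 2, 0⟩ := by
    apply Complex.ext
    · rw [polarPoint_re]; simp
    · rw [polarPoint_im]; simp
  set L := 3 / 2 + 1 + 2 * y + M₀ with hL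
  have hL0 : 0 < L := by positivity
  obtain ⟨m1, m2, t1, t2, hend⟩ := tendsto_segIntegral_outer (ρ := 3 / 2) (θ₀ := 0) (by norm_num)
    hy0 hθ hM0 (fun θ _ => growthRate_polarPoint_le_of_edge_le hy θ) (a := 3 / 2) (b := 0)
    (by norm_num) le_rfl hpol (by norm_num)
    (mem_quadrantMinus_of_norm_sq_ne hy0 (by norm_num) le_rfl
      (by rw [norm_sq_eq]; norm_num; linarith))
    (fun s hs => by rw [hM, ← growthRate_at_three_halves hy]; exact growthRate_lt_of_edge_le hy hs)
    hL
  set P : ℕ → ℂ := fun i => if i = 0 then ⟨3 / 2, 0⟩ else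
    if i = 1 then ⟨3 / 2 + L, 0 + L⟩ else ⟨3 / 2 + L, 0⟩ with hP
  have hpath : IsQuadrantPath P 2 y :=
    { mem := by
        intro i hi
        interval_cases i
        · exact m1
        · exact m2
      im_start := rfl
      im_end := rfl
      re_start := by simp [hP]
      re_end := by simp only [hP]; norm_num; positivity
      sq_start := by simp only [hP]; norm_num; linarith
      sq_end := by simpa [hP] using hend }
  have := tendsto_correlationKernel hpath (l := fun _ => 0) (fun i hi => by
    interval_cases i
    · exact t1
    · exact t2) h
  simpa using this

/-! ### The bulk: a complex saddle. -/

/-- `a + b i` is the critical point of the growth rate for the parameter `y` in the bulk. -/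
structure IsBulkPoint (y a b : ℝ) : Prop where
  re_pos : 0 < a
  im_pos : 0 < b
  im_sq : b ^ 2 * (1 + 2 * a) = a ^ 2 * (3 - 2 * a)
  param : y * (1 + 2 * a) = 8 * a ^ 3

namespace IsBulkPoint

variable {y a b : ℝ} (h : IsBulkPoint y a b)
include h

/-- Together with `param_eq'` this expresses the real and imaginary parts of ζ³ - yζ + y = 0 at ζ =
a + bi. -/
theorem param_eq : y = 2 * a * (a ^ 2 + b ^ 2) := by
  have h0 := h.re_pos
  have h1 : (1 + 2 * a) ≠ 0 := by positivity
  apply mul_right_cancel₀ h1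
  linear_combination h.param - 2 * a * h.im_sq

theorem param_eq' : y = 3 * a ^ 2 - b ^ 2 := by
  have h0 := h.re_pos
  have h1 : (1 + 2 * a) ≠ 0 := by positivity
  apply mul_right_cancel₀ h1
  linear_combination h.param + h.im_sq

theorem sq_add_sq : (a ^ 2 + b ^ 2) * (1 + 2 * a) = 4 * a ^ 2 := by
  linear_combination h.im_sq

theorem param_pos : 0 < y := by
  have h0 := h.re_pos
  rw [h.param_eq]; positivity

theorem re_lt : 2 * a < 3 := by
  have h0 := h.re_pos
  have h1 := h.im_pos
  have h2 : 0 < a ^ 2 * (3 - 2 * a) := by rw [← h.im_sq]; positivity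
  have := (mul_pos_iff_of_pos_left (by positivity)).mp h2
  linarith

theorem growthRate_sq_of_norm {ζ : ℂ} (hζ : ζ.re ^ 2 + ζ.im ^ 2 = a ^ 2 + b ^ 2) :
    growthRate y ζ ^ 2 =
      Real.exp (4 * ζ.re) * ((1 + 2 * a) * (1 + 2 * a - 2 * ζ.re ^ 2 / a)) := by
  have h0 := h.re_pos
  have hne : ζ ≠ 0 := by
    rintro rfl
    simp only [Complex.zero_re, Complex.zero_im] at hζ
    nlinarith [sq_nonneg b]
  rw [growthRate_sq y hne]
  congr 1
  have h1 : ζ.im ^ 2 = a ^ 2 + b ^ 2 - ζ.re ^ 2 := by linarith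
  rw [hζ, h1, h.param_eq]
  have hr : a ^ 2 + b ^ 2 = 4 * a ^ 2 / (1 + 2 * a) := by
    rw [eq_div_iff (by positivity)]; exact h.sq_add_sq
  rw [hr]
  field_simp
  ring

theorem growthRate_critical_sq :
    growthRate y ⟨a, b⟩ ^ 2 = Real.exp (4 * a) * (1 + 2 * a) := by
  have h0 := h.re_pos
  rw [h.growthRate_sq_of_norm rfl]
  simp only
  congr 1
  field_simp
  ring

/-- On this circle the growth rate depends on X = Re ζ only, and 1 + 2a - 2X²/a ≤ 1 + 4(a-X) ≤
e^{4(a-X)}, where the first inequality is 2(a-X)²/a ≥ 0. -/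
theorem growthRate_le_of_norm {ζ : ℂ} (hζ : ζ.re ^ 2 + ζ.im ^ 2 = a ^ 2 + b ^ 2) :
    growthRate y ζ ≤ growthRate y ⟨a, b⟩ := by
  have h0 := h.re_pos
  refine le_of_sq_le_sq ?_ (by unfold growthRate; positivity)
  rw [h.growthRate_sq_of_norm hζ, h.growthRate_critical_sq]
  set X := ζ.re
  have h1 : Real.exp (4 * a) = Real.exp (4 * X) * Real.exp (4 * (a - X)) := by
    rw [← Real.exp_add]; congr 1; ring
  rw [h1, mul_assoc, mul_comm (Real.exp (4 * (a - X)))]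
  gcongr
  refine le_trans ?_ (Real.add_one_le_exp _)
  have h2 : 0 ≤ 2 * (a - X) ^ 2 / a := by positivity
  have h3 : 2 * (a - X) ^ 2 / a = 2 * a - 4 * X + 2 * X ^ 2 / a := by field_simp; ring
  linarith

/-- With b = aT and s = aσ, using y = 2(1+T²)a³ in some places and y = (3-T²)a² in the others makes
the expression homogeneous in a. Division by a⁶σ leaves a polynomial with positive coefficients. -/
theorem growthRate_lt_of_diagonal {s : ℝ} (hs : 0 < s) :
    growthRate y ⟨a, b⟩ < growthRate y ⟨a + s, b + s⟩ := by
  have h0 := h.re_pos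
  refine _root_.growthRate_lt_of_diagonal h0 (fun s hs => ?_) hs
  obtain ⟨T, hT⟩ : ∃ T, b = a * T := ⟨b / a, by field_simp⟩
  obtain ⟨σ, rfl⟩ : ∃ σ, s = a * σ := ⟨s / a, by field_simp⟩
  have hT0 : 0 < T := by
    have := h.im_pos
    rw [hT] at this
    exact (mul_pos_iff_of_pos_left h0).mp this
  have hσ : 0 < σ := (mul_pos_iff_of_pos_left h0).mp hs
  have e1 : y = 2 * (1 + T ^ 2) * a ^ 3 := by rw [h.param_eq, hT]; ring
  have e2 : y = (3 - T ^ 2) * a ^ 2 := by rw [h.param_eq', hT]; ring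
  have key : ∀ y₁ y₂ : ℝ, y = y₁ → y = y₂ → 0 < (((a + a * σ) ^ 2 + (b + a * σ) ^ 2) ^ 2 -
      2 * y₂ * ((a + a * σ) ^ 2 - (b + a * σ) ^ 2) + y₂ ^ 2) *
        ((a + a * σ) ^ 2 + (b + a * σ) ^ 2) +
      y₁ * (((a + a * σ) - (b + a * σ)) *
        ((a + a * σ) ^ 2 + (b + a * σ) ^ 2 + 4 * (a + a * σ) * (b + a * σ)) -
        y₂ * ((a + a * σ) + (b + a * σ))) → 0 < (((a + a * σ) ^ 2 + (b + a * σ) ^ 2) ^ 2 -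
      2 * y * ((a + a * σ) ^ 2 - (b + a * σ) ^ 2) + y ^ 2) *
        ((a + a * σ) ^ 2 + (b + a * σ) ^ 2) +
      y * (((a + a * σ) - (b + a * σ)) *
        ((a + a * σ) ^ 2 + (b + a * σ) ^ 2 + 4 * (a + a * σ) * (b + a * σ)) -
        y * ((a + a * σ) + (b + a * σ))) := by
    rintro _ _ rfl rfl h
    exact h
  refine key _ _ e1 e2 ?_
  have hpos : 0 < a ^ 6 * σ * ((24 * T + 24 * T ^ 3) +
      (12 + 12 * T + 84 * T ^ 2 + 12 * T ^ 3 + 8 * T ^ 4) * σ +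
      (8 + 72 * T + 56 * T ^ 2 + 24 * T ^ 3) * σ ^ 2 + (36 + 48 * T + 36 * T ^ 2) * σ ^ 3 +
      (24 + 24 * T) * σ ^ 4 + 8 * σ ^ 5) := by positivity
  refine hpos.trans_eq ?_
  rw [hT]
  ring

/-- On the ray to the saddle the growth rate depends on g = 2a in (0, 3) only. Its derivative
contains the factor s - 1, and the cofactor is written as a sum of terms positive for 0 < s < 1. -/
theorem growthRate_lt_of_radial {s : ℝ} (hs : 0 < s) (hs1 : s < 1) :
    growthRate y ⟨a, b⟩ < growthRate y ⟨s * a, s * b⟩ := by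
  have h0 := h.re_pos
  set g := 2 * a with hg
  have hg0 : 0 < g := by positivity
  have hg3 : g < 3 := h.re_lt
  set F : ℝ → ℝ := fun s => Real.exp (2 * g * s) *
    ((s ^ 4 - g * (g - 1) * s ^ 2 + g ^ 2) / s ^ 4) with hF
  have hF' : ∀ s, 0 < s → growthRate y ⟨s * a, s * b⟩ ^ 2 = F s := by
    intro s hs
    rw [growthRate_sq y]
    · simp only [hF]
      have e0 : 4 * (s * a) = 2 * g * s := by rw [hg]; ring
      rw [e0]
      congr 1
      have hr : a ^ 2 + b ^ 2 = 4 * a ^ 2 / (1 + 2 * a) := by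
        rw [eq_div_iff (by positivity)]; exact h.sq_add_sq
      have hb : b ^ 2 = 4 * a ^ 2 / (1 + 2 * a) - a ^ 2 := by rw [← hr]; ring
      rw [h.param_eq, mul_pow, mul_pow, hb, hg]
      field_simp
      ring
    · intro h1
      have := congrArg Complex.re h1
      simp at this
      rcases this with h2 | h2 <;> linarith
  have hder : ∀ s, 0 < s → HasDerivAt F (Real.exp (2 * g * s) * (2 * g * ((s - 1) *
      ((1 - g / 3) * (s ^ 4 + s ^ 3 + s ^ 2) + g / 3 * ((1 - s) * (s + 2) * (3 - s ^ 2)) +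
        (s ^ 2 + s) * (g * (3 - g))))) / s ^ 5) s := by
    intro s hs
    have d1 : HasDerivAt (fun s : ℝ => s ^ 4) (4 * s ^ 3) s := by
      simpa using hasDerivAt_pow 4 s
    have d2 : HasDerivAt (fun s : ℝ => s ^ 2) (2 * s) s := by
      simpa using hasDerivAt_pow 2 s
    have d3 : HasDerivAt (fun s : ℝ => Real.exp (2 * g * s)) (Real.exp (2 * g * s) * (2 * g)) s := by
      exact (((hasDerivAt_id s).const_mul (2 * g)).exp).congr_deriv (by simp)
    have d5 : HasDerivAt (fun s : ℝ => s ^ 4 - g * (g - 1) * s ^ 2 + g ^ 2)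
        (4 * s ^ 3 - g * (g - 1) * (2 * s)) s :=
      (d1.sub (d2.const_mul (g * (g - 1)))).add_const (g ^ 2)
    refine (d3.mul (d5.div d1 (by positivity))).congr_deriv ?_
    generalize Real.exp (2 * g * s) = e
    simp only [Pi.div_apply]
    clear_value g
    field_simp
    ring
  have hmono : StrictAntiOn F (Set.Icc s 1) := by
    refine strictAntiOn_of_deriv_neg (convex_Icc s 1) (fun u hu =>
      (hder u (hs.trans_le hu.1)).continuousAt.continuousWithinAt) fun u hu => ?_
    rw [interior_Icc] at hu
    have hu0 : 0 < u := hs.trans hu.1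
    rw [(hder u hu0).deriv]
    have h1 : 0 < 1 - u := by linarith [hu.2]
    have h2 : 0 < 1 - g / 3 := by linarith
    have h3 : 0 < 3 - g := by linarith
    have h4 : 0 < 3 - u ^ 2 := by nlinarith [hu.2]
    have h5 : 0 < (1 - g / 3) * (u ^ 4 + u ^ 3 + u ^ 2) +
        g / 3 * ((1 - u) * (u + 2) * (3 - u ^ 2)) + (u ^ 2 + u) * (g * (3 - g)) := by positivity
    have h6 : (u - 1) * ((1 - g / 3) * (u ^ 4 + u ^ 3 + u ^ 2) +
        g / 3 * ((1 - u) * (u + 2) * (3 - u ^ 2)) + (u ^ 2 + u) * (g * (3 - g))) < 0 :=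
      mul_neg_of_neg_of_pos (by linarith) h5
    refine div_neg_of_neg_of_pos ?_ (by positivity)
    exact mul_neg_of_pos_of_neg (Real.exp_pos _) (mul_neg_of_pos_of_neg (by positivity) h6)
  have h1 := hmono (Set.left_mem_Icc.mpr hs1.le) (Set.right_mem_Icc.mpr hs1.le) hs1
  rw [← hF' 1 one_pos, ← hF' s hs, one_mul, one_mul] at h1
  refine lt_of_pow_lt_pow_left₀ 2 ?_ h1
  unfold growthRate
  positivity

end IsBulkPoint

theorem exists_polarPoint_eq {a b : ℝ} (ha : 0 < a) :
    ∃ θ ∈ Set.Ioo (-(Real.pi / 2)) (Real.pi / 2), polarPoint ‖(⟨a, b⟩ : ℂ)‖ θ = ⟨a, b⟩ := by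
  refine ⟨Complex.arg ⟨a, b⟩, ?_, ?_⟩
  · exact abs_lt.mp (Complex.abs_arg_lt_pi_div_two_iff.mpr (Or.inl ha))
  · exact Complex.norm_mul_exp_arg_mul_I _

namespace IsBulkPoint

variable {y a b : ℝ} (h : IsBulkPoint y a b)
include h

/-- The first two segments lie inside the disk and the last two outside. The sum of the limits is
-1/y times the displacement from the real point δa to the saddle, with imaginary part -b/y. -/
theorem tendsto_correlationKernel {p q : ℕ → ℝ[X]} (hpq : IsBiorthogonalSystem p q) :
    Tendsto (fun N : ℕ => (N : ℝ) * correlationKernel p q N ((N : ℝ) ^ 2 * y) ((N : ℝ) ^ 2 * y))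
      atTop (𝓝 (b / (Real.pi * y))) := by
  have ha := h.re_pos
  have hb := h.im_pos
  have hy := h.param_pos
  have hpi := Real.pi_pos
  set M₀ := growthRate y ⟨a, b⟩ with hM
  have hM0 : 0 ≤ M₀ := by rw [hM]; unfold growthRate; positivity
  obtain ⟨θ₀, hθ₀, hpol⟩ := exists_polarPoint_eq (b := b) ha
  set ρ := ‖(⟨a, b⟩ : ℂ)‖ with hρd
  have hρsq : a ^ 2 + b ^ 2 = ρ ^ 2 := (norm_sq_eq ⟨a, b⟩).symm
  have hρ : 0 < ρ := ha.trans_le (Complex.re_le_norm (⟨a, b⟩ : ℂ))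
  have hcirc : ∀ θ ∈ Set.Ioo (-(Real.pi / 2)) (Real.pi / 2),
      growthRate y (polarPoint ρ θ) ≤ M₀ := fun θ _ => h.growthRate_le_of_norm (by
    rw [← norm_sq_eq, norm_polarPoint hρ.le, hρsq])
  have hyρ : y = 2 * a * ρ ^ 2 := by rw [← hρsq]; exact h.param_eq
  set L := ρ + 1 + 2 * y + M₀ with hL
  have hL0 : 0 < L := by positivity
  obtain ⟨m2, m3, t2, t3, hend⟩ := tendsto_segIntegral_outer hρ hy hθ₀ hM0 hcirc ha hb.le hpol
    hρsq (mem_quadrantMinus_of_im_pos ha hb) (fun s hs => h.growthRate_lt_of_diagonal hs) hL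
  -- On the initial segment the growth rate is at least y/(δρ)² - 1 = 2a/δ² - 1; δ is small enough
  -- for this to exceed M₀.
  obtain ⟨δ, hδ0, hδ1, hδ2⟩ : ∃ δ : ℝ, 0 < δ ∧ δ ≤ 1 / 2 ∧ δ * (M₀ + 1) ≤ a := by
    refine ⟨min (1 / 2) (a / (M₀ + 1)), lt_min (by norm_num) (by positivity), min_le_left _ _, ?_⟩
    rw [← le_div_iff₀ (by positivity)]
    exact min_le_right _ _
  have hδa : δ ≤ a := by nlinarith
  have hδsq : δ ^ 2 < 2 * a := by nlinarith
  have hδy : (δ * ρ) ^ 2 < y := by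
    rw [hyρ, mul_pow]
    gcongr
  -- the initial vertical segment
  have hseg0 : ∀ t, segPoint ⟨δ * a, 0⟩ ⟨δ * a, δ * b⟩ t = ⟨δ * a, t * (δ * b)⟩ := by
    intro t
    apply Complex.ext
    · rw [segPoint_re]; ring
    · rw [segPoint_im]; ring
  have hn0 : ∀ t ∈ Set.Icc (0 : ℝ) 1,
      ‖segPoint ⟨δ * a, 0⟩ ⟨δ * a, δ * b⟩ t‖ ^ 2 ≤ (δ * ρ) ^ 2 := by
    intro t ht
    rw [hseg0, norm_sq_eq]
    simp only
    rw [mul_pow δ ρ, ← hρsq, mul_pow, mul_pow, mul_pow]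
    have : t ^ 2 ≤ 1 := by nlinarith [ht.1, ht.2]
    have h1 : t ^ 2 * (δ ^ 2 * b ^ 2) ≤ 1 * (δ ^ 2 * b ^ 2) := by gcongr
    linarith
  have hn0' : ∀ t ∈ Set.Icc (0 : ℝ) 1, ‖segPoint ⟨δ * a, 0⟩ ⟨δ * a, δ * b⟩ t‖ ≤ ρ / 2 := by
    intro t ht
    refine (le_of_sq_le_sq (hn0 t ht) (by positivity)).trans ?_
    nlinarith
  have m0 : ∀ t ∈ Set.Icc (0 : ℝ) 1,
      segPoint ⟨δ * a, 0⟩ ⟨δ * a, δ * b⟩ t ∈ quadrantMinus y := by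
    intro t ht
    refine mem_quadrantMinus_of_norm_sq_ne hy ?_ ?_ ((hn0 t ht).trans_lt hδy).ne
    · rw [hseg0]; simp only; positivity
    · rw [hseg0]; have := ht.1; simp only; positivity
  have t0 := tendsto_segIntegral_of_far (δ := 1) (ε := ρ / 2) (P := ⟨δ * a, 0⟩)
    (Q := ⟨δ * a, δ * b⟩) hρ hy hθ₀ hM0 hcirc (by positivity) m0
    (fun t ht => by
      refine lt_of_lt_of_le ?_ (growthRate_ge_of_norm_sq_le hy
        (m0 t (Set.Ioo_subset_Icc_self ht)).1 (hn0 t (Set.Ioo_subset_Icc_self ht)))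
      rw [lt_sub_iff_add_lt, lt_div_iff₀ (by positivity), hyρ, mul_pow, ← mul_assoc]
      refine mul_lt_mul_of_pos_right ?_ (by positivity)
      nlinarith)
    (fun t ht => by
      have := hn0' t (Set.Ioo_subset_Icc_self ht)
      rw [abs_of_nonpos (by linarith)]
      linarith)
    (fun t ht => by
      have := hn0' t (Set.Ioo_subset_Icc_self ht)
      rw [if_pos (by linarith)])
  -- the radial segment
  have hseg1 : ∀ t, segPoint ⟨δ * a, δ * b⟩ ⟨a, b⟩ t =
      ⟨(1 - (1 - t) * (1 - δ)) * a, (1 - (1 - t) * (1 - δ)) * b⟩ := by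
    intro t
    apply Complex.ext
    · rw [segPoint_re]; ring
    · rw [segPoint_im]; ring
  have hr : ∀ t ∈ Set.Icc (0 : ℝ) 1, 0 < 1 - (1 - t) * (1 - δ) := by
    intro t ht
    nlinarith [ht.1, ht.2]
  have hmul : ∀ s : ℝ, (⟨s * a, s * b⟩ : ℂ) = s * ⟨a, b⟩ := by
    intro s
    apply Complex.ext <;> simp
  have hn1 : ∀ t ∈ Set.Icc (0 : ℝ) 1,
      ‖segPoint ⟨δ * a, δ * b⟩ ⟨a, b⟩ t‖ - ρ = -((1 - t) * (1 - δ) * ρ) := by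
    intro t ht
    rw [hseg1, hmul, norm_mul, Complex.norm_real, Real.norm_of_nonneg (hr t ht).le, ← hρd]
    ring
  have m1 : ∀ t ∈ Set.Icc (0 : ℝ) 1,
      segPoint ⟨δ * a, δ * b⟩ ⟨a, b⟩ t ∈ quadrantMinus y := by
    intro t ht
    rw [hseg1]
    exact mem_quadrantMinus_of_im_pos (mul_pos (hr t ht) ha) (mul_pos (hr t ht) hb)
  have hpos1 : ∀ t ∈ Set.Ioo (0 : ℝ) 1, 0 < (1 - t) * (1 - δ) := fun t ht =>
    mul_pos (by linarith [ht.2]) (by linarith)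
  -- The radial segment reaches the circle at its end, t = 1, and along a ray the distance to the
  -- circle is the distance to the saddle, so C = 1.
  have t1 := tendsto_segIntegral_kernelIntegrand (τ := 1) (C := 1) (c := (1 - δ) * ρ) (δ := 1)
    (P := ⟨δ * a, δ * b⟩) (Q := ⟨a, b⟩) hρ hy zero_le_one
    (mul_pos (by linarith) hρ) hθ₀ hM0 hcirc m1
    (fun t ht => by
      rw [hseg1]
      exact h.growthRate_lt_of_radial (hr t (Set.Ioo_subset_Icc_self ht))
        (by linarith [hpos1 t ht]))
    (fun t ht => by
      have h1 := mul_pos (hpos1 t ht) hρ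
      rw [hn1 t (Set.Ioo_subset_Icc_self ht), abs_neg, abs_of_pos h1,
        abs_of_nonpos (by linarith [ht.2])]
      exact le_of_eq (by ring))
    (fun t ht => by
      have h1 := mul_pos (hpos1 t ht) hρ
      rw [hn1 t (Set.Ioo_subset_Icc_self ht), abs_neg, abs_of_pos h1, hpol, hseg1, hmul,
        ← sub_one_mul, norm_mul, ← hρd, ← Complex.ofReal_one, ← Complex.ofReal_sub,
        Complex.norm_real, Real.norm_eq_abs, sub_sub_cancel_left, abs_neg,
        abs_of_pos (hpos1 t ht), one_mul])
    (fun t ht => by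
      have h1 := mul_pos (hpos1 t ht) hρ
      have h2 := hn1 t (Set.Ioo_subset_Icc_self ht)
      rw [if_pos (by linarith)])
  set P : ℕ → ℂ := fun i => if i = 0 then ⟨δ * a, 0⟩ else if i = 1 then ⟨δ * a, δ * b⟩ else
    if i = 2 then ⟨a, b⟩ else if i = 3 then ⟨a + L, b + L⟩ else ⟨a + L, 0⟩ with hP
  set l : ℕ → ℂ := fun i => if i < 2 then -((1 / y : ℝ) : ℂ) * (P (i + 1) - P i) else 0 with hl
  have hpath : IsQuadrantPath P 4 y :=
    { mem := by
        intro i hi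
        interval_cases i
        · exact m0
        · exact m1
        · exact m2
        · exact m3
      im_start := rfl
      im_end := rfl
      re_start := mul_pos hδ0 ha
      re_end := add_pos ha hL0
      sq_start := by
        refine lt_of_le_of_lt ?_ hδy
        change (δ * a) ^ 2 ≤ _
        rw [mul_pow, mul_pow, ← hρsq]
        gcongr
        linarith [sq_nonneg b]
      sq_end := hend }
  have hlim := _root_.tendsto_correlationKernel hpath (l := l) (fun i hi => by
    interval_cases i
    · exact t0
    · exact t1
    · exact t2
    · exact t3) hpq
  convert hlim using 2
  have hsum : ∑ i ∈ Finset.range 4, l i =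
      -((1 / y : ℝ) : ℂ) * ((⟨a, b⟩ : ℂ) - ⟨δ * a, 0⟩) := by
    simp only [Finset.sum_range_succ, Finset.sum_range_zero, hl, hP]
    norm_num
    ring
  rw [hsum, ← Complex.ofReal_neg, Complex.im_ofReal_mul, Complex.sub_im]
  simp only
  field_simp
  ring

end IsBulkPoint

/-- Cardano's formula for ζ³ - yζ + y = 0: since y/2 = (3uv/2)³, the nonreal roots are
(3uv/2)((u+v)/2 ± i√3(u-v)/2). The cube roots u and v are those in `hFun`, and u³ + v³ = 2. -/
theorem exists_isBulkPoint {y : ℝ} (hy : y ∈ Set.Ioo (0 : ℝ) (27 / 4)) :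
    ∃ a b, IsBulkPoint y a b ∧ b / (Real.pi * y) = limitDensity y := by
  have hy0 := hy.1
  have hpi := Real.pi_pos
  have e1 : 1 - 4 * y / 27 < 1 := by linarith
  have e2 : 0 < 1 - 4 * y / 27 := by linarith [hy.2]
  set s := Real.sqrt (1 - 4 * y / 27) with hs
  have hs0 : 0 < s := Real.sqrt_pos.mpr e2
  have hssq : s ^ 2 = 1 - 4 * y / 27 := Real.sq_sqrt e2.le
  have hs1 : s < 1 := by nlinarith
  have cube : ∀ x : ℝ, 0 ≤ x → (x ^ (1 / 3 : ℝ)) ^ 3 = x := by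
    intro x hx
    rw [← Real.rpow_natCast, ← Real.rpow_mul hx]
    norm_num
  set u := (1 + s) ^ (1 / 3 : ℝ) with hu
  set v := (1 - s) ^ (1 / 3 : ℝ) with hv
  have hu3 : u ^ 3 = 1 + s := cube _ (by linarith)
  have hv3 : v ^ 3 = 1 - s := cube _ (by linarith)
  have hv0 : 0 < v := Real.rpow_pos_of_pos (by linarith) _
  have huv : v < u := Real.rpow_lt_rpow (by linarith) (by linarith) (by norm_num)
  have hu0 : 0 < u := hv0.trans huv
  have hprod : (u * v) ^ 3 = 4 * y / 27 := by
    rw [mul_pow, hu3, hv3]; linear_combination -hssq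
  have hyuv : y = 27 / 4 * (u * v) ^ 3 := by rw [hprod]; ring
  have h3 : Real.sqrt 3 ^ 2 = 3 := Real.sq_sqrt (by norm_num)
  have h30 : 0 < Real.sqrt 3 := Real.sqrt_pos.mpr (by norm_num)
  have hS : u ^ 3 + v ^ 3 = 2 := by rw [hu3, hv3]; ring
  have hA : 1 + 2 * (3 / 4 * (u * v) * (u + v)) = (u + v) ^ 3 / 2 := by
    linear_combination (-1 / 2 : ℝ) * hS
  refine ⟨3 / 4 * (u * v) * (u + v), 3 * Real.sqrt 3 / 4 * (u * v) * (u - v), ?_, ?_⟩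
  · refine ⟨by positivity, ?_, ?_, ?_⟩
    · have : 0 < u - v := by linarith
      positivity
    · rw [hA, mul_pow, mul_pow, div_pow, mul_pow, h3]
      have h4 : 3 - 2 * (3 / 4 * (u * v) * (u + v)) = 3 / 2 * (u + v) * (u - v) ^ 2 := by
        linear_combination (-3 / 2 : ℝ) * hS
      rw [h4]
      ring
    · rw [hA, hyuv]; ring
  · rw [limitDensity, if_pos hy, hFun, ← hs, ← hu, ← hv]
    have hpow : (4 * y / 27) ^ (2 / 3 : ℝ) = (u * v) ^ 2 := by
      rw [← hprod, ← Real.rpow_natCast, ← Real.rpow_mul (by positivity)]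
      norm_num
    rw [hpow, hyuv]
    field_simp

theorem tendsto_correlationKernel_limitDensity {p q : ℕ → ℝ[X]} (h : IsBiorthogonalSystem p q)
    {x : ℝ} (hx : 0 < x) :
    Tendsto (fun N : ℕ => (N : ℝ) * correlationKernel p q N ((N : ℝ) ^ 2 * x) ((N : ℝ) ^ 2 * x))
      atTop (𝓝 (limitDensity x)) := by
  rcases lt_or_ge x (27 / 4) with h1 | h1
  · obtain ⟨a, b, hab, h2⟩ := exists_isBulkPoint ⟨hx, h1⟩
    rw [← h2]
    exact hab.tendsto_correlationKernel h
  · rw [limitDensity, if_neg fun h2 => absurd h2.2 (not_lt.mpr h1)]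
    exact tendsto_correlationKernel_of_edge_le h1 h
theorem theorem1 {Ω : Type*} [MeasurableSpace Ω] (P : Measure Ω) [IsProbabilityMeasure P]
    (X₁ X₂ : (N : ℕ) → Ω → (Fin N → Fin N → ℂ))
    (hX₁ : ∀ N, HasLaw (X₁ N) (gaussianLaw N) P)
    (hX₂ : ∀ N, HasLaw (X₂ N) (gaussianLaw N) P)
    (hindep : ∀ N, IndepFun (X₁ N) (X₂ N) P) :
    -- the limit is a probability measure
    IsProbabilityMeasure limitMeasure ∧
    -- almost sure convergence of the scaled empirical measures, weakly and in moments
    (∀ᵐ ω ∂P,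
      (∀ f : BoundedContinuousFunction ℝ ℝ,
        Tendsto
          (fun N : ℕ =>
            ∫ x, f x ∂(scaledEmpiricalMeasure (Matrix.of (X₁ N ω) * Matrix.of (X₂ N ω))))
          atTop (𝓝 (∫ x, f x ∂limitMeasure))) ∧
      (∀ l : ℕ,
        Tendsto
          (fun N : ℕ =>
            ∫ x, x ^ l ∂(scaledEmpiricalMeasure (Matrix.of (X₁ N ω) * Matrix.of (X₂ N ω))))
          atTop (𝓝 (∫ x, x ^ l ∂limitMeasure)))) ∧
    -- the biorthogonal polynomials exist, and the kernel built from them has the stated limit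
    (∃ p q : ℕ → ℝ[X], IsBiorthogonalSystem p q) ∧
    (∀ p q : ℕ → ℝ[X], IsBiorthogonalSystem p q → ∀ x : ℝ, 0 < x →
      Tendsto
        (fun N : ℕ => (N : ℝ) * correlationKernel p q N ((N : ℝ) ^ 2 * x) ((N : ℝ) ^ 2 * x))
        atTop (𝓝 (limitDensity x))) := by
  refine ⟨isProbabilityMeasure_limitMeasure, ae_tendsto_scaledEmpiricalMeasure hX₁ hX₂ hindep,
    ⟨biorthLeft, monicLaguerre, isBiorthogonalSystem_biorthLeft_monicLaguerre⟩, ?_⟩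
  exact fun p q h x hx => tendsto_correlationKernel_limitDensity h hx
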